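/- Let $W\in R=\mathbb C[x_1,\dots,x_N]$ have a finite-dimensional Jacobi ring $\operatorname{Jac}(W)=R/(\partial_1W,\dots,\partial_NW)$, let $D$ be a matrix factorisation of $W$ (an odd polynomial supermatrix of size $2n$ with $D^2=W\cdot e$, where $e$ is the identity matrix), and let $A=\operatorname{End}(D)$ be the $\mathbb Z_2$-graded algebra of polynomial supermatrices of size $2n$, with $r_1(a)=Da-(-1)^{|a|}aD$ and $r_2(a\otimes b)=(-1)^{\tilde a}ab$, $\tilde a=|a|-1$. Let $\partial=\partial_1+\partial_2$ be the codifferential on the tensor coalgebra $(T_A,\Delta)$, $T_A=\bigoplus_{m\ge0}A[1]^{\otimes m}$, determined by $r_1,r_2$; for an operator $X$ between tensor coalgebras write $X_m^k$ for its component from tensor degree $m$ to tensor degree $k$. Choose a graded decomposition $A=H\oplus B\oplus L$ with $B=\operatorname{Im} r_1$ and $H\oplus B=\operatorname{Ker} r_1$, so that $H\cong H_{r_1}(A)$; let $\pi_H:A\to H$ be the projection along $B\oplus L$ and let $G:A\to A$ vanish on $H\oplus L$ and invert $r_1:L\to B$ on $B$. There is a unique pair $(F,\tilde\partial)$ of a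 coalgebra morphism $F:T_H\to T_A$ of degree $0$ with $F_0^1=0$ and a minimal $A_\infty$-structure $\tilde\partial$ on $H$ such that $\partial F=F\tilde\partial$, $F_1^1$ is the inclusion of $H$, and $F_m^1=-G\,\partial_2^1F_m^2$ for $m\ge2$. For $\alpha\in\mathbb C$ call $(\bar F,U)$ retraction data of type $\alpha$ if $\bar F:T_A\to T_H$ is a coalgebra morphism of degree $0$ with $\bar F_0^1=0$, $U\in\operatorname{End}(T_A)$ is odd with $U(1)=0$, and $$\bar F\partial=\tilde\partial\bar F,\qquad \bar FF=\mathrm{id},\qquad F\bar F-\mathrm{id}=\partial U+U\partial,$$ $$\Delta U=\big(U\otimes(\alpha\,\mathrm{id}+(1-\alpha)F\bar F)+((1-\alpha)\,\mathrm{id}+\alpha F\bar F)\otimes U\big)\Delta,$$ $$U_1^1=-G,\quad \bar F_1^1=\pi_H,\quad U_m^1=-G\,\partial_2^1U_m^2,\quad \bar F_m^1=\pi_H\,\partial_2^1U_m^2\quad(m\ge2).$$ For $\alpha=0$ and for $\alpha=1$ there are unique retraction data of type $\alpha$. For every $\alpha$, all retraction data of type $\alpha$ satisfy $UU=0$, $UF=0$,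 $\bar FU=0$. Let $(\phi_i)$ be polynomials whose classes form a basis of $\operatorname{Jac}(W)$, let $t=(t_i)$ be formal parameters of even degree, and let $\delta\in\operatorname{End}(T_A)[[t]]$ be the odd coderivation whose only component in $\operatorname{Hom}(A[1]^{\otimes m},A[1])$, $m\ge0$, is $\delta_0^1=\sum_it_i\phi_i\cdot e$. Then $\partial+\delta$ is a curved $A_\infty$-structure on $A$ over $\mathbb C[[t]]$. For all retraction data of any type $\alpha$, the bulk-induced deformation $\tilde\delta:=\sum_{m\ge1}\frac1{m!}M_m^1(\delta^{\wedge m})$ of $(H,\tilde\partial)$, where $$M_m^1(a_1\wedge\dots\wedge a_m)=\sum_{\sigma\in S_m}\varepsilon_{\sigma;a_1,\dots,a_m}\,\bar F\,a_{\sigma(1)}\,U\,a_{\sigma(2)}\cdots U\,a_{\sigma(m)}\,F$$ with the Koszul signs $\varepsilon_{\sigma;a_1,\dots,a_m}$ of the suspension of $\operatorname{End}(T_A)$, converges in $\operatorname{End}(T_H)[[t]]$ (each coefficient is a finite sum), $\mathrm{id}-\delta U$ is invertible in $\operatorname{End}(T_A)[[t]]$, and $$\tilde\delta=\sum_{m\ge0}\bar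 F(\delta U)^m\delta F=\bar F(\mathrm{id}-\delta U)^{-1}\delta F.$$ Moreover $\tilde\partial+\tilde\delta$ is a curved $A_\infty$-structure on $H$ over $\mathbb C[[t]]$. -/

import Mathlib

open scoped TensorProduct

noncomputable section

namespace LGBulk

/-! ## The tensor coalgebra of a super vector space

A super vector space `V` is given with the linear map `τ : V → V` that acts as `(-1)^(degree)`.
The space `T_V = ⨁ₙ V^{⊗n}` is `TensorAlgebra ℂ V`, whose product is concatenation of tensors. -/

section Coalgebra

variable {V V' : Type*} [AddCommGroup V] [Module ℂ V] [AddCommGroup V'] [Module ℂ V']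

/-- The operator on `T_V × (T_V ⊗ T_V)` that sends `(w, z)` to `(v w, 1 ⊗ v w + (v ⊗ 1) z)`. -/
def deconcatStep : V →ₗ[ℂ]
    Module.End ℂ (TensorAlgebra ℂ V × (TensorAlgebra ℂ V ⊗[ℂ] TensorAlgebra ℂ V)) where
  toFun v :=
    (LinearMap.mulLeft ℂ (TensorAlgebra.ι ℂ v) ∘ₗ LinearMap.fst ℂ _ _).prod
      (TensorProduct.mk ℂ _ _ 1 ∘ₗ LinearMap.mulLeft ℂ (TensorAlgebra.ι ℂ v) ∘ₗ
          LinearMap.fst ℂ _ _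
        + (LinearMap.mulLeft ℂ (TensorAlgebra.ι ℂ v)).rTensor _ ∘ₗ LinearMap.snd ℂ _ _)
  map_add' u v := by
    refine LinearMap.ext fun x => Prod.ext ?_ ?_
    · simp [add_mul]
    · have h : LinearMap.mulLeft ℂ (TensorAlgebra.ι ℂ u + TensorAlgebra.ι ℂ v)
          = LinearMap.mulLeft ℂ (TensorAlgebra.ι ℂ u)
            + LinearMap.mulLeft ℂ (TensorAlgebra.ι ℂ v) := by
        ext; simp [add_mul]
      simp [h, TensorProduct.tmul_add, LinearMap.rTensor_add]
      abel
  map_smul' c v := by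
    refine LinearMap.ext fun x => Prod.ext ?_ ?_
    · simp
    · have h : LinearMap.mulLeft ℂ (c • TensorAlgebra.ι ℂ v)
          = c • LinearMap.mulLeft ℂ (TensorAlgebra.ι ℂ v) := by
        ext; simp
      simp [h, LinearMap.rTensor_smul]

/-- The deconcatenation coproduct `Δ : T_V → T_V ⊗ T_V`; see `deconcat_prod` for its values. -/
def deconcat : TensorAlgebra ℂ V →ₗ[ℂ] TensorAlgebra ℂ V ⊗[ℂ] TensorAlgebra ℂ V where
  toFun x := (TensorAlgebra.lift ℂ deconcatStep x (1, 1 ⊗ₜ[ℂ] 1)).2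
  map_add' x y := by simp
  map_smul' c x := by simp

theorem deconcat_one :
    deconcat (1 : TensorAlgebra ℂ V) = 1 ⊗ₜ[ℂ] 1 := by
  simp [deconcat]

theorem lift_deconcatStep_fst (x w : TensorAlgebra ℂ V)
    (z : TensorAlgebra ℂ V ⊗[ℂ] TensorAlgebra ℂ V) :
    (TensorAlgebra.lift ℂ deconcatStep x (w, z)).1 = x * w := by
  induction x using TensorAlgebra.induction generalizing w z with
  | algebraMap r => simp [Module.algebraMap_end_apply, Algebra.smul_def]
  | ι v => simp [deconcatStep]
  | mul a b ha hb =>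
    have hb' := hb w z
    rcases h : TensorAlgebra.lift ℂ deconcatStep b (w, z) with ⟨w', z'⟩
    rw [h] at hb'
    rw [map_mul, Module.End.mul_apply, h, ha, mul_assoc, ← hb']
  | add a b ha hb => simp [ha, hb, add_mul]

theorem deconcat_ι_mul (v : V) (x : TensorAlgebra ℂ V) :
    deconcat (TensorAlgebra.ι ℂ v * x) = 1 ⊗ₜ[ℂ] (TensorAlgebra.ι ℂ v * x)
      + (LinearMap.mulLeft ℂ (TensorAlgebra.ι ℂ v)).rTensor _ (deconcat x) := by
  have h := lift_deconcatStep_fst x 1 (1 ⊗ₜ[ℂ] 1)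
  rw [mul_one] at h
  rcases h' : TensorAlgebra.lift ℂ deconcatStep x (1, 1 ⊗ₜ[ℂ] 1) with ⟨w, z⟩
  rw [h'] at h
  simp only at h
  subst h
  simp only [deconcat, LinearMap.coe_mk, AddHom.coe_mk, map_mul, Module.End.mul_apply,
    TensorAlgebra.lift_ι_apply, h']
  simp [deconcatStep]

/-- `Δ (v₁ ⊗ … ⊗ vₙ) = ∑_{j=0}^{n} (v₁ ⊗ … ⊗ vⱼ) ⊗ (vⱼ₊₁ ⊗ … ⊗ vₙ)`. -/
theorem deconcat_prod (l : List V) :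
    deconcat (l.map (TensorAlgebra.ι ℂ)).prod
      = ∑ j ∈ Finset.range (l.length + 1),
          ((l.take j).map (TensorAlgebra.ι ℂ)).prod ⊗ₜ[ℂ]
            ((l.drop j).map (TensorAlgebra.ι ℂ)).prod := by
  induction l with
  | nil => simp [deconcat_one]
  | cons v l ih =>
    rw [List.map_cons, List.prod_cons, deconcat_ι_mul, ih, List.length_cons,
      Finset.sum_range_succ' _ (l.length + 1), map_sum]
    simp [add_comm]

/-- The counit: the component in `V^{⊗0} = ℂ`. -/
def counit : TensorAlgebra ℂ V →ₗ[ℂ] ℂ := (TensorAlgebra.algebraMapInv).toLinearMap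

/-- The projection of `T_V` onto `V^{⊗1} = V`. -/
def pr₁ : TensorAlgebra ℂ V →ₗ[ℂ] V := TensorAlgebra.ιInv

/-- The projection of `T_V` onto `V^{⊗2} = V ⊗ V`. -/
def pr₂ : TensorAlgebra ℂ V →ₗ[ℂ] V ⊗[ℂ] V := TensorProduct.map pr₁ pr₁ ∘ₗ deconcat

/-- The operator `(-1)^(degree)` on `T_V`. -/
def tauT (τ : V →ₗ[ℂ] V) : TensorAlgebra ℂ V →ₗ[ℂ] TensorAlgebra ℂ V :=
  (TensorAlgebra.lift ℂ (TensorAlgebra.ι ℂ ∘ₗ τ)).toLinearMap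

/-- `f ⊗ g` for an odd map `g`, with the Koszul sign:
`(f ⊗ g)(x ⊗ y) = (-1)^(degree of x) f(x) ⊗ g(y)`. For even `g`, `f ⊗ g` is
`TensorProduct.map f g`. -/
def tensorOdd (τ : V →ₗ[ℂ] V) (f g : Module.End ℂ (TensorAlgebra ℂ V)) :
    TensorAlgebra ℂ V ⊗[ℂ] TensorAlgebra ℂ V →ₗ[ℂ] TensorAlgebra ℂ V ⊗[ℂ] TensorAlgebra ℂ V :=
  TensorProduct.map (f ∘ₗ tauT τ) g

/-- Odd operators on `T_V`. -/
def IsOdd (τ : V →ₗ[ℂ] V) (X : Module.End ℂ (TensorAlgebra ℂ V)) : Prop :=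
  X ∘ₗ tauT τ = -(tauT τ ∘ₗ X)

/-- Coderivations of odd degree on `T_V`: `Δ X = (X ⊗ id + id ⊗ X) Δ`. -/
structure IsOddCoderivation (τ : V →ₗ[ℂ] V) (X : Module.End ℂ (TensorAlgebra ℂ V)) : Prop where
  odd : IsOdd τ X
  coLeibniz : deconcat ∘ₗ X
    = (TensorProduct.map X LinearMap.id + tensorOdd τ LinearMap.id X) ∘ₗ deconcat

/-- The coderivation `∑ id^{⊗j} ⊗ r ⊗ id^{⊗k}` with components `r = ∑ rₙ : T_V → V`, all odd.
The Koszul sign is produced by letting `(-1)^(degree)` act on the first `j` tensor factors. -/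
def oddCoderivation (τ : V →ₗ[ℂ] V) (r : TensorAlgebra ℂ V →ₗ[ℂ] V) :
    Module.End ℂ (TensorAlgebra ℂ V) :=
  LinearMap.mul' ℂ _
    ∘ₗ TensorProduct.map
        (LinearMap.mul' ℂ _ ∘ₗ TensorProduct.map (tauT τ) (TensorAlgebra.ι ℂ ∘ₗ r) ∘ₗ deconcat)
        LinearMap.id
    ∘ₗ deconcat

/-- A strong `A_∞`-structure on a super vector space: an odd coderivation `b` on the tensor
coalgebra with `b² = 0` and with vanishing curvature. Here `V` is the suspended space. -/
structure IsAInfinity (τ : V →ₗ[ℂ] V) (b : Module.End ℂ (TensorAlgebra ℂ V)) : Prop where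
  coder : IsOddCoderivation τ b
  sq : b ∘ₗ b = 0
  strong : b 1 = 0

/-- Morphisms of degree 0 of tensor coalgebras `T_V → T_{V'}` with `F_0^1 = 0`. -/
structure IsStrongCoalgHom (τ : V →ₗ[ℂ] V) (τ' : V' →ₗ[ℂ] V')
    (F : TensorAlgebra ℂ V →ₗ[ℂ] TensorAlgebra ℂ V') : Prop where
  even : F ∘ₗ tauT τ = tauT τ' ∘ₗ F
  comul : deconcat ∘ₗ F = TensorProduct.map F F ∘ₗ deconcat
  counit : counit ∘ₗ F = counit
  strong : F 1 = 1

end Coalgebra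

/-! ## Formal power series in the moduli, with operator coefficients -/

section Formal

variable {κ : Type*}

/-- Convergence of a series of formal power series: every coefficient is a finite sum. -/
def HasFormalSum {R : Type*} [Semiring R] (f : ℕ → MvPowerSeries κ R) (s : MvPowerSeries κ R) :
    Prop :=
  ∀ m : κ →₀ ℕ, {n | MvPowerSeries.coeff m (f n) ≠ 0}.Finite ∧
    MvPowerSeries.coeff m s = ∑ᶠ n, MvPowerSeries.coeff m (f n)

/-- A curved `A_∞`-structure over `ℂ⟦t⟧` on a (suspended) super vector space `V`. -/
structure IsCurvedAInfinity {V : Type*} [AddCommGroup V] [Module ℂ V] (τ : V →ₗ[ℂ] V)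
    (b : MvPowerSeries κ (Module.End ℂ (TensorAlgebra ℂ V))) : Prop where
  coder : ∀ m, IsOddCoderivation τ (MvPowerSeries.coeff m b)
  sq : b * b = 0

variable {C₁ C₂ : Type*} [AddCommGroup C₁] [Module ℂ C₁] [AddCommGroup C₂] [Module ℂ C₂]

/-- `X ↦ p X i`, extended to formal power series. -/
def compress (p : C₁ →ₗ[ℂ] C₂) (i : C₂ →ₗ[ℂ] C₁) (X : MvPowerSeries κ (Module.End ℂ C₁)) :
    MvPowerSeries κ (Module.End ℂ C₂) :=
  fun m => p ∘ₗ MvPowerSeries.coeff m X ∘ₗ i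

/-- The sign `ε` with `v_{σ 1} ∧ … ∧ v_{σ n} = ε v_1 ∧ … ∧ v_n` for homogeneous `v_k` of degree
`deg k`: each inverted pair of odd elements contributes `-1`. -/
def koszulSign {n : ℕ} (σ : Equiv.Perm (Fin n)) (deg : Fin n → ZMod 2) : ℤ :=
  ∏ i, ∏ j, if i < j ∧ σ j < σ i ∧ deg (σ i) = 1 ∧ deg (σ j) = 1 then -1 else 1

/-- `M_n^1(a_1 ∧ … ∧ a_n) = ∑_σ ε_σ p a_{σ 1} h a_{σ 2} h … h a_{σ n} i` for homogeneous
`a_k` whose degree in `End(C₁)[1]` is `deg k`, extended `ℂ⟦t⟧`-multilinearly. -/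
def transfer (p : C₁ →ₗ[ℂ] C₂) (h : Module.End ℂ C₁) (i : C₂ →ₗ[ℂ] C₁) {n : ℕ}
    (deg : Fin n → ZMod 2) (a : Fin n → MvPowerSeries κ (Module.End ℂ C₁)) :
    MvPowerSeries κ (Module.End ℂ C₂) :=
  ∑ σ : Equiv.Perm (Fin n), koszulSign σ deg •
    compress p i (((List.ofFn fun k => a (σ k)).intersperse (MvPowerSeries.C h)).prod)

end Formal

/-! ## Splittings of a complex -/

/-- A decomposition `A = H ⊕ B ⊕ L` into graded subspaces, where `B` is the image of `d`,
`H ⊕ B` is the kernel of `d`, and `L` is a complement of the kernel. -/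
structure Splitting {A : Type*} [AddCommGroup A] [Module ℂ A] (τ d : A →ₗ[ℂ] A) where
  H : Submodule ℂ A
  L : Submodule ℂ A
  gradedH : ∀ a ∈ H, τ a ∈ H
  gradedL : ∀ a ∈ L, τ a ∈ L
  disjoint : Disjoint H (LinearMap.range d)
  sup_eq : H ⊔ LinearMap.range d = LinearMap.ker d
  isCompl : IsCompl (LinearMap.ker d) L

namespace Splitting

variable {A : Type*} [AddCommGroup A] [Module ℂ A] {τ d : A →ₗ[ℂ] A} (S : Splitting τ d)

theorem isCompl_H : IsCompl S.H (LinearMap.range d ⊔ S.L) := by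
  constructor
  · exact S.disjoint.disjoint_sup_right_of_disjoint_sup_left (S.sup_eq ▸ S.isCompl.disjoint)
  · rw [codisjoint_iff, ← sup_assoc, S.sup_eq]
    exact S.isCompl.sup_eq_top

theorem isCompl_B : IsCompl (LinearMap.range d) (S.H ⊔ S.L) := by
  have h : LinearMap.range d ⊔ S.H = LinearMap.ker d := by rw [sup_comm, S.sup_eq]
  constructor
  · exact S.disjoint.symm.disjoint_sup_right_of_disjoint_sup_left (h ▸ S.isCompl.disjoint)
  · rw [codisjoint_iff, ← sup_assoc, h]
    exact S.isCompl.sup_eq_top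

theorem bijective_L : Function.Bijective (d.rangeRestrict ∘ₗ S.L.subtype) := by
  constructor
  · rw [← LinearMap.ker_eq_bot, LinearMap.ker_eq_bot']
    intro l hl
    have h : (l : A) ∈ LinearMap.ker d := by
      simpa using congrArg Subtype.val hl
    have := (Submodule.disjoint_def.mp S.isCompl.disjoint) l h l.2
    exact Subtype.ext this
  · rintro ⟨_, a, rfl⟩
    have ha : a ∈ LinearMap.ker d ⊔ S.L := by rw [S.isCompl.sup_eq_top]; trivial
    obtain ⟨k, hk, l, hl, rfl⟩ := Submodule.mem_sup.mp ha
    refine ⟨⟨l, hl⟩, Subtype.ext ?_⟩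
    have hk' : d k = 0 := hk
    simp [hk']

/-- The projection `π_H : A → H` along `B ⊕ L`. -/
def piH : A →ₗ[ℂ] S.H := S.H.projectionOnto (LinearMap.range d ⊔ S.L) S.isCompl_H

/-- The isomorphism `d : L → B`. -/
def equivLB : S.L ≃ₗ[ℂ] LinearMap.range d := LinearEquiv.ofBijective _ S.bijective_L

theorem equivLB_apply (l : S.L) : (S.equivLB l : A) = d l := rfl

/-- The homotopy `G : A → A`, which vanishes on `H ⊕ L` and inverts `d : L → B` on `B`. -/
def G : A →ₗ[ℂ] A :=
  S.L.subtype ∘ₗ S.equivLB.symm.toLinearMap ∘ₗ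
    (LinearMap.range d).projectionOnto (S.H ⊔ S.L) S.isCompl_B

/-- `d G + G d = id - π_H`. -/
theorem homotopy (a : A) : d (S.G a) + S.G (d a) = a - S.piH a := by
  have hG : ∀ b : LinearMap.range d, d (S.G b) = b := by
    intro b
    have h1 := Submodule.projectionOnto_apply_left S.isCompl_B b
    have h2 : S.G b = (S.equivLB.symm b : A) := by simp [G, h1]
    rw [h2, ← S.equivLB_apply, LinearEquiv.apply_symm_apply]
  have hG0 : ∀ x ∈ S.H ⊔ S.L, S.G x = 0 := by
    intro x hx
    simp [G, (Submodule.projectionOnto_apply_eq_zero_iff S.isCompl_B).mpr hx]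
  have hGL : ∀ l ∈ S.L, S.G (d l) = l := by
    intro l hl
    have h : S.equivLB.symm ⟨d l, l, rfl⟩ = ⟨l, hl⟩ := by
      rw [LinearEquiv.symm_apply_eq]; rfl
    have h1 := Submodule.projectionOnto_apply_left S.isCompl_B ⟨d l, l, rfl⟩
    have h2 : S.G (d l) = (S.equivLB.symm ⟨d l, l, rfl⟩ : A) := by
      simp only [G, LinearMap.comp_apply, h1]; rfl
    rw [h2, h]
  have ha : a ∈ (S.H ⊔ LinearMap.range d) ⊔ S.L := by
    rw [S.sup_eq, S.isCompl.sup_eq_top]; trivial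
  obtain ⟨k, hk, l, hl, rfl⟩ := Submodule.mem_sup.mp ha
  obtain ⟨x, hx, b, hb, rfl⟩ := Submodule.mem_sup.mp hk
  have hdk : d (x + b) = 0 := by
    have : x + b ∈ LinearMap.ker d := S.sup_eq ▸ hk
    exact this
  have h1 : S.piH x = ⟨x, hx⟩ := Submodule.projectionOnto_apply_left S.isCompl_H ⟨x, hx⟩
  have h2 : S.piH (b + l) = 0 :=
    (Submodule.projectionOnto_apply_eq_zero_iff S.isCompl_H).mpr
      (Submodule.add_mem_sup hb hl)
  have h3 : d (S.G b) = b := hG ⟨b, hb⟩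
  have h4 : S.G x = 0 := hG0 x (Submodule.mem_sup_left hx)
  have h5 : S.G l = 0 := hG0 l (Submodule.mem_sup_right hl)
  rw [add_assoc, map_add S.piH, h1, h2, ← add_assoc, map_add d, hdk, map_add S.G, map_add S.G,
    h4, h5, zero_add, zero_add, add_zero, hGL l hl, h3]
  simp
  abel

/-- The degree operator of `H`. -/
def tauH : S.H →ₗ[ℂ] S.H := τ.restrict S.gradedH

end Splitting

/-! ## Landau-Ginzburg models -/

/-- The ideal generated by the partial derivatives of `W`. -/
def jacobianIdeal {N : ℕ} (W : MvPolynomial (Fin N) ℂ) : Ideal (MvPolynomial (Fin N) ℂ) :=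
  Ideal.span (Set.range fun i => MvPolynomial.pderiv i W)

/-- The Jacobi ring `Jac(W) = ℂ[x₁,…,x_N] / (∂₁W, …, ∂_N W)`. -/
abbrev Jac {N : ℕ} (W : MvPolynomial (Fin N) ℂ) : Type :=
  MvPolynomial (Fin N) ℂ ⧸ jacobianIdeal W

/-- Polynomial supermatrices of size `2n`; the first `n` basis vectors are even, the last `n`
are odd. -/
abbrev Supermatrix (N n : ℕ) : Type :=
  Matrix (Fin n ⊕ Fin n) (Fin n ⊕ Fin n) (MvPolynomial (Fin N) ℂ)

/-- A matrix factorisation of `W`: an odd supermatrix `D` with `D² = W · e`. -/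
structure IsMatrixFactorisation {N n : ℕ} (W : MvPolynomial (Fin N) ℂ) (D : Supermatrix N n) :
    Prop where
  odd₁ : D.toBlocks₁₁ = 0
  odd₂ : D.toBlocks₂₂ = 0
  sq : D * D = W • (1 : Supermatrix N n)

section OpenString

variable {N n : ℕ}

/-- The matrix `σ` with `σ a = (-1)^{|a|} a σ` for homogeneous `a`. -/
def sigma : Supermatrix N n := Matrix.fromBlocks 1 0 0 (-1)

/-- `a ↦ (-1)^{|a|} a` on supermatrices, that is, `a ↦ σ a σ`. -/
def parity : Supermatrix N n →ₗ[ℂ] Supermatrix N n :=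
  LinearMap.mulLeft ℂ sigma ∘ₗ LinearMap.mulRight ℂ sigma

/-- The degree operator of the suspended space `A[1]`, where `ã = |a| - 1`. -/
def tauA : Supermatrix N n →ₗ[ℂ] Supermatrix N n := -parity

/-- The boundary BRST operator `d a = D a - (-1)^{|a|} a D`. -/
def brst (D : Supermatrix N n) : Supermatrix N n →ₗ[ℂ] Supermatrix N n :=
  LinearMap.mulLeft ℂ D - LinearMap.mulRight ℂ D ∘ₗ parity

/-- The map `r₂ = ∂_2^1`, `r₂(a ⊗ b) = (-1)^{ã} a b`, on the component `A[1]^{⊗2}` of `T_A`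
(and zero on the others). -/
def r₂ : TensorAlgebra ℂ (Supermatrix N n) →ₗ[ℂ] Supermatrix N n :=
  LinearMap.mul' ℂ _ ∘ₗ TensorProduct.map tauA LinearMap.id ∘ₗ pr₂

/-- The off-shell open string algebra: the codifferential `∂ = ∂₁ + ∂₂` on `T_A`,
`A = End(D)`, with `r₁ = d` and `r₂` from matrix multiplication. -/
def offShell (D : Supermatrix N n) : Module.End ℂ (TensorAlgebra ℂ (Supermatrix N n)) :=
  oddCoderivation tauA (brst D ∘ₗ pr₁ + r₂)

/-- The coderivation on `T_A` whose only component is `A[1]^{⊗0} = ℂ → A[1]`, `1 ↦ f · e`. -/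
def insertion (f : MvPolynomial (Fin N) ℂ) :
    Module.End ℂ (TensorAlgebra ℂ (Supermatrix N n)) :=
  oddCoderivation tauA (counit.smulRight (f • (1 : Supermatrix N n)))

/-- The off-shell deformation `δ` with `δ_0^1 = ∑ tᵢ φᵢ`. -/
def offShellDeformation {κ : Type*} [Fintype κ] (φ : κ → MvPolynomial (Fin N) ℂ) :
    MvPowerSeries κ (Module.End ℂ (TensorAlgebra ℂ (Supermatrix N n))) :=
  ∑ i, MvPowerSeries.monomial (Finsupp.single i 1) (insertion (φ i))

variable {D : Supermatrix N n} (S : Splitting tauA (brst D))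

/-- `(F, ∂̃)` is the minimal model of the off-shell algebra for the chosen splitting:
`F_1^1` is the inclusion of `H`, `F_m^1 = -G ∂_2^1 F_m^2` for `m ≥ 2`, and `∂̃` is a minimal
`A_∞`-structure on `H` with `∂ F = F ∂̃`. -/
structure IsMinimalModel
    (F : TensorAlgebra ℂ S.H →ₗ[ℂ] TensorAlgebra ℂ (Supermatrix N n))
    (dt : Module.End ℂ (TensorAlgebra ℂ S.H)) : Prop where
  coalgHom : IsStrongCoalgHom S.tauH tauA F
  aInfinity : IsAInfinity S.tauH dt
  minimal : ∀ a : S.H, pr₁ (dt (TensorAlgebra.ι ℂ a)) = 0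
  comm : offShell D ∘ₗ F = F ∘ₗ dt
  F_one : ∀ a : S.H, pr₁ (F (TensorAlgebra.ι ℂ a)) = (a : Supermatrix N n)
  F_two_le : ∀ m : ℕ, 2 ≤ m → ∀ v : Fin m → S.H,
    pr₁ (F (TensorAlgebra.tprod ℂ S.H m v)) = -S.G (r₂ (F (TensorAlgebra.tprod ℂ S.H m v)))

/-- `(F̄, U)` completes `F` to a deformation retraction of `(T_A, ∂)` onto `(T_H, ∂̃)`, where
`F̄` is a coalgebra morphism and
`Δ U = (U ⊗ (α id + (1 - α) F F̄) + ((1 - α) id + α F F̄) ⊗ U) Δ`.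
The odd homotopy is normalised by `F F̄ - id = ∂ U + U ∂`, so `U_1^1 = -G`; further
`U_m^1 = -G ∂_2^1 U_m^2`, `F̄_1^1 = π_H` and `F̄_m^1 = π_H ∂_2^1 U_m^2` for `m ≥ 2`. -/
structure IsRetraction (α : ℂ)
    (F : TensorAlgebra ℂ S.H →ₗ[ℂ] TensorAlgebra ℂ (Supermatrix N n))
    (dt : Module.End ℂ (TensorAlgebra ℂ S.H))
    (Fb : TensorAlgebra ℂ (Supermatrix N n) →ₗ[ℂ] TensorAlgebra ℂ S.H)
    (U : Module.End ℂ (TensorAlgebra ℂ (Supermatrix N n))) : Prop where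
  coalgHom : IsStrongCoalgHom tauA S.tauH Fb
  odd : IsOdd tauA U
  comm : Fb ∘ₗ offShell D = dt ∘ₗ Fb
  leftInv : Fb ∘ₗ F = LinearMap.id
  homotopy : F ∘ₗ Fb - LinearMap.id = offShell D ∘ₗ U + U ∘ₗ offShell D
  comul : deconcat ∘ₗ U
    = (TensorProduct.map U (α • LinearMap.id + (1 - α) • (F ∘ₗ Fb))
        + tensorOdd tauA ((1 - α) • LinearMap.id + α • (F ∘ₗ Fb)) U) ∘ₗ deconcat
  U_zero : U 1 = 0
  U_one : ∀ a : Supermatrix N n, pr₁ (U (TensorAlgebra.ι ℂ a)) = -S.G a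
  U_two_le : ∀ m : ℕ, 2 ≤ m → ∀ v : Fin m → Supermatrix N n,
    pr₁ (U (TensorAlgebra.tprod ℂ _ m v)) = -S.G (r₂ (U (TensorAlgebra.tprod ℂ _ m v)))
  Fb_one : ∀ a : Supermatrix N n, pr₁ (Fb (TensorAlgebra.ι ℂ a)) = S.piH a
  Fb_two_le : ∀ m : ℕ, 2 ≤ m → ∀ v : Fin m → Supermatrix N n,
    pr₁ (Fb (TensorAlgebra.tprod ℂ _ m v)) = S.piH (r₂ (U (TensorAlgebra.tprod ℂ _ m v)))

end OpenString

end LGBulk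

end

/-! The tensor coalgebra is cofree, so everything is decided in tensor degree one. Suppose that `X`
obeys a rule `Δ X = (X ⊗ g + f ⊗ X) Δ` with `f 1 = g 1 = 1` and kills all words shorter than a given
one. Then its value on that word is primitive, hence has tensor degree one. If moreover its
component in degree one is a function of its component in degree two, the value is zero
(`eq_zero_of_comul`). The recursions for `F`, `U` and `F̄` have exactly this shape. This gives
uniqueness and, for every `α`, the side conditions `U U = 0`, `U F = 0`, `F̄ U = 0`
(`IsRetraction.unique`, `IsRetraction.comp_F`, `standard_form`).

Existence is homological perturbation theory. For `∂₁` alone, the sum of `-G` over the tensor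
positions is a homotopy `u` that contracts `T_A` onto `T_H` (`exists_isLinearHomotopy`). As `∂₂`
lowers the tensor degree and `u` does not raise it, `1 - ∂₂ u` has an inverse `N`. With `i` and `π`
the inclusion of `H` and the projection to `H` in every tensor factor, the data are `U = u N`, `F =
(1 + u N ∂₂) i` and `F̄ = π N`. Their coproduct formulas are identities between operators on `T_A ⊗
T_A`, proved in an abstract ring that contains two commuting copies of `End(T_A)`.

The deformation `δ` satisfies the Maurer-Cartan equation because each `φᵢ e` is closed and central.
It has no constant term in `t`, so `1 - δ U` is an invertible power series and the geometric series
converges. In the suspension `δ` has degree zero, so all `m!` permutations give the same term and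
the sum over `m` is that geometric series (`smul_transfer_const`). A second use of the perturbation
lemma gives `(∂̃ + δ̃)² = 0` (`perturbation_sq`). That `δ̃` is a coderivation follows, for every
`α`, from the solution `v` of `v = F F̄ + U δ v`: the coproduct formula for `U` forces `Δ v = (v ⊗
v) Δ` (`IsRetraction.intertwines_perturbed_image`). -/

namespace LGBulk

/-! ### Differences in a tensor product of maps. -/

section TensorMaps

variable {M M' P P' : Type*} [AddCommGroup M] [Module ℂ M] [AddCommGroup M'] [Module ℂ M']
  [AddCommGroup P] [Module ℂ P] [AddCommGroup P'] [Module ℂ P']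

theorem map_sub_left (f f' : M →ₗ[ℂ] P) (g : M' →ₗ[ℂ] P') :
    TensorProduct.map (f - f') g = TensorProduct.map f g - TensorProduct.map f' g := by
  ext; simp [TensorProduct.sub_tmul]

theorem map_sub_right (f : M →ₗ[ℂ] P) (g g' : M' →ₗ[ℂ] P') :
    TensorProduct.map f (g - g') = TensorProduct.map f g - TensorProduct.map f g' := by
  ext; simp [TensorProduct.tmul_sub]

end TensorMaps

/-! ### Words, primitive elements and the uniqueness principle for the tensor coalgebra. -/

section Words

variable {V V' : Type*} [AddCommGroup V] [Module ℂ V] [AddCommGroup V'] [Module ℂ V']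

/-- The product `v₁ ⊗ … ⊗ vₙ` in `T_V`. -/
noncomputable def word (l : List V) : TensorAlgebra ℂ V := (l.map (TensorAlgebra.ι ℂ)).prod

@[simp] theorem word_nil : word ([] : List V) = 1 := rfl

theorem word_cons (v : V) (l : List V) : word (v :: l) = TensorAlgebra.ι ℂ v * word l := by
  simp [word]

/-- Left multiplication by any element preserves the span, by induction on that element, and `x = x
* 1`. Linear maps out of `T_V` can therefore be compared on words. -/
theorem span_word : Submodule.span ℂ (Set.range (word (V := V))) = ⊤ := by
  have key : ∀ x : TensorAlgebra ℂ V, ∀ y ∈ Submodule.span ℂ (Set.range (word (V := V))),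
      x * y ∈ Submodule.span ℂ (Set.range (word (V := V))) := by
    intro x
    induction x using TensorAlgebra.induction with
    | algebraMap r =>
      intro y hy
      rw [← Algebra.smul_def]
      exact Submodule.smul_mem _ _ hy
    | ι v =>
      intro y hy
      induction hy using Submodule.span_induction with
      | mem _ h =>
        obtain ⟨l, rfl⟩ := h
        exact Submodule.subset_span ⟨v :: l, word_cons v l⟩
      | zero => simp
      | add a b _ _ ha hb => rw [mul_add]; exact Submodule.add_mem _ ha hb
      | smul c a _ ha => rw [mul_smul_comm]; exact Submodule.smul_mem _ _ ha
    | mul a b ha hb => intro y hy; rw [mul_assoc]; exact ha _ (hb _ hy)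
    | add a b ha hb => intro y hy; rw [add_mul]; exact Submodule.add_mem _ (ha _ hy) (hb _ hy)
  rw [eq_top_iff]
  intro x _
  rw [← mul_one x]
  exact key x 1 (Submodule.subset_span ⟨[], rfl⟩)

theorem ext_word {M : Type*} [AddCommGroup M] [Module ℂ M] {f g : TensorAlgebra ℂ V →ₗ[ℂ] M}
    (h : ∀ l, f (word l) = g (word l)) : f = g :=
  LinearMap.ext_on_range span_word h

theorem deconcat_word (l : List V) : deconcat (word l)
    = ∑ j ∈ Finset.range (l.length + 1), word (l.take j) ⊗ₜ[ℂ] word (l.drop j) :=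
  deconcat_prod l

theorem tprod_eq_word {m : ℕ} (v : Fin m → V) :
    TensorAlgebra.tprod ℂ V m v = word (List.ofFn v) := by
  rw [TensorAlgebra.tprod_apply, word, List.map_ofFn]
  rfl

@[simp] theorem counit_one : counit (1 : TensorAlgebra ℂ V) = 1 := by simp [counit]

theorem counit_mul (x y : TensorAlgebra ℂ V) : counit (x * y) = counit x * counit y := by
  simp [counit]

@[simp] theorem counit_ι (v : V) : counit (TensorAlgebra.ι ℂ v) = 0 := by
  simp [counit, TensorAlgebra.algebraMapInv]

theorem counit_ι_mul (v : V) (x : TensorAlgebra ℂ V) : counit (TensorAlgebra.ι ℂ v * x) = 0 := by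
  simp [counit_mul]

@[simp] theorem pr₁_ι (v : V) : pr₁ (TensorAlgebra.ι ℂ v) = v := TensorAlgebra.ι_leftInverse v

/-- `counit` and `pr₁` are the two components of the homomorphism to the trivial square-zero
extension of `ℂ` by `V`, where this is the product rule. -/
theorem pr₁_mul (x y : TensorAlgebra ℂ V) :
    pr₁ (x * y) = counit x • pr₁ y + counit y • pr₁ x := by
  let _ : Module ℂᵐᵒᵖ V := Module.compHom _ ((RingHom.id ℂ).fromOpposite mul_comm)
  have : IsCentralScalar ℂ V := ⟨fun r m => rfl⟩
  have h : ∀ z : TensorAlgebra ℂ V, (TensorAlgebra.toTrivSqZeroExt z).fst = counit z := by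
    intro z
    have : (TrivSqZeroExt.fstHom ℂ ℂ V).comp TensorAlgebra.toTrivSqZeroExt
        = TensorAlgebra.algebraMapInv := by
      ext v; simp [TensorAlgebra.algebraMapInv]
    exact DFunLike.congr_fun this z
  have h' : ∀ z : TensorAlgebra ℂ V, pr₁ z = (TensorAlgebra.toTrivSqZeroExt z).snd :=
    fun z => rfl
  rw [h', map_mul, TrivSqZeroExt.snd_mul, h, h, ← h', ← h']
  rfl

@[simp] theorem pr₁_one : pr₁ (1 : TensorAlgebra ℂ V) = 0 := by
  have := pr₁_mul (1 : TensorAlgebra ℂ V) 1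
  simpa using this

@[simp] theorem pr₁_ι_mul (v : V) (x : TensorAlgebra ℂ V) :
    pr₁ (TensorAlgebra.ι ℂ v * x) = counit x • v := by
  simp [pr₁_mul]

theorem counit_word_cons (v : V) (l : List V) : counit (word (v :: l)) = 0 := by
  rw [word_cons, counit_ι_mul]

theorem pr₁_word_cons_cons (v w : V) (l : List V) : pr₁ (word (v :: w :: l)) = 0 := by
  rw [word_cons, pr₁_ι_mul, counit_word_cons, zero_smul]

theorem deconcat_ι (v : V) : deconcat (TensorAlgebra.ι ℂ v)
    = 1 ⊗ₜ TensorAlgebra.ι ℂ v + TensorAlgebra.ι ℂ v ⊗ₜ 1 := by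
  have := deconcat_ι_mul v 1
  simpa [deconcat_one] using this

theorem counit_deconcat (x : TensorAlgebra ℂ V) :
    TensorProduct.lid ℂ _ (TensorProduct.map counit LinearMap.id (deconcat x)) = x := by
  have : (TensorProduct.lid ℂ _).toLinearMap ∘ₗ TensorProduct.map counit LinearMap.id ∘ₗ deconcat
      = (LinearMap.id : Module.End ℂ (TensorAlgebra ℂ V)) := by
    refine ext_word fun l => ?_
    rcases l with _ | ⟨v, l⟩
    · simp [deconcat_one]
    · simp only [word_cons, LinearMap.comp_apply, deconcat_ι_mul, map_add]
      have : TensorProduct.map counit LinearMap.id ((LinearMap.mulLeft ℂ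
          (TensorAlgebra.ι ℂ v)).rTensor _ (deconcat (word l))) = 0 := by
        rw [← LinearMap.comp_apply, LinearMap.map_comp_rTensor]
        have h0 : counit ∘ₗ LinearMap.mulLeft ℂ (TensorAlgebra.ι ℂ v) = 0 := by
          ext x; simp [counit_mul]
        rw [h0, TensorProduct.map_zero_left, LinearMap.zero_apply]
      rw [this]
      simp
  exact DFunLike.congr_fun this x

theorem map_counit_deconcat {M M' : Type*} [AddCommGroup M] [Module ℂ M] [AddCommGroup M']
    [Module ℂ M'] (m : M) (g : TensorAlgebra ℂ V →ₗ[ℂ] M') (x : TensorAlgebra ℂ V) :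
    TensorProduct.map (LinearMap.toSpanSingleton ℂ M m ∘ₗ counit) g (deconcat x) = m ⊗ₜ g x := by
  have h1 := congrArg (fun z => TensorProduct.map (LinearMap.toSpanSingleton ℂ M m) g
    ((TensorProduct.lid ℂ _).symm z)) (counit_deconcat x)
  simp only [LinearEquiv.symm_apply_apply, TensorProduct.lid_symm_apply, TensorProduct.map_tmul,
    LinearMap.toSpanSingleton_apply, one_smul] at h1
  rw [← h1, ← LinearMap.comp_apply (TensorProduct.map _ g) (TensorProduct.map _ _),
    ← TensorProduct.map_comp, LinearMap.comp_id]

/-- Among the initial segments of a word, `pr₁` sees only the one of length one, so the sum splits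
off the first letter and puts it back. -/
theorem mul_pr₁_deconcat (x : TensorAlgebra ℂ V) :
    LinearMap.mul' ℂ _ (TensorProduct.map (TensorAlgebra.ι ℂ ∘ₗ pr₁) LinearMap.id (deconcat x))
      + counit x • 1 = x := by
  have key : LinearMap.mul' ℂ _ ∘ₗ TensorProduct.map (TensorAlgebra.ι ℂ ∘ₗ pr₁) LinearMap.id
        ∘ₗ deconcat + counit.smulRight (1 : TensorAlgebra ℂ V) = LinearMap.id := by
    refine ext_word fun l => ?_
    rcases l with _ | ⟨v, l⟩
    · simp [deconcat_one]
    · have h0 : (TensorAlgebra.ι ℂ ∘ₗ pr₁) ∘ₗ LinearMap.mulLeft ℂ (TensorAlgebra.ι ℂ v)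
          = (LinearMap.toSpanSingleton ℂ _ (TensorAlgebra.ι ℂ v)) ∘ₗ counit := by
        ext x; simp
      rw [word_cons, LinearMap.add_apply, LinearMap.comp_apply, LinearMap.comp_apply,
        deconcat_ι_mul, map_add, map_add, ← LinearMap.comp_apply (TensorProduct.map _ _),
        LinearMap.map_comp_rTensor, h0, map_counit_deconcat]
      simp [counit_mul]
  exact DFunLike.congr_fun key x

/-- Primitive elements of the tensor coalgebra. -/
def IsPrimitive (y : TensorAlgebra ℂ V) : Prop := deconcat y = y ⊗ₜ 1 + 1 ⊗ₜ y

/-- The counit axiom shows that the counit of `y` vanishes; then `mul_pr₁_deconcat` applied to `y ⊗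
1 + 1 ⊗ y` leaves only `ι (pr₁ y)`. -/
theorem IsPrimitive.eq_ι {y : TensorAlgebra ℂ V} (h : IsPrimitive y) :
    y = TensorAlgebra.ι ℂ (pr₁ y) := by
  have h1 := counit_deconcat y
  rw [h] at h1
  have h2 : counit y • (1 : TensorAlgebra ℂ V) = 0 := by
    simpa using h1
  have h3 := mul_pr₁_deconcat y
  rw [h, h2] at h3
  simpa using h3.symm

theorem IsPrimitive.pr₂_eq_zero {y : TensorAlgebra ℂ V} (h : IsPrimitive y) : pr₂ y = 0 := by
  rw [pr₂, LinearMap.comp_apply, h]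
  simp

/-- In an induction on the length, only the cut after the last letter survives. -/
theorem map_deconcat_left {M M' : Type*} [AddCommGroup M] [Module ℂ M] [AddCommGroup M']
    [Module ℂ M'] (X : TensorAlgebra ℂ V →ₗ[ℂ] M) (g : TensorAlgebra ℂ V →ₗ[ℂ] M')
    (l : List V) (h : ∀ l' : List V, l'.length < l.length → X (word l') = 0) :
    TensorProduct.map X g (deconcat (word l)) = X (word l) ⊗ₜ g 1 := by
  rw [deconcat_word, map_sum, Finset.sum_range_succ, Finset.sum_eq_zero]
  · simp
  · intro j hj
    rw [Finset.mem_range] at hj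
    rw [TensorProduct.map_tmul, h _ (by simp [hj]), TensorProduct.zero_tmul]

theorem map_deconcat_right {M M' : Type*} [AddCommGroup M] [Module ℂ M] [AddCommGroup M']
    [Module ℂ M'] (f : TensorAlgebra ℂ V →ₗ[ℂ] M) (X : TensorAlgebra ℂ V →ₗ[ℂ] M')
    (l : List V) (h : ∀ l' : List V, l'.length < l.length → X (word l') = 0) :
    TensorProduct.map f X (deconcat (word l)) = f 1 ⊗ₜ X (word l) := by
  rw [deconcat_word, map_sum, Finset.sum_range_succ', Finset.sum_eq_zero]
  · simp
  · intro j hj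
    rw [Finset.mem_range] at hj
    rw [TensorProduct.map_tmul, h _ (by simp; omega), TensorProduct.tmul_zero]

/-- Induction on the tensor degree. -/
theorem word_induction {E : Type*} {P : List E → Prop}
    (h : ∀ l, (∀ l' : List E, l'.length < l.length → P l') → P l) (l : List E) : P l := by
  suffices ∀ n, ∀ l : List E, l.length = n → P l from this _ l rfl
  intro n
  induction n using Nat.strong_induction_on with
  | _ n ih => exact fun l hl => h l fun l' hl' => ih _ (hl ▸ hl') l' rfl

/-- A map that is a coderivation along two maps is determined by its component of
tensor degree one. -/
theorem eq_zero_of_comul {X f g : TensorAlgebra ℂ V →ₗ[ℂ] TensorAlgebra ℂ V'}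
    (hX : deconcat ∘ₗ X = (TensorProduct.map X g + TensorProduct.map f X) ∘ₗ deconcat)
    (hf : f 1 = 1) (hg : g 1 = 1) (c : V' ⊗[ℂ] V' →ₗ[ℂ] V')
    (h : ∀ l, pr₁ (X (word l)) = c (pr₂ (X (word l)))) : X = 0 := by
  refine ext_word (word_induction fun l ih => ?_)
  -- All inner cuts vanish by induction; the two outer ones give `X w ⊗ 1` and `1 ⊗ X w`.
  have hp : IsPrimitive (X (word l)) := by
    have := DFunLike.congr_fun hX (word l)
    simp only [LinearMap.comp_apply, LinearMap.add_apply] at this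
    rw [IsPrimitive, this, map_deconcat_left X g l ih, map_deconcat_right f X l ih, hf, hg]
  -- The value is `ι` of its `pr₁`, which is a function of `pr₂`, and `pr₂` kills primitive
  -- elements.
  rw [hp.eq_ι, h, hp.pr₂_eq_zero]
  simp

/-- The difference of two coalgebra morphisms is a coderivation along them: `F ⊗ F - F' ⊗ F' = (F -
F') ⊗ F + F' ⊗ (F - F')`. -/
theorem eq_of_comul {F F' : TensorAlgebra ℂ V →ₗ[ℂ] TensorAlgebra ℂ V'}
    (hF : deconcat ∘ₗ F = TensorProduct.map F F ∘ₗ deconcat) (hF1 : F 1 = 1)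
    (hF' : deconcat ∘ₗ F' = TensorProduct.map F' F' ∘ₗ deconcat) (hF1' : F' 1 = 1)
    (c : V' ⊗[ℂ] V' →ₗ[ℂ] V')
    (h : ∀ l, pr₁ ((F - F') (word l)) = c (pr₂ ((F - F') (word l)))) : F = F' := by
  rw [← sub_eq_zero]
  refine eq_zero_of_comul (f := F') (g := F) ?_ hF1' hF1 c h
  rw [LinearMap.comp_sub, hF, hF', ← LinearMap.sub_comp]
  congr 1
  rw [map_sub_left, map_sub_right]
  abel

end Words

/-! ### Coderivations along a pair of coalgebra morphisms, with prescribed components. -/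

section Along

variable {V V' V'' : Type*} [AddCommGroup V] [Module ℂ V] [AddCommGroup V'] [Module ℂ V']
  [AddCommGroup V''] [Module ℂ V'']

/-- The functorial map `T_V → T_{V'}` of a linear map. -/
noncomputable def tmap (p : V →ₗ[ℂ] V') : TensorAlgebra ℂ V →ₗ[ℂ] TensorAlgebra ℂ V' :=
  (TensorAlgebra.lift ℂ (TensorAlgebra.ι ℂ ∘ₗ p)).toLinearMap

theorem tauT_eq_tmap (τ : V →ₗ[ℂ] V) : tauT τ = tmap τ := rfl

@[simp] theorem tmap_one (p : V →ₗ[ℂ] V') : tmap p 1 = 1 := by simp [tmap]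

@[simp] theorem tmap_mul (p : V →ₗ[ℂ] V') (x y : TensorAlgebra ℂ V) :
    tmap p (x * y) = tmap p x * tmap p y := by simp [tmap]

@[simp] theorem tmap_ι (p : V →ₗ[ℂ] V') (v : V) :
    tmap p (TensorAlgebra.ι ℂ v) = TensorAlgebra.ι ℂ (p v) := by simp [tmap]

theorem tmap_word (p : V →ₗ[ℂ] V') (l : List V) : tmap p (word l) = word (l.map p) := by
  induction l with
  | nil => simp
  | cons v l ih => simp [word_cons, ih]

theorem tmap_comp (q : V' →ₗ[ℂ] V'') (p : V →ₗ[ℂ] V') : tmap (q ∘ₗ p) = tmap q ∘ₗ tmap p :=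
  ext_word fun l => by simp [tmap_word]

theorem tmap_id : tmap (LinearMap.id : V →ₗ[ℂ] V) = LinearMap.id :=
  ext_word fun l => by simp [tmap_word]

theorem deconcat_tmap (p : V →ₗ[ℂ] V') :
    deconcat ∘ₗ tmap p = TensorProduct.map (tmap p) (tmap p) ∘ₗ deconcat :=
  ext_word fun l => by
    simp [tmap_word, deconcat_word, List.map_take, List.map_drop]

theorem counit_tmap (p : V →ₗ[ℂ] V') : counit ∘ₗ tmap p = counit :=
  ext_word fun l => by
    cases l <;> simp [word_cons, counit_mul]

theorem pr₁_tmap (p : V →ₗ[ℂ] V') : pr₁ ∘ₗ tmap p = p ∘ₗ pr₁ :=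
  ext_word fun l => by
    rcases l with _ | ⟨a, _ | ⟨b, l⟩⟩ <;> simp [word_cons, counit_mul]

/-- `x ↦ ∑ u(x') g(x'')`, a coderivation-like sum over the initial segments. -/
noncomputable def headAlong (g : TensorAlgebra ℂ V →ₗ[ℂ] TensorAlgebra ℂ V')
    (u : TensorAlgebra ℂ V →ₗ[ℂ] V') : TensorAlgebra ℂ V →ₗ[ℂ] TensorAlgebra ℂ V' :=
  LinearMap.mul' ℂ _ ∘ₗ TensorProduct.map (TensorAlgebra.ι ℂ ∘ₗ u) g ∘ₗ deconcat

/-- The coderivation `∑ p^{⊗j} ⊗ u ⊗ g` along the maps `tmap p` and `g`. -/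
noncomputable def coderivAlong (p : V →ₗ[ℂ] V')
    (g : TensorAlgebra ℂ V →ₗ[ℂ] TensorAlgebra ℂ V')
    (u : TensorAlgebra ℂ V →ₗ[ℂ] V') : TensorAlgebra ℂ V →ₗ[ℂ] TensorAlgebra ℂ V' :=
  LinearMap.mul' ℂ _
    ∘ₗ TensorProduct.map
        (LinearMap.mul' ℂ _ ∘ₗ TensorProduct.map (tmap p) (TensorAlgebra.ι ℂ ∘ₗ u) ∘ₗ deconcat) g
    ∘ₗ deconcat

theorem oddCoderivation_eq (τ : V →ₗ[ℂ] V) (r : TensorAlgebra ℂ V →ₗ[ℂ] V) :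
    oddCoderivation τ r = coderivAlong τ LinearMap.id r := rfl

variable (p : V →ₗ[ℂ] V') (g : TensorAlgebra ℂ V →ₗ[ℂ] TensorAlgebra ℂ V')
  (u : TensorAlgebra ℂ V →ₗ[ℂ] V')

theorem headAlong_one : headAlong g u 1 = TensorAlgebra.ι ℂ (u 1) * g 1 := by
  simp [headAlong, deconcat_one]

theorem coderivAlong_one : coderivAlong p g u 1 = TensorAlgebra.ι ℂ (u 1) * g 1 := by
  simp [coderivAlong, deconcat_one]

/-- Separates the empty initial segment from those that contain `v`; the latter are absorbed by
replacing `u` with `u (v ⊗ ·)`. Inductions with this recursion must therefore keep `u` general. -/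
theorem headAlong_ι_mul (v : V) (x : TensorAlgebra ℂ V) :
    headAlong g u (TensorAlgebra.ι ℂ v * x) = TensorAlgebra.ι ℂ (u 1) * g (TensorAlgebra.ι ℂ v * x)
      + headAlong g (u ∘ₗ LinearMap.mulLeft ℂ (TensorAlgebra.ι ℂ v)) x := by
  simp only [headAlong, LinearMap.comp_apply, deconcat_ι_mul, map_add]
  refine congrArg₂ _ (by simp) ?_
  rw [← LinearMap.comp_apply (TensorProduct.map _ _), LinearMap.map_comp_rTensor]
  rfl

/-- Either `u` acts on an initial segment, or the first letter is moved out by `p` and `u` acts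
further to the right. -/
theorem coderivAlong_ι_mul (v : V) (x : TensorAlgebra ℂ V) :
    coderivAlong p g u (TensorAlgebra.ι ℂ v * x) = headAlong g u (TensorAlgebra.ι ℂ v * x)
      + TensorAlgebra.ι ℂ (p v) * coderivAlong p g u x := by
  set J := LinearMap.mul' ℂ _ ∘ₗ TensorProduct.map (tmap p) (TensorAlgebra.ι ℂ ∘ₗ u) ∘ₗ deconcat
    with hJ
  have hJ1 : J 1 = TensorAlgebra.ι ℂ (u 1) := by simp [hJ, deconcat_one]
  have hJv : J ∘ₗ LinearMap.mulLeft ℂ (TensorAlgebra.ι ℂ v)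
      = (TensorAlgebra.ι ℂ ∘ₗ u) ∘ₗ LinearMap.mulLeft ℂ (TensorAlgebra.ι ℂ v)
        + LinearMap.mulLeft ℂ (TensorAlgebra.ι ℂ (p v)) ∘ₗ J := by
    refine LinearMap.ext fun y => ?_
    simp only [hJ, LinearMap.comp_apply, LinearMap.mulLeft_apply, deconcat_ι_mul, map_add,
      LinearMap.add_apply]
    congr 1
    · simp
    · induction deconcat y using TensorProduct.induction_on with
      | zero => simp
      | tmul a b => simp [mul_assoc]
      | add a b ha hb => simp only [map_add, ha, hb, mul_add]
  rw [headAlong_ι_mul]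
  change LinearMap.mul' ℂ _ (TensorProduct.map J g (deconcat (TensorAlgebra.ι ℂ v * x))) = _ +
    _ * LinearMap.mul' ℂ _ (TensorProduct.map J g (deconcat x))
  rw [deconcat_ι_mul, map_add, map_add, add_assoc]
  congr 1
  · simp [hJ1]
  · rw [← LinearMap.comp_apply (TensorProduct.map _ _), LinearMap.map_comp_rTensor, hJv,
      TensorProduct.map_add_left, LinearMap.add_apply, map_add]
    congr 1
    induction deconcat x using TensorProduct.induction_on with
    | zero => simp
    | tmul a b => simp [mul_assoc]
    | add a b ha hb => simp only [map_add, ha, hb, mul_add]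

variable {g}

/-- The single letter produced by `u` cannot be cut: a cut lies in front of it, or behind it inside
the image of `g`, where `g` is a coalgebra morphism. -/
theorem deconcat_headAlong (hg : deconcat ∘ₗ g = TensorProduct.map g g ∘ₗ deconcat)
    (hg1 : g 1 = 1) (x : TensorAlgebra ℂ V) :
    deconcat (headAlong g u x)
      = 1 ⊗ₜ headAlong g u x + TensorProduct.map (headAlong g u) g (deconcat x) := by
  have key : ∀ l : List V, ∀ u : TensorAlgebra ℂ V →ₗ[ℂ] V',
      deconcat (headAlong g u (word l)) = 1 ⊗ₜ headAlong g u (word l)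
        + TensorProduct.map (headAlong g u) g (deconcat (word l)) := by
    intro l
    induction l with
    | nil => intro u; simp [headAlong_one, hg1, deconcat_one, deconcat_ι]
    | cons v l ih =>
      intro u
      have hh : headAlong g u ∘ₗ LinearMap.mulLeft ℂ (TensorAlgebra.ι ℂ v)
          = LinearMap.mulLeft ℂ (TensorAlgebra.ι ℂ (u 1)) ∘ₗ g ∘ₗ
              LinearMap.mulLeft ℂ (TensorAlgebra.ι ℂ v)
            + headAlong g (u ∘ₗ LinearMap.mulLeft ℂ (TensorAlgebra.ι ℂ v)) := by
        refine LinearMap.ext fun y => ?_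
        simp [headAlong_ι_mul]
      have hgd : ∀ y, deconcat (g y) = TensorProduct.map g g (deconcat y) :=
        fun y => DFunLike.congr_fun hg y
      rw [word_cons, headAlong_ι_mul, map_add, ih, deconcat_ι_mul, hgd, deconcat_ι_mul]
      simp only [map_add, TensorProduct.map_tmul, headAlong_one, hg1, mul_one,
        TensorProduct.tmul_add]
      rw [← LinearMap.comp_apply (TensorProduct.map (headAlong g u) g),
        LinearMap.map_comp_rTensor, hh, TensorProduct.map_add_left, LinearMap.add_apply,
        LinearMap.rTensor_tmul, LinearMap.mulLeft_apply, mul_one]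
      have e : (LinearMap.rTensor _ (LinearMap.mulLeft ℂ (TensorAlgebra.ι ℂ (u 1))))
          (TensorProduct.map g g (LinearMap.rTensor _ (LinearMap.mulLeft ℂ (TensorAlgebra.ι ℂ v))
            (deconcat (word l))))
          = TensorProduct.map (LinearMap.mulLeft ℂ (TensorAlgebra.ι ℂ (u 1)) ∘ₗ g ∘ₗ
              LinearMap.mulLeft ℂ (TensorAlgebra.ι ℂ v)) g (deconcat (word l)) := by
        induction deconcat (word l) using TensorProduct.induction_on with
        | zero => simp
        | tmul a b => simp
        | add a b ha hb => simp only [map_add, ha, hb]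
      rw [e]
      abel
  have : deconcat ∘ₗ headAlong g u = TensorProduct.mk ℂ _ _ 1 ∘ₗ headAlong g u
      + TensorProduct.map (headAlong g u) g ∘ₗ deconcat := ext_word fun l => key l u
  exact DFunLike.congr_fun this x

theorem deconcat_coderivAlong (hg : deconcat ∘ₗ g = TensorProduct.map g g ∘ₗ deconcat)
    (hg1 : g 1 = 1) :
    deconcat ∘ₗ coderivAlong p g u
      = (TensorProduct.map (coderivAlong p g u) g
        + TensorProduct.map (tmap p) (coderivAlong p g u)) ∘ₗ deconcat := by
  refine ext_word fun l => ?_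
  induction l with
  | nil => simp [coderivAlong_one, hg1, deconcat_one, deconcat_ι, add_comm]
  | cons v l ih =>
    simp only [LinearMap.comp_apply, LinearMap.add_apply] at ih ⊢
    have hU : coderivAlong p g u ∘ₗ LinearMap.mulLeft ℂ (TensorAlgebra.ι ℂ v)
        = headAlong g u ∘ₗ LinearMap.mulLeft ℂ (TensorAlgebra.ι ℂ v)
          + LinearMap.mulLeft ℂ (TensorAlgebra.ι ℂ (p v)) ∘ₗ coderivAlong p g u := by
      refine LinearMap.ext fun y => ?_
      simp [coderivAlong_ι_mul]
    have hp : tmap p ∘ₗ LinearMap.mulLeft ℂ (TensorAlgebra.ι ℂ v)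
        = LinearMap.mulLeft ℂ (TensorAlgebra.ι ℂ (p v)) ∘ₗ tmap p := by
      refine LinearMap.ext fun y => ?_
      simp
    have e : ∀ (a b : TensorAlgebra ℂ V →ₗ[ℂ] TensorAlgebra ℂ V') y,
        (LinearMap.mulLeft ℂ (TensorAlgebra.ι ℂ (p v))).rTensor _ (TensorProduct.map a b y)
          = TensorProduct.map (LinearMap.mulLeft ℂ (TensorAlgebra.ι ℂ (p v)) ∘ₗ a) b y := by
      intro a b y
      rw [← LinearMap.comp_apply, LinearMap.rTensor_comp_map]
    rw [word_cons, coderivAlong_ι_mul, map_add, deconcat_headAlong _ hg hg1, deconcat_ι_mul,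
      deconcat_ι_mul, ih]
    simp only [map_add, TensorProduct.map_tmul]
    simp only [← LinearMap.comp_apply (TensorProduct.map _ _) (LinearMap.rTensor _ _),
        LinearMap.map_comp_rTensor]
    rw [hU, hp, TensorProduct.map_add_left, e, e]
    simp only [LinearMap.add_apply, tmap_one, coderivAlong_ι_mul, coderivAlong_one,
      headAlong_one, TensorProduct.tmul_add]
    abel

theorem counit_coderivAlong (x : TensorAlgebra ℂ V) : counit (coderivAlong p g u x) = 0 := by
  simp only [coderivAlong, LinearMap.comp_apply]
  induction deconcat x using TensorProduct.induction_on with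
  | zero => simp
  | add a b ha hb => simp only [map_add, ha, hb, add_zero]
  | tmul a b =>
    simp only [TensorProduct.map_tmul, LinearMap.mul'_apply, counit_mul, LinearMap.comp_apply]
    induction deconcat a using TensorProduct.induction_on with
    | zero => simp
    | add a b ha hb => simp only [map_add, add_mul, ha, hb, add_zero]
    | tmul a b => simp [counit_mul]

theorem pr₁_headAlong (hg : counit ∘ₗ g = counit) (x : TensorAlgebra ℂ V) :
    pr₁ (headAlong g u x) = u x := by
  have hg' : ∀ y, counit (g y) = counit y := fun y => DFunLike.congr_fun hg y
  have key : ∀ l : List V, ∀ u : TensorAlgebra ℂ V →ₗ[ℂ] V', pr₁ (headAlong g u (word l))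
      = u (word l) := by
    intro l
    induction l with
    | nil => intro u; simp [headAlong_one, hg']
    | cons v l ih =>
      intro u
      rw [word_cons, headAlong_ι_mul, map_add, ih]
      simp [hg', counit_mul]
  exact DFunLike.congr_fun (ext_word (f := pr₁ ∘ₗ headAlong g u) fun l => key l u) x

theorem pr₁_coderivAlong (hg : counit ∘ₗ g = counit) : pr₁ ∘ₗ coderivAlong p g u = u := by
  have hg' : ∀ y, counit (g y) = counit y := fun y => DFunLike.congr_fun hg y
  refine ext_word fun l => ?_
  cases l with
  | nil => simp [coderivAlong_one, hg']
  | cons v l =>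
    rw [LinearMap.comp_apply, word_cons, coderivAlong_ι_mul, map_add, pr₁_headAlong _ hg,
      pr₁_ι_mul, counit_coderivAlong]
    simp

theorem coderivAlong_odd {τ : V →ₗ[ℂ] V} {τ' : V' →ₗ[ℂ] V'} (hp : p ∘ₗ τ = τ' ∘ₗ p)
    (hg : g ∘ₗ tauT τ = tauT τ' ∘ₗ g) (hu : u ∘ₗ tauT τ = -(τ' ∘ₗ u)) :
    coderivAlong p g u ∘ₗ tauT τ = -(tauT τ' ∘ₗ coderivAlong p g u) := by
  have hu' : ∀ y, u (tmap τ y) = -τ' (u y) := fun y => DFunLike.congr_fun hu y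
  have hg' : ∀ y, g (tmap τ y) = tmap τ' (g y) := fun y => DFunLike.congr_fun hg y
  have hp' : ∀ y, tmap p (tmap τ y) = tmap τ' (tmap p y) := fun y => by
    rw [← LinearMap.comp_apply, ← tmap_comp, hp, tmap_comp, LinearMap.comp_apply]
  have hd : ∀ y : TensorAlgebra ℂ V,
      deconcat (tmap τ y) = TensorProduct.map (tmap τ) (tmap τ) (deconcat y) :=
    fun y => DFunLike.congr_fun (deconcat_tmap τ) y
  refine LinearMap.ext fun x => ?_
  simp only [tauT_eq_tmap, coderivAlong, LinearMap.comp_apply, LinearMap.neg_apply, hd]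
  induction deconcat x using TensorProduct.induction_on with
  | zero => simp
  | add a b ha hb => simp only [map_add, ha, hb, neg_add]
  | tmul a b =>
    simp only [TensorProduct.map_tmul, LinearMap.mul'_apply, LinearMap.comp_apply, hg', hd,
      tmap_mul, ← neg_mul]
    congr 1
    induction deconcat a using TensorProduct.induction_on with
    | zero => simp
    | add a b ha hb => simp only [map_add, ha, hb, neg_add]
    | tmul a b => simp [hu', hp']

/-- If `u` sees only single letters, just one initial segment contributes. This yields the simple
recursion used for `∂₁` and for the linear homotopy. -/
theorem headAlong_pr₁_ι_mul (s : V →ₗ[ℂ] V') (v : V) (x : TensorAlgebra ℂ V) :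
    headAlong g (s ∘ₗ pr₁) (TensorAlgebra.ι ℂ v * x) = TensorAlgebra.ι ℂ (s v) * g x := by
  have h : (s ∘ₗ pr₁) ∘ₗ LinearMap.mulLeft ℂ (TensorAlgebra.ι ℂ v)
      = LinearMap.toSpanSingleton ℂ _ (s v) ∘ₗ counit := by
    ext y; simp
  rw [headAlong_ι_mul, h, headAlong, ← LinearMap.comp_assoc, LinearMap.comp_apply,
    LinearMap.comp_apply, LinearMap.comp_apply, ← LinearMap.comp_assoc,
    LinearMap.comp_toSpanSingleton, map_counit_deconcat]
  simp

theorem coderivAlong_pr₁_ι_mul (s : V →ₗ[ℂ] V') (v : V) (x : TensorAlgebra ℂ V) :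
    coderivAlong p g (s ∘ₗ pr₁) (TensorAlgebra.ι ℂ v * x)
      = TensorAlgebra.ι ℂ (s v) * g x
        + TensorAlgebra.ι ℂ (p v) * coderivAlong p g (s ∘ₗ pr₁) x := by
  rw [coderivAlong_ι_mul, headAlong_pr₁_ι_mul]

theorem coderivAlong_pr₁_one (s : V →ₗ[ℂ] V') : coderivAlong p g (s ∘ₗ pr₁) 1 = 0 := by
  simp [coderivAlong_one]

end Along

/-! ### Homological perturbation identities in a ring; `N` is the inverse of `1 - e u`. -/

section Perturbation

variable {R : Type*} [Ring R] {d e u p N : R}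

theorem odd_mul_odd {x y t : R} (hx : x * t = -(t * x)) (hy : y * t = -(t * y)) :
    x * y * t = t * (x * y) := by
  rw [mul_assoc, hy, mul_neg, ← mul_assoc, hx, neg_mul, neg_neg, mul_assoc]

theorem comm_of_homotopy {b U P : R} (hb : b * b = 0) (h : P = 1 + (b * U + U * b)) :
    b * P = P * b := by
  rw [h]
  linear_combination (norm := noncomm_ring) hb * U - U * hb

/-- An inverse of `1 - e u` produces an inverse of `1 - u e`. -/
theorem perturbed_inverse_left (hN : N * (1 - e * u) = 1) :
    (1 + u * N * e) * (1 - u * e) = 1 := by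
  linear_combination (norm := noncomm_ring) u * hN * e

theorem perturbed_inverse_right (hN : (1 - e * u) * N = 1) :
    (1 - u * e) * (1 + u * N * e) = 1 := by
  linear_combination (norm := noncomm_ring) u * hN * e

theorem perturbed_inverse_mul (hN : N * (1 - e * u) = 1) : (1 + u * N * e) * u = u * N := by
  linear_combination (norm := noncomm_ring) -(u * hN)

/-- The homotopy `u N` for the perturbed differential `d + e`. -/
theorem perturbed_homotopy (hN : N * (1 - e * u) = 1) (hN' : (1 - e * u) * N = 1)
    (hp : p = 1 + d * u + u * d) (hde : d * e + e * d + e * e = 0) :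
    (1 + u * N * e) * p * N = 1 + ((d + e) * (u * N) + u * N * (d + e)) := by
  -- Arranged so that multiplication by `M` on the left and `N` on the right cancels the outer
  -- factors; the discrepancy is `u (d e + e d + e e) u = 0`.
  have h : p = (1 - u * e) * (1 - e * u) + (1 - u * e) * ((d + e) * u)
      + u * (d + e) * (1 - e * u) := by
    linear_combination (norm := noncomm_ring) hp + u * hde * u
  have hM := perturbed_inverse_left hN
  have hMu := perturbed_inverse_mul hN
  generalize 1 + u * N * e = M at *
  calc M * p * N = (M * (1 - u * e)) * ((1 - e * u) * N) + (M * (1 - u * e)) * ((d + e) * u) * N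
      + (M * u) * (d + e) * ((1 - e * u) * N) := by rw [h]; noncomm_ring
    _ = _ := by rw [hM, hN', hMu]; noncomm_ring

/-- The side conditions give `N u = u` and `N p = p`, so they pass to the perturbed data `U = u N`
and `P = (1 + u N e) p N`. The last three relations are telescoping rules, the input for the
coproduct of the perturbed homotopy. -/
theorem perturbed_relations (hN : N * (1 - e * u) = 1) (huu : u * u = 0) (hup : u * p = 0)
    (hpu : p * u = 0) (hpp : p * p = p) :
    N * u = u ∧ N * p = p ∧ u * N * u = 0 ∧ (1 + u * N * e) * p * N * u = 0 ∧
      u * N * p = 0 ∧ (1 + u * N * e) * p * N * p = (1 + u * N * e) * p ∧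
      u * N * e * u = u * N - u ∧
      (1 + u * N * e) * p * N * e * u = (1 + u * N * e) * p * N - (1 + u * N * e) * p ∧
      u * N * e * p = (1 + u * N * e) * p - p := by
  have h1 : N * u = u := by
    linear_combination (norm := noncomm_ring) hN * u + N * e * huu
  have h2 : N * p = p := by
    linear_combination (norm := noncomm_ring) hN * p + N * e * hup
  refine ⟨h1, h2, by rw [mul_assoc, h1, huu], by rw [mul_assoc, h1, mul_assoc, hpu, mul_zero],
    by rw [mul_assoc, h2, hup], by rw [mul_assoc, h2, mul_assoc, hpp], ?_, ?_, ?_⟩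
  · linear_combination (norm := noncomm_ring) -(u * hN)
  · linear_combination (norm := noncomm_ring) -((1 + u * N * e) * p * hN)
  · noncomm_ring

theorem perturbed_inverse_comm {t : R} (hN : N * (1 - e * u) = 1) (hN' : (1 - e * u) * N = 1)
    (he : e * t = -(t * e)) (hu : u * t = -(t * u)) : N * t = t * N := by
  have h : (1 - e * u) * t = t * (1 - e * u) := by
    linear_combination (norm := noncomm_ring) -(e * hu) + he * u
  calc N * t = N * (t * (1 - e * u)) * N := by rw [mul_assoc, mul_assoc, hN', mul_one]
    _ = N * (1 - e * u) * t * N := by rw [← h]; noncomm_ring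
    _ = t * N := by rw [hN, one_mul]

theorem perturbed_inverse_eq (hN : N * (1 - e * u) = 1) (hN' : (1 - e * u) * N = 1) :
    N = 1 + N * e * u ∧ N = 1 + e * u * N :=
  ⟨by linear_combination (norm := noncomm_ring) hN,
    by linear_combination (norm := noncomm_ring) hN'⟩

/-- The square of the transferred differential. -/
theorem perturbation_sq {A : R} (hN : N * (1 - e * u) = 1) (hN' : (1 - e * u) * N = 1)
    (hA : A = N * e) (hp : p = 1 + d * u + u * d) (hde : d * e + e * d + e * e = 0) :
    d * A + A * d + A * p * A = 0 := by
  -- Multiplication by `1 - e u` on the left and `1 - u e` on the right turns each outer `A` into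
  -- `e`. The expression becomes `d e + e d + e e`, and both factors are invertible.
  have h1 : (1 - e * u) * A = e := by rw [hA, ← mul_assoc, hN', one_mul]
  have h2 : A * (1 - u * e) = e := by
    rw [hA]; linear_combination (norm := noncomm_ring) hN * e
  have h3 : A = e * (1 + u * N * e) := by
    rw [hA]; linear_combination (norm := noncomm_ring) (hN' * e)
  have hM' := perturbed_inverse_right hN'
  have h : (1 - e * u) * (d * A + A * d + A * p * A) * (1 - u * e) = 0 := by
    calc _ = (1 - e * u) * d * (A * (1 - u * e)) + ((1 - e * u) * A) * d * (1 - u * e)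
          + ((1 - e * u) * A) * p * (A * (1 - u * e)) := by noncomm_ring
      _ = 0 := by
        rw [h1, h2, hp]
        linear_combination (norm := noncomm_ring) hde
  calc _ = (N * (1 - e * u)) * (d * A + A * d + A * p * A)
        * ((1 - u * e) * (1 + u * N * e)) := by rw [hN, hM', one_mul, mul_one]
    _ = N * ((1 - e * u) * (d * A + A * d + A * p * A) * (1 - u * e)) * (1 + u * N * e) := by
      noncomm_ring
    _ = 0 := by rw [h, mul_zero, zero_mul]

end Perturbation

/-! ### Operators on a tensor square: `l` and `r` model the two legs, `t` the degree operator. -/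

section TensorSquare

variable {R S : Type*} [Ring R] [Ring S] [Algebra ℂ R] [Algebra ℂ S] {l r : R →ₐ[ℂ] S}

/-- The legs multiply without signs, since `l` and `r` commute; every Koszul sign is an explicit `t`
on the left leg. -/
theorem tens_mul (hc : ∀ x y, l x * r y = r y * l x) (a b c d : R) :
    l a * r b * (l c * r d) = l (a * c) * r (b * d) := by
  rw [mul_assoc, ← mul_assoc (r b), ← hc, map_mul, map_mul]
  noncomm_ring

/-- The reason why coproduct formulas of every type `α` are consistent: the mixed terms cancel for
each `α`. -/
theorem tens_interpolate (α : ℂ) (v p : R) :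
    l (v - p) * r (α • v + (1 - α) • p) + l ((1 - α) • v + α • p) * r (v - p)
      = l v * r v - l p * r p := by
  simp only [map_add, map_sub, map_smul, mul_add, add_mul, mul_sub, sub_mul, smul_mul_assoc,
    mul_smul_comm]
  module

theorem tens_interpolate_one (α : ℂ) {p x : R} (h : p = 1 + x) :
    l x * r (α • 1 + (1 - α) • p) + l ((1 - α) • 1 + α • p) * r x = l p * r p - 1 := by
  have e := tens_interpolate (l := l) (r := r) α 1 p
  have hx : (1 : R) - p = -x := by rw [h]; abel
  rw [hx, map_neg, map_neg, map_one, map_one, one_mul] at e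
  linear_combination (norm := noncomm_ring) -e

variable {t U δ : R}

/-- The image of a perturbed projector is closed under the coproduct. -/
theorem perturbed_image_comul (hc : ∀ x y, l x * r y = r y * l x) (ht : t * t = 1)
    (hU : U * t = -(t * U)) {p v : R} (α : ℂ) (hv : v = p + U * δ * v)
    (hUv : U * v = 0) (hpv : p * v = p) :
    (1 - (l U * r (α • 1 + (1 - α) • p) + l (((1 - α) • 1 + α • p) * t) * r U)
      * (l δ + l t * r δ)) * (l v * r v) = l p * r p := by
  set q := α • (1 : R) + (1 - α) • p with hq
  set q' := (1 - α) • (1 : R) + α • p with hq'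
  have hqv : q * v = α • v + (1 - α) • p := by rw [hq, add_mul, smul_mul_assoc, smul_mul_assoc,
    hpv, one_mul]
  have hqv' : q' * v = (1 - α) • v + α • p := by rw [hq', add_mul, smul_mul_assoc, smul_mul_assoc,
    hpv, one_mul]
  have hw : U * δ * v = v - p := by rw [eq_sub_iff_add_eq, add_comm, ← hv]
  -- Of the four products, the two in which `U` meets `v` with no `δ` in between vanish by `U v =
  -- 0`; the other two contain `U δ v = v - p`.
  have e : (l U * r q + l (q' * t) * r U) * (l δ * r 1 + l t * r δ) * (l v * r v)
      = l (v - p) * r (q * v) + l (q' * v) * r (v - p) := by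
    have h1 : l (q' * t * δ * v) * r (U * 1 * v) = 0 := by rw [mul_one, hUv, map_zero, mul_zero]
    have h2 : l (U * t * v) * r (q * δ * v) = 0 := by
      rw [hU, neg_mul, mul_assoc, hUv, mul_zero, neg_zero, map_zero, zero_mul]
    have h3 : q' * t * t * v = q' * v := by rw [mul_assoc q', ht, mul_one]
    simp only [add_mul, mul_add, tens_mul hc]
    rw [h1, h2, h3, hw, mul_one]
    abel
  rw [map_one, mul_one, hqv, hqv', tens_interpolate] at e
  rw [sub_mul, one_mul, e, sub_sub_cancel]

/-- A perturbed projector commutes with the coproduct up to the perturbation. -/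
theorem perturbed_projector_comul (hc : ∀ x y, l x * r y = r y * l x) (ht : t * t = 1)
    {p k : R} (α : ℂ) (hk : k = p + k * δ * U) (htp : p * t = t * p) (htk : k * t = t * k)
    (hkU : k * U = 0) (hkp : k * p = p) :
    l k * r k * (1 - (l δ + l t * r δ) *
      (l U * r (α • 1 + (1 - α) • p) + l (((1 - α) • 1 + α • p) * t) * r U)) = l p * r p := by
  set q := α • (1 : R) + (1 - α) • p with hq
  set q' := (1 - α) • (1 : R) + α • p with hq'
  have hqk : k * q = α • k + (1 - α) • p := by rw [hq, mul_add, mul_smul_comm, mul_smul_comm,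
    hkp, mul_one]
  have hqk' : k * q' = (1 - α) • k + α • p := by rw [hq', mul_add, mul_smul_comm, mul_smul_comm,
    hkp, mul_one]
  have hw : k * δ * U = k - p := by rw [eq_sub_iff_add_eq, add_comm, ← hk]
  have htq : t * (q' * t) = q' := by
    have : t * q' = q' * t := by
      rw [hq', mul_add, add_mul, mul_smul_comm, mul_smul_comm, smul_mul_assoc, smul_mul_assoc,
        htp, mul_one, one_mul]
    rw [← mul_assoc, this, mul_assoc, ht, mul_one]
  -- Mirror image of the argument for the perturbed image: `k U = 0` removes two products, and `k δ
  -- U = k - p` evaluates the rest.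
  have e : (l k * r k) * ((l δ * r 1 + l t * r δ) * (l U * r q + l (q' * t) * r U))
      = l (k - p) * r (k * q) + l (k * q') * r (k - p) := by
    have h1 : l (k * (δ * (q' * t))) * r (k * (1 * U)) = 0 := by
      rw [one_mul, hkU, map_zero, mul_zero]
    have h2 : l (k * (t * U)) * r (k * (δ * q)) = 0 := by
      rw [← mul_assoc, htk, mul_assoc, hkU, mul_zero, map_zero, zero_mul]
    simp only [add_mul, mul_add, tens_mul hc]
    rw [h1, h2, htq, ← mul_assoc k δ U, hw, one_mul]
    abel
  rw [map_one, mul_one, hqk, hqk', tens_interpolate] at e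
  rw [mul_sub, mul_one, e, sub_sub_cancel]

/-- The perturbed homotopy of type `0`. -/
theorem perturbed_homotopy_comul_zero (hc : ∀ x y, l x * r y = r y * l x) (ht : t * t = 1)
    {u p m P : R} (hut : u * t = -(t * u))
    (hUu : U * u = 0) (hPu : P * u = 0) (hUp : U * p = 0) (hPp : P * p = m)
    (hUδu : U * δ * u = U - u) (hPδu : P * δ * u = P - m) (hUδp : U * δ * p = m - p) :
    (l U * r P + l t * r U) * (1 - (l δ + l t * r δ) * (l u * r p + l t * r u))
      = l u * r p + l t * r u := by
  -- Four of the eight products vanish by the side conditions. The other four telescope to the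
  -- difference of the perturbed and the unperturbed homotopy.
  have e : (l U * r P + l t * r U) * ((l δ * r 1 + l t * r δ) * (l u * r p + l t * r u))
      = l (U - u) * r m + l U * r (P - m) + l u * r (m - p) + l t * r (U - u) := by
    have h1 : l (U * (δ * t)) * r (P * (1 * u)) = 0 := by rw [one_mul, hPu, map_zero, mul_zero]
    have h2 : l (U * (t * u)) * r (P * (δ * p)) = 0 := by
      rw [← neg_eq_iff_eq_neg.mpr hut, mul_neg, ← mul_assoc, hUu, zero_mul, neg_zero, map_zero,
        zero_mul]
    have h3 : l (t * (δ * u)) * r (U * (1 * p)) = 0 := by rw [one_mul, hUp, map_zero, mul_zero]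
    have h4 : l (t * (δ * t)) * r (U * (1 * u)) = 0 := by rw [one_mul, hUu, map_zero, mul_zero]
    have h5 : t * (t * u) = u := by rw [← mul_assoc, ht, one_mul]
    simp only [add_mul, mul_add, tens_mul hc]
    rw [h1, h2, h3, h4, h5, ht, one_mul, mul_one, mul_one, hPp, ← mul_assoc U δ u, hUδu,
      ← mul_assoc P δ u, hPδu, ← mul_assoc U δ p, hUδp]
    abel
  rw [map_one, mul_one] at e
  rw [mul_sub, mul_one, e]
  simp only [map_sub, mul_sub, sub_mul]
  abel

/-- The perturbed homotopy of type `1`. -/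
theorem perturbed_homotopy_comul_one (hc : ∀ x y, l x * r y = r y * l x) (ht : t * t = 1)
    {u p m P : R} (hut : u * t = -(t * u)) (hδ : δ * t = -(t * δ)) (hpt : p * t = t * p)
    (hUu : U * u = 0) (hPu : P * u = 0) (hUp : U * p = 0) (hPp : P * p = m)
    (hUδu : U * δ * u = U - u) (hPδu : P * δ * u = P - m) (hUδp : U * δ * p = m - p) :
    (l U + l (P * t) * r U) * (1 - (l δ + l t * r δ) * (l u + l (p * t) * r u))
      = l u + l (p * t) * r u := by
  have e : (l U * r 1 + l (P * t) * r U) *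
      ((l δ * r 1 + l t * r δ) * (l u * r 1 + l (p * t) * r u))
      = l (U - u) + l ((m - p) * t) * r u + l ((P - m) * t) * r U + l (m * t) * r (U - u) := by
    have g1 : t * (t * u) = u := by rw [← mul_assoc, ht, one_mul]
    have g2 : t * (p * t) = p := by rw [hpt, ← mul_assoc, ht, one_mul]
    have h2 : U * (t * u) = 0 := by
      rw [← neg_eq_iff_eq_neg.mpr hut, mul_neg, ← mul_assoc, hUu, zero_mul, neg_zero]
    have h5 : P * t * (t * u) = 0 := by rw [mul_assoc, g1, hPu]
    have h6 : P * t * p = m * t := by rw [mul_assoc, ← hpt, ← mul_assoc, hPp]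
    have h7 : P * t * (δ * u) = (P - m) * t := by
      rw [← hPδu, mul_assoc P t, ← mul_assoc t, ← neg_eq_iff_eq_neg.mpr hδ]
      simp only [mul_assoc, neg_mul, mul_neg, hut]
    have h8 : U * (δ * (p * t)) = (m - p) * t := by rw [← hUδp]; simp only [mul_assoc]
    simp only [add_mul, mul_add, tens_mul hc]
    rw [h2, g2, hUp, h5, h6, h7, h8, ← mul_assoc U δ u, hUδu]
    simp only [one_mul, mul_one, hUu, map_zero, mul_zero, zero_mul, map_one]
    abel
  rw [map_one, mul_one, mul_one, mul_one] at e
  rw [mul_sub, mul_one, e]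
  simp only [map_sub, mul_sub, sub_mul]
  abel

/-- The anticommutator of a coderivation with a homotopy. -/
theorem anticomm_comul (hc : ∀ x y, l x * r y = r y * l x) (ht : t * t = 1)
    {q q' : R} (hU : U * t = -(t * U)) (hδ : δ * t = -(t * δ)) (hδq : δ * q = q * δ)
    (hδq' : δ * q' = q' * δ) (htq' : q' * t = t * q') :
    (l δ + l t * r δ) * (l U * r q + l (q' * t) * r U)
      + (l U * r q + l (q' * t) * r U) * (l δ + l t * r δ)
      = l (δ * U + U * δ) * r q + l q' * r (δ * U + U * δ) := by
  have e : (l δ * r 1 + l t * r δ) * (l U * r q + l (q' * t) * r U)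
      + (l U * r q + l (q' * t) * r U) * (l δ * r 1 + l t * r δ)
      = l (δ * U + U * δ) * r q + l q' * r (δ * U + U * δ) := by
    have h1 : δ * (q' * t) = -(q' * t * δ) := by
      rw [← mul_assoc, hδq', mul_assoc, hδ, mul_neg, mul_assoc]
    have h2 : t * (q' * t) = q' := by rw [htq', ← mul_assoc, ht, one_mul]
    have h3 : q' * t * t = q' := by rw [mul_assoc, ht, mul_one]
    simp only [add_mul, mul_add, tens_mul hc, one_mul, mul_one, h1, h2, h3, hU, hδq, map_add,
      map_neg, neg_mul]
    abel
  simpa using e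

theorem anticomm_homotopy_comul (hc : ∀ x y, l x * r y = r y * l x) (ht : t * t = 1)
    {p : R} (α : ℂ) (hU : U * t = -(t * U)) (hδ : δ * t = -(t * δ)) (hδp : δ * p = p * δ)
    (htp : p * t = t * p) :
    (l δ + l t * r δ) * (l U * r (α • 1 + (1 - α) • p) + l (((1 - α) • 1 + α • p) * t) * r U)
      + (l U * r (α • 1 + (1 - α) • p) + l (((1 - α) • 1 + α • p) * t) * r U) * (l δ + l t * r δ)
      = l (δ * U + U * δ) * r (α • 1 + (1 - α) • p)
        + l ((1 - α) • 1 + α • p) * r (δ * U + U * δ) := by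
  refine anticomm_comul hc ht hU hδ ?_ ?_ ?_ <;>
    simp only [mul_add, add_mul, mul_smul_comm, smul_mul_assoc, mul_one, one_mul, hδp, htp]

/-- The square of a homotopy. -/
theorem sq_homotopy_comul (hc : ∀ x y, l x * r y = r y * l x) (ht : t * t = 1)
    {p : R} (α : ℂ) (hU : U * t = -(t * U)) (hUp : U * p = 0) (htp : p * t = t * p) :
    (l U * r (α • 1 + (1 - α) • p) + l (((1 - α) • 1 + α • p) * t) * r U)
      * (l U * r (α • 1 + (1 - α) • p) + l (((1 - α) • 1 + α • p) * t) * r U)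
      = l (U * U) * r ((α • 1 + (1 - α) • p) * (α • 1 + (1 - α) • p))
        + l (((1 - α) • 1 + α • p) * ((1 - α) • 1 + α • p)) * r (U * U)
        + (l (((1 - α) * (1 - α)) • (U * t)) * r (p * U) - l (p * U * t) * r ((α * α) • U)) := by
  -- The two mixed products do not cancel completely; what remains contains `p U`. This is why `U U
  -- = 0` and `F̄ U = 0` have to be proved together.
  set q := α • (1 : R) + (1 - α) • p with hq
  set q' := (1 - α) • (1 : R) + α • p with hq'
  have h1 : q' * t * (q' * t) = q' * q' := by
    have : t * q' = q' * t := by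
      rw [hq', mul_add, add_mul, mul_smul_comm, mul_smul_comm, smul_mul_assoc, smul_mul_assoc,
        htp, mul_one, one_mul]
    rw [mul_assoc, ← mul_assoc t, this, mul_assoc q' t, ht, mul_one]
  have h2 : U * (q' * t) = (1 - α) • (U * t) := by
    rw [← mul_assoc, hq', mul_add, mul_smul_comm, mul_smul_comm, hUp, smul_zero, add_zero,
      mul_one, smul_mul_assoc]
  have h3 : U * q = α • U := by
    rw [hq, mul_add, mul_smul_comm, mul_smul_comm, hUp, smul_zero, add_zero, mul_one]
  have h4 : q * U = α • U + (1 - α) • (p * U) := by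
    rw [hq, add_mul, smul_mul_assoc, smul_mul_assoc, one_mul]
  have h5 : q' * t * U = -((1 - α) • (U * t) + α • (p * U * t)) := by
    rw [mul_assoc, ← neg_eq_iff_eq_neg.mpr hU, mul_neg, hq', add_mul, smul_mul_assoc,
      smul_mul_assoc, one_mul, mul_assoc]
  simp only [add_mul, mul_add, tens_mul hc]
  rw [h1, h2, h3, h4, h5]
  simp only [map_add, map_neg, map_smul, add_mul, mul_add, neg_mul, smul_mul_assoc, mul_smul_comm]
  module

end TensorSquare

/-! ### Operators on `T_V` and the two legs of `T_V ⊗ T_V`. -/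

section Operators

variable {V V' : Type*} [AddCommGroup V] [Module ℂ V] [AddCommGroup V'] [Module ℂ V']

/-- `X ↦ X ⊗ id`. -/
noncomputable def actL : Module.End ℂ (TensorAlgebra ℂ V) →ₐ[ℂ]
    Module.End ℂ (TensorAlgebra ℂ V ⊗[ℂ] TensorAlgebra ℂ V) :=
  Module.End.rTensorAlgHom ℂ (TensorAlgebra ℂ V) (TensorAlgebra ℂ V)

/-- `X ↦ id ⊗ X`, without signs. -/
noncomputable def actR : Module.End ℂ (TensorAlgebra ℂ V) →ₐ[ℂ]
    Module.End ℂ (TensorAlgebra ℂ V ⊗[ℂ] TensorAlgebra ℂ V) :=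
  Module.End.lTensorAlgHom ℂ (TensorAlgebra ℂ V) (TensorAlgebra ℂ V)

theorem map_eq_act (f g : Module.End ℂ (TensorAlgebra ℂ V)) :
    TensorProduct.map f g = actL f * actR g := by
  refine TensorProduct.ext' fun x y => ?_
  rfl

theorem act_comm (f g : Module.End ℂ (TensorAlgebra ℂ V)) :
    actL f * actR g = actR g * actL f := by
  refine TensorProduct.ext' fun x y => ?_
  rfl

theorem act_mul_act (a b c d : Module.End ℂ (TensorAlgebra ℂ V)) :
    actL a * actR b * (actL c * actR d) = actL (a * c) * actR (b * d) :=
  TensorProduct.ext' fun _ _ => rfl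

variable {τ : V →ₗ[ℂ] V}

theorem tauT_one : tauT τ 1 = 1 := tmap_one τ

theorem tauT_sq (hτ : τ ∘ₗ τ = LinearMap.id) : tauT τ * tauT τ = 1 := by
  rw [Module.End.mul_eq_comp, tauT_eq_tmap, ← tmap_comp, hτ, tmap_id]
  rfl

/-- Brings the co-Leibniz rule into the form of the ring identities for `l`, `r` and `t`. -/
theorem isOddCoderivation_iff (X : Module.End ℂ (TensorAlgebra ℂ V)) :
    IsOddCoderivation τ X ↔ X * tauT τ = -(tauT τ * X) ∧
      deconcat ∘ₗ X = (actL X + actL (tauT τ) * actR X) ∘ₗ deconcat := by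
  have : TensorProduct.map X LinearMap.id + tensorOdd τ LinearMap.id X
      = actL X + actL (tauT τ) * actR X := by
    rw [tensorOdd, LinearMap.id_comp, map_eq_act, map_eq_act]
    congr 1
    change actL X * actR 1 = _
    rw [map_one, mul_one]
  constructor
  · rintro ⟨h1, h2⟩; exact ⟨h1, this ▸ h2⟩
  · rintro ⟨h1, h2⟩; exact ⟨h1, this ▸ h2⟩

theorem isOddCoderivation_oddCoderivation {r : TensorAlgebra ℂ V →ₗ[ℂ] V}
    (hr : r ∘ₗ tauT τ = -(τ ∘ₗ r)) : IsOddCoderivation τ (oddCoderivation τ r) where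
  odd := by
    rw [oddCoderivation_eq]
    exact coderivAlong_odd τ r rfl rfl hr
  coLeibniz := by
    rw [oddCoderivation_eq, deconcat_coderivAlong _ _ (by simp) rfl]
    rfl

theorem pr₁_oddCoderivation (r : TensorAlgebra ℂ V →ₗ[ℂ] V) :
    pr₁ ∘ₗ oddCoderivation τ r = r := by
  rw [oddCoderivation_eq, pr₁_coderivAlong]
  rfl

theorem oddCoderivation_add (r s : TensorAlgebra ℂ V →ₗ[ℂ] V) :
    oddCoderivation τ (r + s) = oddCoderivation τ r + oddCoderivation τ s := by
  simp only [oddCoderivation, LinearMap.comp_add, TensorProduct.map_add_right,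
    TensorProduct.map_add_left, LinearMap.add_comp]

theorem IsOddCoderivation.add {X Y : Module.End ℂ (TensorAlgebra ℂ V)}
    (hX : IsOddCoderivation τ X) (hY : IsOddCoderivation τ Y) : IsOddCoderivation τ (X + Y) := by
  rw [isOddCoderivation_iff] at *
  constructor
  · rw [add_mul, mul_add, hX.1, hY.1]; abel
  · rw [LinearMap.comp_add, hX.2, hY.2, ← LinearMap.add_comp]
    congr 1
    simp only [map_add, mul_add]
    abel

theorem IsOddCoderivation.zero : IsOddCoderivation τ (0 : Module.End ℂ (TensorAlgebra ℂ V)) := by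
  rw [isOddCoderivation_iff]
  simp

/-- The anticommutator of odd coderivations is an even coderivation, so its degree-one component
decides. All `A_∞`-relations below are obtained in this way. -/
theorem IsOddCoderivation.anticommute (hτ : τ ∘ₗ τ = LinearMap.id)
    {X Y : Module.End ℂ (TensorAlgebra ℂ V)} (hX : IsOddCoderivation τ X)
    (hY : IsOddCoderivation τ Y) (h : pr₁ ∘ₗ (X * Y + Y * X) = 0) : X * Y + Y * X = 0 := by
  rw [isOddCoderivation_iff] at hX hY
  have ht := tauT_sq hτ
  generalize tauT τ = t at *
  refine eq_zero_of_comul (f := LinearMap.id) (g := LinearMap.id) ?_ rfl rfl 0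
    (fun l => DFunLike.congr_fun h (word l))
  have e1 : deconcat ∘ₗ (X * Y) = ((actL X + actL t * actR X) * (actL Y + actL t * actR Y))
      ∘ₗ deconcat := by
    rw [Module.End.mul_eq_comp, ← LinearMap.comp_assoc, hX.2, LinearMap.comp_assoc, hY.2]
    rfl
  have e2 : deconcat ∘ₗ (Y * X) = ((actL Y + actL t * actR Y) * (actL X + actL t * actR X))
      ∘ₗ deconcat := by
    rw [Module.End.mul_eq_comp, ← LinearMap.comp_assoc, hY.2, LinearMap.comp_assoc, hX.2]
    rfl
  rw [LinearMap.comp_add, e1, e2, ← LinearMap.add_comp]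
  congr 1
  have e := anticomm_comul (R := Module.End ℂ (TensorAlgebra ℂ V))
    (S := Module.End ℂ (TensorAlgebra ℂ V ⊗[ℂ] TensorAlgebra ℂ V)) (l := actL) (r := actR) (q := 1) (q' := 1) act_comm ht hY.1 hX.1
    (by simp) (by simp) (by simp)
  rw [map_one, mul_one, one_mul, map_one, mul_one, one_mul] at e
  rw [e, map_eq_act, map_eq_act]
  change _ = actL _ * actR 1 + actL 1 * actR _
  rw [map_one, map_one, mul_one, one_mul]

end Operators

/-! ### The off-shell open string algebra and the bulk insertions. -/

section OpenString

variable {N n : ℕ} {W : MvPolynomial (Fin N) ℂ} {D : Supermatrix N n}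

theorem sigma_mul_sigma : (sigma : Supermatrix N n) * sigma = 1 := by
  simp [sigma, Matrix.fromBlocks_multiply]

theorem parity_apply (a : Supermatrix N n) : parity a = sigma * (a * sigma) := rfl

theorem parity_parity (a : Supermatrix N n) : parity (parity a) = a := by
  have h := sigma_mul_sigma (N := N) (n := n)
  rw [parity_apply, parity_apply]
  calc _ = (sigma * sigma) * a * (sigma * sigma) := by simp only [mul_assoc]
    _ = a := by rw [h, one_mul, mul_one]

theorem parity_mul (a b : Supermatrix N n) : parity (a * b) = parity a * parity b := by
  have h := sigma_mul_sigma (N := N) (n := n)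
  simp only [parity_apply]
  calc _ = sigma * a * 1 * b * sigma := by simp only [mul_assoc, one_mul]
    _ = _ := by rw [← h]; simp only [mul_assoc]

theorem parity_smul_one (f : MvPolynomial (Fin N) ℂ) :
    parity (f • (1 : Supermatrix N n)) = f • 1 := by
  rw [parity_apply, smul_mul_assoc, mul_smul_comm, one_mul, sigma_mul_sigma]

theorem IsMatrixFactorisation.parity_eq (hD : IsMatrixFactorisation W D) : parity D = -D := by
  have : D = Matrix.fromBlocks 0 D.toBlocks₁₂ D.toBlocks₂₁ 0 := by
    conv_lhs => rw [← Matrix.fromBlocks_toBlocks D, hD.odd₁, hD.odd₂]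
  rw [parity_apply, this]
  simp [sigma, Matrix.fromBlocks_multiply, Matrix.fromBlocks_neg]

theorem tauA_apply (a : Supermatrix N n) : tauA a = -parity a := rfl

theorem tauA_tauA : (tauA : Supermatrix N n →ₗ[ℂ] _) ∘ₗ tauA = LinearMap.id := by
  refine LinearMap.ext fun a => ?_
  simp [tauA_apply, parity_parity]

theorem brst_apply (a : Supermatrix N n) : brst D a = D * a - parity a * D := rfl

theorem brst_tauA (hD : IsMatrixFactorisation W D) : brst D ∘ₗ tauA = -(tauA ∘ₗ brst D) := by
  refine LinearMap.ext fun a => ?_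
  simp only [LinearMap.comp_apply, LinearMap.neg_apply, tauA_apply, brst_apply, map_sub, map_neg,
    parity_mul, hD.parity_eq, parity_parity]
  noncomm_ring

theorem brst_brst (hD : IsMatrixFactorisation W D) (a : Supermatrix N n) :
    brst D (brst D a) = 0 := by
  simp only [brst_apply, map_sub, parity_mul, hD.parity_eq, parity_parity]
  have h : D * (D * a) - -D * parity a * D - (D * (parity a * D) - a * -D * D)
      = D * D * a - a * (D * D) := by
    noncomm_ring
  rw [h, hD.sq]
  simp

theorem brst_mul (a b : Supermatrix N n) :
    brst D (a * b) = brst D a * b + parity a * brst D b := by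
  simp only [brst_apply, parity_mul]
  noncomm_ring

theorem r₂_one : r₂ (1 : TensorAlgebra ℂ (Supermatrix N n)) = 0 := by
  simp [r₂, pr₂, deconcat_one]

theorem r₂_ι_mul (a : Supermatrix N n) (x : TensorAlgebra ℂ (Supermatrix N n)) :
    r₂ (TensorAlgebra.ι ℂ a * x) = tauA a * pr₁ x := by
  have h : pr₁ ∘ₗ LinearMap.mulLeft ℂ (TensorAlgebra.ι ℂ a)
      = LinearMap.toSpanSingleton ℂ _ a ∘ₗ counit := by
    ext y; simp
  rw [r₂, pr₂, LinearMap.comp_apply, LinearMap.comp_apply, LinearMap.comp_apply, deconcat_ι_mul,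
    map_add, ← LinearMap.comp_apply (TensorProduct.map pr₁ pr₁), LinearMap.map_comp_rTensor, h,
    map_counit_deconcat]
  simp

theorem r₂_ι (a : Supermatrix N n) : r₂ (TensorAlgebra.ι ℂ a) = 0 := by
  have := r₂_ι_mul a 1
  simpa using this

theorem r₂_eq_zero_of_pr₂ {x : TensorAlgebra ℂ (Supermatrix N n)} (h : pr₂ x = 0) : r₂ x = 0 := by
  simp [r₂, h]

theorem r₂_tauT : r₂ ∘ₗ tauT tauA = -((tauA : Supermatrix N n →ₗ[ℂ] _) ∘ₗ r₂) := by
  refine ext_word fun l => ?_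
  rcases l with _ | ⟨a, l⟩
  · simp [r₂_one, tauT_one]
  · have h : pr₁ (tauT tauA (word l)) = tauA (pr₁ (word l)) :=
      DFunLike.congr_fun (pr₁_tmap tauA) (word l)
    rw [word_cons, LinearMap.comp_apply, tauT_eq_tmap, tmap_mul, tmap_ι, r₂_ι_mul,
      ← tauT_eq_tmap, h, LinearMap.neg_apply, LinearMap.comp_apply, r₂_ι_mul]
    simp only [tauA_apply, parity_mul, map_neg, parity_parity]
    noncomm_ring

variable (D) in
/-- The part `∂₁` of the codifferential. -/
noncomputable def linPart : Module.End ℂ (TensorAlgebra ℂ (Supermatrix N n)) :=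
  oddCoderivation tauA (brst D ∘ₗ pr₁)

/-- The part `∂₂` of the codifferential. -/
noncomputable def quadPart : Module.End ℂ (TensorAlgebra ℂ (Supermatrix N n)) :=
  oddCoderivation tauA r₂

theorem offShell_eq : offShell D = linPart D + quadPart := oddCoderivation_add _ _

theorem isOddCoderivation_linPart (hD : IsMatrixFactorisation W D) :
    IsOddCoderivation tauA (linPart D) := by
  refine isOddCoderivation_oddCoderivation ?_
  rw [LinearMap.comp_assoc, tauT_eq_tmap, pr₁_tmap, ← LinearMap.comp_assoc, brst_tauA hD]
  rfl

theorem isOddCoderivation_quadPart :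
    IsOddCoderivation tauA (quadPart : Module.End ℂ (TensorAlgebra ℂ (Supermatrix N n))) :=
  isOddCoderivation_oddCoderivation r₂_tauT

theorem isOddCoderivation_offShell (hD : IsMatrixFactorisation W D) :
    IsOddCoderivation tauA (offShell D) := by
  rw [offShell_eq]
  exact (isOddCoderivation_linPart hD).add isOddCoderivation_quadPart

theorem pr₁_linPart (x : TensorAlgebra ℂ (Supermatrix N n)) :
    pr₁ (linPart D x) = brst D (pr₁ x) := DFunLike.congr_fun (pr₁_oddCoderivation _) x

theorem pr₁_quadPart (x : TensorAlgebra ℂ (Supermatrix N n)) :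
    pr₁ (quadPart x) = r₂ x := DFunLike.congr_fun (pr₁_oddCoderivation _) x

theorem counit_quadPart (x : TensorAlgebra ℂ (Supermatrix N n)) : counit (quadPart x) = 0 :=
  counit_coderivAlong _ _ x

theorem linPart_one : linPart D (1 : TensorAlgebra ℂ (Supermatrix N n)) = 0 :=
  coderivAlong_pr₁_one _ _

theorem linPart_ι_mul (a : Supermatrix N n) (x : TensorAlgebra ℂ (Supermatrix N n)) :
    linPart D (TensorAlgebra.ι ℂ a * x)
      = TensorAlgebra.ι ℂ (brst D a) * x + TensorAlgebra.ι ℂ (tauA a) * linPart D x :=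
  coderivAlong_pr₁_ι_mul _ _ _ _

theorem quadPart_one : quadPart (1 : TensorAlgebra ℂ (Supermatrix N n)) = 0 := by
  rw [quadPart, oddCoderivation_eq, coderivAlong_one, r₂_one]
  simp

theorem r₂_comp_mulLeft (a : Supermatrix N n) :
    r₂ ∘ₗ LinearMap.mulLeft ℂ (TensorAlgebra.ι ℂ a) = LinearMap.mulLeft ℂ (tauA a) ∘ₗ pr₁ := by
  refine LinearMap.ext fun x => ?_
  simp [r₂_ι_mul]

theorem quadPart_ι (a : Supermatrix N n) : quadPart (TensorAlgebra.ι ℂ a) = 0 := by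
  rw [← mul_one (TensorAlgebra.ι ℂ a), quadPart, oddCoderivation_eq, coderivAlong_ι_mul,
    ← oddCoderivation_eq, ← quadPart, quadPart_one, headAlong_ι_mul, r₂_one, r₂_comp_mulLeft,
    headAlong_one]
  simp

theorem quadPart_ι_mul_ι_mul (a b : Supermatrix N n) (x : TensorAlgebra ℂ (Supermatrix N n)) :
    quadPart (TensorAlgebra.ι ℂ a * (TensorAlgebra.ι ℂ b * x))
      = TensorAlgebra.ι ℂ (tauA a * b) * x
        + TensorAlgebra.ι ℂ (tauA a) * quadPart (TensorAlgebra.ι ℂ b * x) := by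
  rw [quadPart, oddCoderivation_eq, coderivAlong_ι_mul,
    headAlong_ι_mul, r₂_one, r₂_comp_mulLeft, headAlong_pr₁_ι_mul]
  simp

/-- The graded Leibniz rule for `brst D`, with the signs of the suspension. -/
theorem brst_r₂ (x : TensorAlgebra ℂ (Supermatrix N n)) (hD : IsMatrixFactorisation W D) :
    brst D (r₂ x) + r₂ (linPart D x) = 0 := by
  have : brst D ∘ₗ r₂ + r₂ ∘ₗ linPart D = 0 := by
    refine ext_word fun l => ?_
    rcases l with _ | ⟨a, l⟩
    · simp [r₂_one, linPart_one]
    · have h := DFunLike.congr_fun (brst_tauA hD) a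
      simp only [LinearMap.comp_apply, LinearMap.neg_apply] at h
      have h' : parity (tauA a) = -a := by rw [tauA_apply, map_neg, parity_parity]
      have h'' : tauA (tauA a) = a := DFunLike.congr_fun tauA_tauA a
      rw [word_cons, LinearMap.add_apply, LinearMap.comp_apply, LinearMap.comp_apply, r₂_ι_mul,
        linPart_ι_mul, map_add, r₂_ι_mul, r₂_ι_mul, pr₁_linPart, brst_mul, h, h', h'']
      simp only [neg_mul, LinearMap.zero_apply]
      abel
  exact DFunLike.congr_fun this x

/-- Associativity of matrix multiplication: the two bracketings of three letters enter with opposite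
signs. -/
theorem r₂_quadPart (x : TensorAlgebra ℂ (Supermatrix N n)) : r₂ (quadPart x) = 0 := by
  have : r₂ ∘ₗ quadPart = (0 : TensorAlgebra ℂ (Supermatrix N n) →ₗ[ℂ] _) := by
    refine ext_word fun l => ?_
    rcases l with _ | ⟨a, _ | ⟨b, l⟩⟩
    · simp [quadPart_one]
    · simp [word_cons, quadPart_ι]
    · rw [word_cons, word_cons, LinearMap.comp_apply, quadPart_ι_mul_ι_mul, map_add, r₂_ι_mul,
        r₂_ι_mul, pr₁_quadPart, r₂_ι_mul]
      simp only [tauA_apply, parity_mul, map_neg, parity_parity]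
      simp [mul_assoc]
  exact DFunLike.congr_fun this x

theorem linPart_sq (hD : IsMatrixFactorisation W D) : linPart D * linPart D = 0 := by
  have h := (isOddCoderivation_linPart hD).anticommute tauA_tauA (isOddCoderivation_linPart hD)
    (LinearMap.ext fun x => by simp [pr₁_linPart, brst_brst hD])
  rwa [← two_smul ℂ, smul_eq_zero_iff_right two_ne_zero] at h

/-- The hypothesis of the perturbation lemma for `∂₂` as a perturbation of `∂₁`; both summands
vanish separately. -/
theorem linPart_quadPart (hD : IsMatrixFactorisation W D) :
    linPart D * quadPart + quadPart * linPart D + quadPart * quadPart = 0 := by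
  have h1 := (isOddCoderivation_linPart hD).anticommute tauA_tauA isOddCoderivation_quadPart
    (LinearMap.ext fun x => by simp [pr₁_linPart, pr₁_quadPart, brst_r₂ x hD])
  have h2 := (isOddCoderivation_quadPart (N := N) (n := n)).anticommute tauA_tauA
    isOddCoderivation_quadPart (LinearMap.ext fun x => by simp [pr₁_quadPart, r₂_quadPart])
  rw [← two_smul ℂ, smul_eq_zero_iff_right two_ne_zero] at h2
  rw [h1, h2, add_zero]

theorem offShell_sq (hD : IsMatrixFactorisation W D) : offShell D * offShell D = 0 := by
  have h1 := linPart_sq hD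
  have h2 := linPart_quadPart hD
  rw [offShell_eq]
  linear_combination (norm := noncomm_ring) h1 + h2

theorem offShell_one : offShell D (1 : TensorAlgebra ℂ (Supermatrix N n)) = 0 := by
  rw [offShell_eq, LinearMap.add_apply, linPart_one, quadPart_one, add_zero]

theorem pr₁_offShell (x : TensorAlgebra ℂ (Supermatrix N n)) :
    pr₁ (offShell D x) = brst D (pr₁ x) + r₂ x := by
  rw [offShell_eq, LinearMap.add_apply, map_add, pr₁_linPart, pr₁_quadPart]

theorem counit_offShell (x : TensorAlgebra ℂ (Supermatrix N n)) : counit (offShell D x) = 0 :=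
  counit_coderivAlong _ _ x

section Insertion

variable (f g : MvPolynomial (Fin N) ℂ)

theorem isOddCoderivation_insertion : IsOddCoderivation tauA
    (insertion f : Module.End ℂ (TensorAlgebra ℂ (Supermatrix N n))) := by
  refine isOddCoderivation_oddCoderivation (LinearMap.ext fun x => ?_)
  have h : counit (tauT tauA x) = counit x := DFunLike.congr_fun (counit_tmap _) x
  simp [h, tauA_apply, parity_smul_one]

theorem pr₁_insertion (x : TensorAlgebra ℂ (Supermatrix N n)) :
    pr₁ (insertion f x) = counit x • f • (1 : Supermatrix N n) :=
  DFunLike.congr_fun (pr₁_oddCoderivation _) x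

theorem counit_insertion (x : TensorAlgebra ℂ (Supermatrix N n)) : counit (insertion f x) = 0 :=
  counit_coderivAlong _ _ x

theorem insertion_one : insertion f (1 : TensorAlgebra ℂ (Supermatrix N n))
    = TensorAlgebra.ι ℂ (f • 1) := by
  rw [insertion, oddCoderivation_eq, coderivAlong_one]
  simp

theorem insertion_ι_mul (a : Supermatrix N n) (x : TensorAlgebra ℂ (Supermatrix N n)) :
    insertion f (TensorAlgebra.ι ℂ a * x)
      = TensorAlgebra.ι ℂ (f • 1) * (TensorAlgebra.ι ℂ a * x)
        + TensorAlgebra.ι ℂ (tauA a) * insertion f x := by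
  have h : (counit.smulRight (f • (1 : Supermatrix N n))) ∘ₗ
      LinearMap.mulLeft ℂ (TensorAlgebra.ι ℂ a) = 0 := by
    ext y; simp [counit_mul]
  rw [insertion, oddCoderivation_eq, coderivAlong_ι_mul, headAlong_ι_mul, h]
  simp [headAlong]

/-- Only words of length one matter. There `f e` is inserted on either side of the letter, and since
it is central the two products cancel by the Koszul sign. -/
theorem r₂_insertion (x : TensorAlgebra ℂ (Supermatrix N n)) : r₂ (insertion f x) = 0 := by
  have : r₂ ∘ₗ insertion f = (0 : TensorAlgebra ℂ (Supermatrix N n) →ₗ[ℂ] _) := by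
    refine ext_word fun l => ?_
    rcases l with _ | ⟨a, l⟩
    · simp [insertion_one, r₂_ι]
    · have h'' : tauA (tauA a) = a := DFunLike.congr_fun tauA_tauA a
      rw [word_cons, LinearMap.comp_apply, insertion_ι_mul, map_add, r₂_ι_mul, r₂_ι_mul,
        pr₁_insertion, h'', pr₁_ι_mul, tauA_apply, parity_smul_one]
      simp
  exact DFunLike.congr_fun this x

theorem brst_smul_one : brst D (f • (1 : Supermatrix N n)) = 0 := by
  rw [brst_apply, parity_smul_one]
  simp

theorem offShell_insertion (hD : IsMatrixFactorisation W D) :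
    offShell D * insertion f + insertion f * offShell D = 0 :=
  (isOddCoderivation_offShell hD).anticommute tauA_tauA (isOddCoderivation_insertion f)
    (LinearMap.ext fun x => by
      simp [pr₁_offShell, pr₁_insertion, counit_offShell, r₂_insertion, brst_smul_one])

theorem insertion_insertion :
    (insertion f * insertion g + insertion g * insertion f :
      Module.End ℂ (TensorAlgebra ℂ (Supermatrix N n))) = 0 :=
  (isOddCoderivation_insertion f).anticommute tauA_tauA (isOddCoderivation_insertion g)
    (LinearMap.ext fun x => by simp [pr₁_insertion, counit_insertion])

end Insertion

end OpenString

/-! ### The contraction of `A` onto `H` in coordinates. -/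

namespace Splitting

variable {A : Type*} [AddCommGroup A] [Module ℂ A] {τ d : A →ₗ[ℂ] A} (S : Splitting τ d)

/-- In the coordinates `a = h + d k + l` the maps `G` and `π_H` read off `k` and `h`, so the side
conditions on `A` become immediate. -/
theorem exists_decomposition (a : A) :
    ∃ h ∈ S.H, ∃ k ∈ S.L, ∃ l ∈ S.L, a = h + d k + l := by
  have ha : a ∈ (S.H ⊔ LinearMap.range d) ⊔ S.L := by
    rw [S.sup_eq, S.isCompl.sup_eq_top]; trivial
  obtain ⟨x, hx, l, hl, rfl⟩ := Submodule.mem_sup.mp ha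
  obtain ⟨h, hh, b, ⟨b', rfl⟩, rfl⟩ := Submodule.mem_sup.mp hx
  have hb : b' ∈ LinearMap.ker d ⊔ S.L := by rw [S.isCompl.sup_eq_top]; trivial
  obtain ⟨y, hy, k, hk, rfl⟩ := Submodule.mem_sup.mp hb
  exact ⟨h, hh, k, hk, l, hl, by rw [map_add d, LinearMap.mem_ker.mp hy, zero_add]⟩

theorem d_of_mem_H {h : A} (hh : h ∈ S.H) : d h = 0 := by
  have : h ∈ S.H ⊔ LinearMap.range d := Submodule.mem_sup_left hh
  rw [S.sup_eq] at this
  exact this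

theorem G_decomposition {h k l : A} (hh : h ∈ S.H) (hk : k ∈ S.L) (hl : l ∈ S.L) :
    S.G (h + d k + l) = k := by
  have h1 : h + d k + l = d k + (h + l) := by abel
  have h2 : (LinearMap.range d).projectionOnto (S.H ⊔ S.L) S.isCompl_B (h + l) = 0 :=
    (Submodule.projectionOnto_apply_eq_zero_iff S.isCompl_B).mpr (Submodule.add_mem_sup hh hl)
  have h3 := Submodule.projectionOnto_apply_left S.isCompl_B ⟨d k, k, rfl⟩
  have h4 : S.equivLB.symm ⟨d k, k, rfl⟩ = ⟨k, hk⟩ := by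
    rw [LinearEquiv.symm_apply_eq]; rfl
  rw [h1, G, LinearMap.comp_apply, LinearMap.comp_apply, map_add, h2, add_zero, h3]
  simp [h4]

theorem piH_decomposition {h k l : A} (hh : h ∈ S.H) (hl : l ∈ S.L) :
    S.piH (h + d k + l) = ⟨h, hh⟩ := by
  have h2 : S.piH (d k + l) = 0 := (Submodule.projectionOnto_apply_eq_zero_iff S.isCompl_H).mpr
      (Submodule.add_mem_sup ⟨k, rfl⟩ hl)
  have h3 : S.piH h = ⟨h, hh⟩ := Submodule.projectionOnto_apply_left S.isCompl_H ⟨h, hh⟩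
  rw [add_assoc, map_add, h2, add_zero, h3]

theorem G_coe (h : S.H) : S.G (h : A) = 0 := by
  have := S.G_decomposition h.2 S.L.zero_mem S.L.zero_mem
  simpa using this

theorem G_mem (a : A) : S.G a ∈ S.L := by
  obtain ⟨h, hh, k, hk, l, hl, rfl⟩ := S.exists_decomposition a
  rwa [S.G_decomposition hh hk hl]

theorem G_G (a : A) : S.G (S.G a) = 0 := by
  have := S.G_decomposition S.H.zero_mem S.L.zero_mem (S.G_mem a)
  simpa using this

theorem piH_G (a : A) : S.piH (S.G a) = 0 := by
  have := S.piH_decomposition (k := 0) S.H.zero_mem (S.G_mem a)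
  simp only [zero_add, add_zero, map_zero] at this
  exact this

theorem piH_coe (h : S.H) : S.piH (h : A) = h := by
  have := S.piH_decomposition (k := 0) h.2 S.L.zero_mem
  simpa using this

theorem piH_d (a : A) : S.piH (d a) = 0 := by
  have := S.piH_decomposition (k := a) S.H.zero_mem S.L.zero_mem
  simp only [zero_add, add_zero] at this
  exact this

/-- `τ` preserves `H` and `L`, while `τ (d k) = d (-τ k)`; the sign of the middle coordinate makes
`G` odd. -/
theorem G_tau (hd : d ∘ₗ τ = -(τ ∘ₗ d)) (a : A) : S.G (τ a) = -τ (S.G a) := by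
  obtain ⟨h, hh, k, hk, l, hl, rfl⟩ := S.exists_decomposition a
  have h1 : τ (d k) = d (-τ k) := by
    have := DFunLike.congr_fun hd k
    simp only [LinearMap.comp_apply, LinearMap.neg_apply] at this
    rw [map_neg, this, neg_neg]
  rw [S.G_decomposition hh hk hl, map_add τ, map_add τ, h1,
    S.G_decomposition (S.gradedH _ hh) (S.L.neg_mem (S.gradedL _ hk)) (S.gradedL _ hl)]

theorem piH_tau (hd : d ∘ₗ τ = -(τ ∘ₗ d)) (a : A) : S.piH (τ a) = S.tauH (S.piH a) := by
  obtain ⟨h, hh, k, hk, l, hl, rfl⟩ := S.exists_decomposition a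
  have h1 : τ (d k) = d (-τ k) := by
    have := DFunLike.congr_fun hd k
    simp only [LinearMap.comp_apply, LinearMap.neg_apply] at this
    rw [map_neg, this, neg_neg]
  rw [S.piH_decomposition hh hl, map_add τ, map_add τ, h1,
    S.piH_decomposition (S.gradedH _ hh) (S.gradedL _ hl)]
  rfl

end Splitting

/-! ### The filtration by tensor degree. -/

section Filtration

variable {V V' : Type*} [AddCommGroup V] [Module ℂ V] [AddCommGroup V'] [Module ℂ V']

/-- The span of the tensors of degree less than `n`. -/
noncomputable def degLT (V : Type*) [AddCommGroup V] [Module ℂ V] (n : ℕ) :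
    Submodule ℂ (TensorAlgebra ℂ V) :=
  Submodule.span ℂ (word '' {l : List V | l.length < n})

theorem word_mem_degLT {l : List V} {n : ℕ} (h : l.length < n) : word l ∈ degLT V n :=
  Submodule.subset_span ⟨l, h, rfl⟩

theorem map_mem_degLT {X : TensorAlgebra ℂ V →ₗ[ℂ] TensorAlgebra ℂ V'} {n m : ℕ}
    (h : ∀ l : List V, l.length < n → X (word l) ∈ degLT V' m) {x : TensorAlgebra ℂ V}
    (hx : x ∈ degLT V n) : X x ∈ degLT V' m := by
  have : degLT V n ≤ (degLT V' m).comap X := by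
    rw [degLT, Submodule.span_le]
    rintro _ ⟨l, hl, rfl⟩
    exact h l hl
  exact this hx

theorem ι_mul_mem_degLT (v : V) {x : TensorAlgebra ℂ V} {n : ℕ} (hx : x ∈ degLT V n) :
    TensorAlgebra.ι ℂ v * x ∈ degLT V (n + 1) := by
  refine map_mem_degLT (X := LinearMap.mulLeft ℂ (TensorAlgebra.ι ℂ v)) (fun l hl => ?_) hx
  rw [LinearMap.mulLeft_apply, ← word_cons]
  exact word_mem_degLT (by simpa using hl)

theorem exists_mem_degLT (x : TensorAlgebra ℂ V) : ∃ n, x ∈ degLT V n := by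
  have hx : x ∈ Submodule.span ℂ (Set.range (word (V := V))) := by rw [span_word]; trivial
  have mono : ∀ {n m : ℕ}, n ≤ m → degLT V n ≤ degLT V m := fun h =>
    Submodule.span_mono (Set.image_mono fun _ hl => lt_of_lt_of_le hl h)
  induction hx using Submodule.span_induction with
  | mem _ h =>
    obtain ⟨l, rfl⟩ := h
    exact ⟨l.length + 1, word_mem_degLT (Nat.lt_succ_self _)⟩
  | zero => exact ⟨0, Submodule.zero_mem _⟩
  | add a b _ _ ha hb =>
    obtain ⟨n, hn⟩ := ha
    obtain ⟨m, hm⟩ := hb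
    exact ⟨max n m, Submodule.add_mem _ (mono (le_max_left _ _) hn) (mono (le_max_right _ _) hm)⟩
  | smul c a _ ha =>
    obtain ⟨n, hn⟩ := ha
    exact ⟨n, Submodule.smul_mem _ _ hn⟩

/-- `X ^ n` kills everything of degree less than `n`, so the geometric series is finite on each
element, although `X` itself need not be nilpotent. -/
theorem isUnit_one_sub_of_degLT {X : Module.End ℂ (TensorAlgebra ℂ V)}
    (h : ∀ n, ∀ x ∈ degLT V (n + 1), X x ∈ degLT V n) : IsUnit (1 - X) := by
  have hn : ∀ n, ∀ x ∈ degLT V n, (X ^ n) x = 0 := by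
    intro n
    induction n with
    | zero => intro x hx; simpa [degLT] using hx
    | succ n ih =>
      intro x hx
      rw [pow_succ, Module.End.mul_apply]
      exact ih _ (h n x hx)
  rw [Module.End.isUnit_iff]
  constructor
  · rw [injective_iff_map_eq_zero]
    intro x hx
    obtain ⟨n, hxn⟩ := exists_mem_degLT x
    have hX : X x = x := by
      rw [LinearMap.sub_apply, Module.End.one_apply, sub_eq_zero] at hx
      exact hx.symm
    have : ∀ k, (X ^ k) x = x := by
      intro k
      induction k with
      | zero => rfl
      | succ k ih => rw [pow_succ, Module.End.mul_apply, hX, ih]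
    rw [← this n, hn n x hxn]
  · intro y
    obtain ⟨n, hy⟩ := exists_mem_degLT y
    refine ⟨(∑ k ∈ Finset.range n, X ^ k) y, ?_⟩
    rw [← Module.End.mul_apply, mul_neg_geom_sum, LinearMap.sub_apply, hn n y hy, sub_zero]
    rfl

theorem tmap_mem_degLT (p : V →ₗ[ℂ] V') (l : List V) :
    tmap p (word l) ∈ degLT V' (l.length + 1) := by
  rw [tmap_word]
  exact word_mem_degLT (by simp)

end Filtration

/-! ### Side conditions for a homotopy with a coproduct formula of type `α`. -/

section Homotopy

variable {V V' : Type*} [AddCommGroup V] [Module ℂ V] [AddCommGroup V'] [Module ℂ V']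
  {τ : V →ₗ[ℂ] V}

theorem pr₁_tprod {m : ℕ} (hm : 2 ≤ m) (v : Fin m → V) :
    pr₁ (TensorAlgebra.tprod ℂ V m v) = 0 := by
  obtain ⟨k, rfl⟩ := Nat.exists_eq_add_of_le' hm
  rw [tprod_eq_word, List.ofFn_succ, List.ofFn_succ, pr₁_word_cons_cons]

/-- The operator `U ⊗ (α id + (1 - α) p) + ((1 - α) id + α p) ⊗ U`. -/
noncomputable def homotopyAct (τ : V →ₗ[ℂ] V) (α : ℂ) (p U : Module.End ℂ (TensorAlgebra ℂ V)) :
    Module.End ℂ (TensorAlgebra ℂ V ⊗[ℂ] TensorAlgebra ℂ V) :=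
  actL U * actR (α • 1 + (1 - α) • p) + actL (((1 - α) • 1 + α • p) * tauT τ) * actR U

theorem homotopyAct_eq (α : ℂ) (p U : Module.End ℂ (TensorAlgebra ℂ V)) :
    homotopyAct τ α p U = TensorProduct.map U (α • LinearMap.id + (1 - α) • p)
        + tensorOdd τ ((1 - α) • LinearMap.id + α • p) U := by
  rw [tensorOdd, map_eq_act, map_eq_act]
  rfl

/-- The homotopy and the projection of a retraction square to zero in the sense of a
standard deformation retraction. -/
theorem standard_form (hτ : τ ∘ₗ τ = LinearMap.id) {α : ℂ}
    {U p : Module.End ℂ (TensorAlgebra ℂ V)} {Fb : TensorAlgebra ℂ V →ₗ[ℂ] TensorAlgebra ℂ V'}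
    {F : TensorAlgebra ℂ V' →ₗ[ℂ] TensorAlgebra ℂ V} (hp : p = F ∘ₗ Fb) (hFbp : Fb ∘ₗ p = Fb)
    (hp1 : p 1 = 1) (htp : p * tauT τ = tauT τ * p)
    (hFb : deconcat ∘ₗ Fb = TensorProduct.map Fb Fb ∘ₗ deconcat) (hFb1 : Fb 1 = 1)
    (hodd : U * tauT τ = -(tauT τ * U)) (hU : deconcat ∘ₗ U = homotopyAct τ α p U ∘ₗ deconcat)
    (hU1 : U 1 = 0) (hUp : U * p = 0) (c : V ⊗[ℂ] V →ₗ[ℂ] V) (c' : V ⊗[ℂ] V →ₗ[ℂ] V')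
    (hc : ∀ l, pr₁ (U (U (word l))) = c (pr₂ (U (U (word l)))))
    (hc' : ∀ l, pr₁ (Fb (U (word l))) = c' (pr₂ (U (U (word l))))) :
    U * U = 0 ∧ Fb ∘ₗ U = 0 := by
  have ht1 : tauT τ (1 : TensorAlgebra ℂ V) = 1 := tauT_one
  have e := sq_homotopy_comul (R := Module.End ℂ (TensorAlgebra ℂ V))
    (S := Module.End ℂ (TensorAlgebra ℂ V ⊗[ℂ] TensorAlgebra ℂ V)) (l := actL) (r := actR) act_comm (tauT_sq hτ) α
    hodd hUp htp
  -- Since `Fb p = Fb`, the map `Fb` does not distinguish the interpolating operators from the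
  -- identity.
  have hq : ∀ x, Fb ((α • (1 : Module.End ℂ (TensorAlgebra ℂ V)) + (1 - α) • p) x) = Fb x := by
    intro x
    have : Fb (p x) = Fb x := DFunLike.congr_fun hFbp x
    simp [this, ← add_smul]
  have hq' : ∀ x, Fb (((1 - α) • (1 : Module.End ℂ (TensorAlgebra ℂ V)) + α • p) x) = Fb x := by
    intro x
    have : Fb (p x) = Fb x := DFunLike.congr_fun hFbp x
    simp [this, ← add_smul]
  have hq1 : (α • (1 : Module.End ℂ (TensorAlgebra ℂ V)) + (1 - α) • p) 1 = 1 := by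
    simp [hp1, ← add_smul]
  have hq1' : ((1 - α) • (1 : Module.End ℂ (TensorAlgebra ℂ V)) + α • p) 1 = 1 := by
    simp [hp1, ← add_smul]
  have hd : ∀ x, deconcat (U x) = homotopyAct τ α p U (deconcat x) :=
    fun x => DFunLike.congr_fun hU x
  have hdb : ∀ x, deconcat (Fb x) = TensorProduct.map Fb Fb (deconcat x) :=
    fun x => DFunLike.congr_fun hFb x
  -- A joint induction: on shorter words `Fb U = 0` removes the terms with `p U` from the coproduct
  -- of `U U`. On the word itself `U U = 0` comes first and then yields `Fb U = 0` through `hc'`.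
  have key : ∀ l : List V, U (U (word l)) = 0 ∧ Fb (U (word l)) = 0 := by
    refine word_induction fun l ih => ?_
    have h1 : ∀ l' : List V, l'.length < l.length → (U * U) (word l') = 0 :=
      fun l' hl' => (ih l' hl').1
    have h2 : ∀ l' : List V, l'.length < l.length → (Fb ∘ₗ U) (word l') = 0 :=
      fun l' hl' => (ih l' hl').2
    have h3 : ∀ l' : List V, l'.length < l.length → (p * U) (word l') = 0 := by
      intro l' hl'
      rw [hp, Module.End.mul_apply, LinearMap.comp_apply, (ih l' hl').2, map_zero]
    have h4 : ∀ l' : List V, l'.length < l.length → (p * U * tauT τ) (word l') = 0 := by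
      intro l' hl'
      have e1 : U (tauT τ (word l')) = -tauT τ (U (word l')) := DFunLike.congr_fun hodd _
      have e2 : p (tauT τ (U (word l'))) = tauT τ (p (U (word l'))) := DFunLike.congr_fun htp _
      have e3 : p (U (word l')) = 0 := h3 l' hl'
      rw [Module.End.mul_apply, Module.End.mul_apply, e1, map_neg, e2, e3, map_zero, neg_zero]
    have hP : IsPrimitive (U (U (word l))) := by
      rw [IsPrimitive, hd, hd, ← Module.End.mul_apply, homotopyAct, e]
      simp only [← map_eq_act, LinearMap.add_apply, LinearMap.sub_apply]
      rw [map_deconcat_left _ _ l h1, map_deconcat_right _ _ l h1, map_deconcat_right _ _ l h3,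
        map_deconcat_left _ _ l h4]
      simp only [Module.End.mul_apply, LinearMap.smul_apply, ht1, hU1, hq1, hq1', smul_zero,
        TensorProduct.zero_tmul, TensorProduct.tmul_zero, sub_zero, add_zero]
    have hUU : U (U (word l)) = 0 := by
      rw [hP.eq_ι, hc, hP.pr₂_eq_zero, map_zero, map_zero]
    refine ⟨hUU, ?_⟩
    have hP' : IsPrimitive (Fb (U (word l))) := by
      rw [IsPrimitive, hdb, hd, homotopyAct]
      rw [← map_eq_act, ← map_eq_act, LinearMap.add_apply, map_add,
        ← LinearMap.comp_apply (TensorProduct.map Fb Fb), ← TensorProduct.map_comp,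
        ← LinearMap.comp_apply (TensorProduct.map Fb Fb), ← TensorProduct.map_comp, map_deconcat_left _ _ l h2, map_deconcat_right _ _ l h2]
      simp only [LinearMap.comp_apply, Module.End.mul_apply, hq, hq', ht1, hFb1]
    rw [hP'.eq_ι, hc', hUU, map_zero, map_zero, map_zero]
  exact ⟨ext_word fun l => (key l).1, ext_word fun l => (key l).2⟩

end Homotopy

/-! ### The contraction for the linear part `∂₁`. -/

section Linear

variable {N n : ℕ} {W : MvPolynomial (Fin N) ℂ} {D : Supermatrix N n}
  (S : Splitting tauA (brst D))

/-- The projector `i π_H` in every tensor factor. -/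
noncomputable def linProj : Module.End ℂ (TensorAlgebra ℂ (Supermatrix N n)) :=
  tmap (S.H.subtype ∘ₗ S.piH)

theorem linProj_eq : linProj S = tmap S.H.subtype ∘ₗ tmap S.piH := tmap_comp _ _

theorem tmap_piH_tmap_subtype : tmap S.piH ∘ₗ tmap S.H.subtype = LinearMap.id := by
  rw [← tmap_comp, ← tmap_id]
  congr 1
  exact LinearMap.ext fun h => S.piH_coe h

theorem tmap_piH_linProj : tmap S.piH ∘ₗ linProj S = tmap S.piH := by
  rw [linProj_eq, ← LinearMap.comp_assoc, tmap_piH_tmap_subtype, LinearMap.id_comp]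

theorem linProj_sq : linProj S * linProj S = linProj S := by
  rw [Module.End.mul_eq_comp]
  conv_lhs => rw [linProj_eq, LinearMap.comp_assoc, ← linProj_eq, tmap_piH_linProj]
  rw [← linProj_eq]

theorem linProj_one : linProj S 1 = 1 := tmap_one _

theorem deconcat_linProj : deconcat ∘ₗ linProj S
    = (actL (linProj S) * actR (linProj S)) ∘ₗ deconcat := by
  rw [← map_eq_act]
  exact deconcat_tmap _

theorem tmap_piH_tauT (hD : IsMatrixFactorisation W D) :
    tmap S.piH ∘ₗ tauT tauA = tauT S.tauH ∘ₗ tmap S.piH := by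
  rw [tauT_eq_tmap, tauT_eq_tmap, ← tmap_comp, ← tmap_comp]
  congr 1
  exact LinearMap.ext fun a => S.piH_tau (brst_tauA hD) a

theorem tauT_tmap_subtype :
    tauT tauA ∘ₗ tmap S.H.subtype = tmap S.H.subtype ∘ₗ tauT S.tauH := by
  rw [tauT_eq_tmap, tauT_eq_tmap, ← tmap_comp, ← tmap_comp]
  rfl

theorem linProj_tauT (hD : IsMatrixFactorisation W D) :
    linProj S * tauT tauA = tauT tauA * linProj S := by
  rw [Module.End.mul_eq_comp, Module.End.mul_eq_comp, linProj_eq, LinearMap.comp_assoc,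
    tmap_piH_tauT S hD, ← LinearMap.comp_assoc, ← tauT_tmap_subtype, LinearMap.comp_assoc]

theorem linPart_tmap_subtype : linPart D ∘ₗ tmap S.H.subtype = 0 := by
  refine ext_word fun l => ?_
  induction l with
  | nil => simp [linPart_one]
  | cons a l ih =>
    rw [LinearMap.comp_apply] at ih ⊢
    rw [word_cons, tmap_mul, tmap_ι, linPart_ι_mul, ih, Submodule.subtype_apply,
      S.d_of_mem_H a.2]
    simp

theorem tmap_piH_linPart : tmap S.piH ∘ₗ linPart D = 0 := by
  refine ext_word fun l => ?_
  induction l with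
  | nil => simp [linPart_one]
  | cons a l ih =>
    rw [LinearMap.comp_apply] at ih ⊢
    rw [word_cons, linPart_ι_mul, map_add, tmap_mul, tmap_ι, tmap_mul, ih, S.piH_d]
    simp

theorem linPart_mul_linProj : linPart D * linProj S = 0 := by
  rw [Module.End.mul_eq_comp, linProj_eq, ← LinearMap.comp_assoc, linPart_tmap_subtype,
    LinearMap.zero_comp]

theorem linProj_mul_linPart : linProj S * linPart D = 0 := by
  rw [Module.End.mul_eq_comp, linProj_eq, LinearMap.comp_assoc, tmap_piH_linPart,
    LinearMap.comp_zero]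

/-- A homotopy for `∂₁` which contracts `T_A` onto `T_H`, with the coproduct formula of
type `α`. -/
structure IsLinearHomotopy (α : ℂ) (u : Module.End ℂ (TensorAlgebra ℂ (Supermatrix N n))) :
    Prop where
  odd : u * tauT tauA = -(tauT tauA * u)
  comul : deconcat ∘ₗ u = homotopyAct tauA α (linProj S) u ∘ₗ deconcat
  one : u 1 = 0
  ι : ∀ a, u (TensorAlgebra.ι ℂ a) = -TensorAlgebra.ι ℂ (S.G a)
  pr₁ : ∀ x, pr₁ (u x) = -S.G (pr₁ x)
  counit : ∀ x, counit (u x) = 0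
  degree : ∀ l, u (word l) ∈ degLT (Supermatrix N n) (l.length + 1)

/-- The tensor trick: `-G` acts on one letter, `p` on the letters before it and `q` on those after
it. -/
theorem isLinearHomotopy_coderivAlong (hD : IsMatrixFactorisation W D) (α : ℂ)
    (p q : Supermatrix N n →ₗ[ℂ] Supermatrix N n) (hp : p ∘ₗ tauA = tauA ∘ₗ p)
    (hq : q ∘ₗ tauA = tauA ∘ₗ q)
    (h : ∀ u, homotopyAct tauA α (linProj S) u
      = TensorProduct.map u (tmap q) + TensorProduct.map (tmap p) u) :
    IsLinearHomotopy S α (coderivAlong p (tmap q) ((-S.G) ∘ₗ pr₁)) where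
  odd := by
    refine coderivAlong_odd p _ hp ?_ ?_
    · rw [tauT_eq_tmap, ← tmap_comp, ← tmap_comp, hq]
    · rw [LinearMap.comp_assoc, tauT_eq_tmap, pr₁_tmap]
      refine LinearMap.ext fun x => ?_
      simp [S.G_tau (brst_tauA hD)]
  comul := by rw [h, deconcat_coderivAlong _ _ (deconcat_tmap q) (tmap_one q)]
  one := coderivAlong_pr₁_one _ _
  ι a := by
    rw [← mul_one (TensorAlgebra.ι ℂ a), coderivAlong_pr₁_ι_mul, coderivAlong_pr₁_one]
    simp
  pr₁ x := DFunLike.congr_fun (pr₁_coderivAlong p ((-S.G) ∘ₗ LGBulk.pr₁) (counit_tmap q)) x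
  counit x := counit_coderivAlong _ _ x
  degree l := by
    induction l with
    | nil => rw [word_nil, coderivAlong_pr₁_one]; exact Submodule.zero_mem _
    | cons a l ih =>
      rw [word_cons, coderivAlong_pr₁_ι_mul]
      exact Submodule.add_mem _ (ι_mul_mem_degLT _ (tmap_mem_degLT q l)) (ι_mul_mem_degLT _ ih)

/-- For `α = 0` and `α = 1` both accompanying maps in the coproduct formula are functorial maps
`tmap`, as the tensor trick requires. Type `0` projects onto `H` on the right of `-G`, type `1` on
the left. -/
theorem exists_isLinearHomotopy (hD : IsMatrixFactorisation W D) {α : ℂ} (hα : α = 0 ∨ α = 1) :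
    ∃ u, IsLinearHomotopy S α u := by
  have h : (S.H.subtype ∘ₗ S.piH) ∘ₗ tauA = tauA ∘ₗ (S.H.subtype ∘ₗ S.piH) :=
    LinearMap.ext fun a => congrArg Subtype.val (S.piH_tau (brst_tauA hD) a)
  rcases hα with rfl | rfl
  · refine ⟨_, isLinearHomotopy_coderivAlong S hD 0 tauA (S.H.subtype ∘ₗ S.piH) rfl h fun u => ?_⟩
    rw [map_eq_act, map_eq_act, homotopyAct, zero_smul, zero_smul, sub_zero, one_smul, one_smul,
      zero_add, add_zero, one_mul]
    rfl
  · refine ⟨_, isLinearHomotopy_coderivAlong S hD 1 ((S.H.subtype ∘ₗ S.piH) ∘ₗ tauA) LinearMap.id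
      (by rw [h, LinearMap.comp_assoc, h]) rfl fun u => ?_⟩
    rw [map_eq_act, map_eq_act, homotopyAct, sub_self, zero_smul, zero_smul, one_smul, one_smul,
      zero_add, add_zero, tmap_comp, tmap_id]
    rfl

namespace IsLinearHomotopy

variable {S} {α : ℂ} {u : Module.End ℂ (TensorAlgebra ℂ (Supermatrix N n))}

/-- `u p` is again a coderivation along two maps, and its degree-one component vanishes because `G`
is zero on `H`. -/
theorem mul_linProj (hu : IsLinearHomotopy S α u) : u * linProj S = 0 := by
  have e : homotopyAct tauA α (linProj S) u * (actL (linProj S) * actR (linProj S))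
      = actL (u * linProj S) * actR (linProj S)
        + actL (((1 - α) • 1 + α • linProj S) * tauT tauA * linProj S)
          * actR (u * linProj S) := by
    have hq : (α • (1 : Module.End ℂ (TensorAlgebra ℂ (Supermatrix N n))) + (1 - α) • linProj S)
        * linProj S = linProj S := by
      rw [add_mul, smul_mul_assoc, smul_mul_assoc, linProj_sq, one_mul, ← add_smul]
      simp
    rw [homotopyAct, add_mul, act_mul_act, act_mul_act, hq]
  refine eq_zero_of_comul (g := linProj S)
    (f := (((1 - α) • 1 + α • linProj S) * tauT tauA * linProj S)) ?_ ?_ (linProj_one S) 0 ?_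
  · rw [map_eq_act, map_eq_act, ← e, Module.End.mul_eq_comp, ← LinearMap.comp_assoc, hu.comul,
      LinearMap.comp_assoc, deconcat_linProj]
    rfl
  · have ht1 : tauT tauA (1 : TensorAlgebra ℂ (Supermatrix N n)) = 1 := tauT_one
    simp [linProj_one, ht1, ← add_smul]
  · intro l
    have h := DFunLike.congr_fun (pr₁_tmap (S.H.subtype ∘ₗ S.piH)) (word l)
    rw [LinearMap.comp_apply] at h
    rw [Module.End.mul_apply, hu.pr₁, linProj, h]
    simp [S.G_coe]

theorem standard (hu : IsLinearHomotopy S α u) (hD : IsMatrixFactorisation W D) : u * u = 0 ∧ tmap S.piH ∘ₗ u = 0 := by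
  refine standard_form tauA_tauA (linProj_eq S) (tmap_piH_linProj S) (linProj_one S)
    (linProj_tauT S hD) (deconcat_tmap _) (tmap_one _) hu.odd hu.comul hu.one hu.mul_linProj
    0 0 (fun l => ?_) (fun l => ?_)
  · rw [hu.pr₁, hu.pr₁]
    simp [S.G_G]
  · have h := DFunLike.congr_fun (pr₁_tmap S.piH) (u (word l))
    rw [LinearMap.comp_apply] at h
    rw [h, LinearMap.comp_apply, hu.pr₁]
    simp [S.piH_G]

theorem linProj_mul (hu : IsLinearHomotopy S α u) (hD : IsMatrixFactorisation W D) : linProj S * u = 0 := by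
  rw [Module.End.mul_eq_comp, linProj_eq, LinearMap.comp_assoc, (hu.standard hD).2,
    LinearMap.comp_zero]

/-- By `tens_interpolate`, `1 - p` obeys the same Leibniz rule as `∂₁ u + u ∂₁`. So the sum of the
two is decided in degree one, where it is the homotopy equation of the splitting. -/
theorem homotopy (hu : IsLinearHomotopy S α u) (hD : IsMatrixFactorisation W D) :
    linProj S = 1 + linPart D * u + u * linPart D := by
  have hd := (isOddCoderivation_iff _).mp (isOddCoderivation_linPart hD)
  have e1 := anticomm_homotopy_comul (R := Module.End ℂ (TensorAlgebra ℂ (Supermatrix N n)))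
    (S := Module.End ℂ (TensorAlgebra ℂ (Supermatrix N n) ⊗[ℂ] TensorAlgebra ℂ (Supermatrix N n)))
    (l := actL) (r := actR) act_comm (tauT_sq tauA_tauA) α hu.odd hd.1
    ((linPart_mul_linProj S).trans (linProj_mul_linPart S).symm) (linProj_tauT S hD)
  have e2 := tens_interpolate (R := Module.End ℂ (TensorAlgebra ℂ (Supermatrix N n)))
    (S := Module.End ℂ (TensorAlgebra ℂ (Supermatrix N n) ⊗[ℂ] TensorAlgebra ℂ (Supermatrix N n)))
    (l := actL) (r := actR) α 1 (linProj S)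
  rw [map_one, map_one, one_mul] at e2
  suffices (1 - linProj S) + (linPart D * u + u * linPart D) = 0 by
    linear_combination (norm := noncomm_ring) -this
  have ht1 : tauT tauA (1 : TensorAlgebra ℂ (Supermatrix N n)) = 1 := tauT_one
  refine eq_zero_of_comul (g := α • 1 + (1 - α) • linProj S)
    (f := (1 - α) • 1 + α • linProj S) ?_ ?_ ?_ 0 ?_
  · have h1 : deconcat ∘ₗ (linPart D * u + u * linPart D)
        = ((actL (linPart D) + actL (tauT tauA) * actR (linPart D))
            * homotopyAct tauA α (linProj S) u + homotopyAct tauA α (linProj S) u *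
              (actL (linPart D) + actL (tauT tauA) * actR (linPart D))) ∘ₗ deconcat := by
      rw [LinearMap.comp_add, Module.End.mul_eq_comp, Module.End.mul_eq_comp,
        ← LinearMap.comp_assoc, ← LinearMap.comp_assoc, hd.2, hu.comul, LinearMap.comp_assoc,
        LinearMap.comp_assoc, hd.2, hu.comul]
      rfl
    rw [LinearMap.comp_add, LinearMap.comp_sub, h1, homotopyAct, e1, deconcat_linProj]
    have h2 : deconcat ∘ₗ (1 : Module.End ℂ (TensorAlgebra ℂ (Supermatrix N n)))
        - (actL (linProj S) * actR (linProj S)) ∘ₗ deconcat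
        = (1 - actL (linProj S) * actR (linProj S)) ∘ₗ deconcat := by
      rw [LinearMap.sub_comp]; rfl
    rw [h2, ← e2, ← LinearMap.add_comp, map_eq_act, map_eq_act]
    congr 1
    simp only [map_add, add_mul, mul_add]
    abel
  · simp [linProj_one, ← add_smul]
  · simp [linProj_one, ← add_smul]
  · intro l
    have h := DFunLike.congr_fun (pr₁_tmap (S.H.subtype ∘ₗ S.piH)) (word l)
    rw [LinearMap.comp_apply] at h
    have h' := S.homotopy (LGBulk.pr₁ (word l))
    simp only [LinearMap.add_apply, LinearMap.sub_apply, Module.End.mul_apply, map_add, map_sub,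
      Module.End.one_apply, pr₁_linPart, hu.pr₁, LinearMap.zero_apply, map_neg]
    rw [linProj, h]
    simp only [LinearMap.comp_apply, Submodule.subtype_apply]
    rw [sub_zero, add_zero, add_zero, ← neg_eq_zero, ← sub_eq_zero.mpr h']
    abel

theorem isUnit (hu : IsLinearHomotopy S α u) : IsUnit (1 - quadPart * u) := by
  refine isUnit_one_sub_of_degLT fun m x hx => ?_
  have hq : ∀ l : List (Supermatrix N n), quadPart (word l) ∈ degLT _ l.length := by
    intro l
    rcases l with _ | ⟨a, l⟩
    · rw [word_nil, quadPart_one]; exact Submodule.zero_mem _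
    · induction l generalizing a with
      | nil =>
        rw [word_cons, word_nil, mul_one, quadPart_ι]; exact Submodule.zero_mem _
      | cons b l ih =>
        rw [word_cons, word_cons, quadPart_ι_mul_ι_mul, ← word_cons b]
        exact Submodule.add_mem _ (ι_mul_mem_degLT _ (word_mem_degLT (Nat.lt_succ_self _)))
          (ι_mul_mem_degLT _ (ih b))
  have mono : ∀ {k m : ℕ}, k ≤ m →
      degLT (Supermatrix N n) k ≤ degLT (Supermatrix N n) m := fun h =>
    Submodule.span_mono (Set.image_mono fun _ hl => lt_of_lt_of_le hl h)
  have h1 : u x ∈ degLT _ (m + 1) := map_mem_degLT (fun l hl => mono hl (hu.degree l)) hx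
  exact map_mem_degLT (fun l hl => mono (Nat.lt_succ_iff.mp hl) (hq l)) h1

end IsLinearHomotopy

end Linear

/-! ### Existence: perturbing the linear contraction by `∂₂`. -/

section Existence

variable {N n : ℕ} {W : MvPolynomial (Fin N) ℂ} {D : Supermatrix N n}
  {S : Splitting tauA (brst D)}

theorem homotopyAct_comul_perturbed {α : ℂ} (hα : α = 0 ∨ α = 1)
    {u U e p P m : Module.End ℂ (TensorAlgebra ℂ (Supermatrix N n))}
    (hut : u * tauT tauA = -(tauT tauA * u)) (he : e * tauT tauA = -(tauT tauA * e))
    (hpt : p * tauT tauA = tauT tauA * p)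
    (hUu : U * u = 0) (hPu : P * u = 0) (hUp : U * p = 0) (hPp : P * p = m)
    (hUeu : U * e * u = U - u) (hPeu : P * e * u = P - m) (hUep : U * e * p = m - p) :
    homotopyAct tauA α P U
        * (1 - (actL e + actL (tauT tauA) * actR e) * homotopyAct tauA α p u)
      = homotopyAct tauA α p u := by
  have ht := tauT_sq (tauA_tauA (N := N) (n := n))
  rcases hα with rfl | rfl
  · have h := perturbed_homotopy_comul_zero
      (R := Module.End ℂ (TensorAlgebra ℂ (Supermatrix N n)))
      (S := Module.End ℂ
        (TensorAlgebra ℂ (Supermatrix N n) ⊗[ℂ] TensorAlgebra ℂ (Supermatrix N n)))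
      (l := actL) (r := actR) act_comm ht hut hUu hPu hUp hPp hUeu hPeu hUep
    simpa only [homotopyAct, zero_smul, sub_zero, one_smul, zero_add, add_zero, one_mul] using h
  · have h := perturbed_homotopy_comul_one
      (R := Module.End ℂ (TensorAlgebra ℂ (Supermatrix N n)))
      (S := Module.End ℂ
        (TensorAlgebra ℂ (Supermatrix N n) ⊗[ℂ] TensorAlgebra ℂ (Supermatrix N n)))
      (l := actL) (r := actR) act_comm ht hut he hpt hUu hPu hUp hPp hUeu hPeu hUep
    simpa only [homotopyAct, zero_smul, sub_self, one_smul, zero_add, add_zero, map_one,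
      mul_one] using h

/-- The projector onto the retract is a coalgebra morphism. -/
theorem comul_of_homotopy {α : ℂ} {b U P : Module.End ℂ (TensorAlgebra ℂ (Supermatrix N n))}
    (hb : IsOddCoderivation tauA b) (hU : U * tauT tauA = -(tauT tauA * U))
    (hUc : deconcat ∘ₗ U = homotopyAct tauA α P U ∘ₗ deconcat) (hbP : b * P = P * b)
    (hP : P * tauT tauA = tauT tauA * P) (h : P = 1 + (b * U + U * b)) :
    deconcat ∘ₗ P = (actL P * actR P) ∘ₗ deconcat := by
  have hd := (isOddCoderivation_iff _).mp hb
  have e1 := anticomm_homotopy_comul (R := Module.End ℂ (TensorAlgebra ℂ (Supermatrix N n)))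
    (S := Module.End ℂ (TensorAlgebra ℂ (Supermatrix N n) ⊗[ℂ] TensorAlgebra ℂ (Supermatrix N n)))
    (l := actL) (r := actR) act_comm (tauT_sq tauA_tauA) α hU hd.1 hbP hP
  have e2 := tens_interpolate_one (R := Module.End ℂ (TensorAlgebra ℂ (Supermatrix N n)))
    (S := Module.End ℂ (TensorAlgebra ℂ (Supermatrix N n) ⊗[ℂ] TensorAlgebra ℂ (Supermatrix N n)))
    (l := actL) (r := actR) α h
  -- The anticommutator of `b` and `U` is `P - 1`, so its Leibniz rule of type `α` sums to `P ⊗ P -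
  -- 1`.
  rw [← e1, eq_sub_iff_add_eq] at e2
  have h1 : deconcat ∘ₗ (b * U + U * b)
      = ((actL b + actL (tauT tauA) * actR b) * homotopyAct tauA α P U + homotopyAct tauA α P U *
            (actL b + actL (tauT tauA) * actR b)) ∘ₗ deconcat := by
    rw [LinearMap.comp_add, Module.End.mul_eq_comp, Module.End.mul_eq_comp,
      ← LinearMap.comp_assoc, ← LinearMap.comp_assoc, hd.2, hUc, LinearMap.comp_assoc,
      LinearMap.comp_assoc, hd.2, hUc]
    rfl
  rw [← e2]
  conv_lhs => rw [h, LinearMap.comp_add, h1]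
  rw [add_comm, LinearMap.add_comp]
  rfl

/-- The differential `F̄ ∂ F` and the retraction data on `T_H`. -/
theorem isMinimalModel_and_isRetraction (hD : IsMatrixFactorisation W D) {α : ℂ}
    {F : TensorAlgebra ℂ S.H →ₗ[ℂ] TensorAlgebra ℂ (Supermatrix N n)}
    {Fb : TensorAlgebra ℂ (Supermatrix N n) →ₗ[ℂ] TensorAlgebra ℂ S.H}
    {U : Module.End ℂ (TensorAlgebra ℂ (Supermatrix N n))}
    (hF : IsStrongCoalgHom S.tauH tauA F) (hFb : IsStrongCoalgHom tauA S.tauH Fb)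
    (hUodd : IsOdd tauA U) (hFbF : Fb ∘ₗ F = LinearMap.id)
    (hP : F ∘ₗ Fb - LinearMap.id = offShell D ∘ₗ U + U ∘ₗ offShell D)
    (hUc : deconcat ∘ₗ U
      = (TensorProduct.map U (α • LinearMap.id + (1 - α) • (F ∘ₗ Fb))
        + tensorOdd tauA ((1 - α) • LinearMap.id + α • (F ∘ₗ Fb)) U) ∘ₗ deconcat)
    (hU1 : U 1 = 0)
    (hFι : ∀ a, F (TensorAlgebra.ι ℂ a) = TensorAlgebra.ι ℂ (a : Supermatrix N n))
    (hUι : ∀ a, U (TensorAlgebra.ι ℂ a) = -TensorAlgebra.ι ℂ (S.G a))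
    (hpF : ∀ x, pr₁ (F x) = (pr₁ x : S.H) - S.G (r₂ (F x)))
    (hpU : ∀ x, pr₁ (U x) = -S.G (pr₁ x) - S.G (r₂ (U x)))
    (hpFb : ∀ x, pr₁ (Fb x) = S.piH (pr₁ x) + S.piH (r₂ (U x))) :
    IsMinimalModel S F (Fb ∘ₗ offShell D ∘ₗ F) ∧
      IsRetraction S α F (Fb ∘ₗ offShell D ∘ₗ F) Fb U := by
  have hb0 := offShell_one (D := D)
  -- `∂` commutes with `F F̄`. Together with `F̄ F = id` this makes `F` and `F̄` chain maps for `F̄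
  -- ∂ F` and gives its square zero.
  have hbP : offShell D * (F ∘ₗ Fb) = (F ∘ₗ Fb) * offShell D :=
    comm_of_homotopy (offShell_sq hD) (sub_eq_iff_eq_add'.mp hP)
  have hbPx : ∀ x, F (Fb (offShell D x)) = offShell D (F (Fb x)) :=
    fun x => (DFunLike.congr_fun hbP x).symm
  have hFbFx : ∀ x, Fb (F x) = x := fun x => DFunLike.congr_fun hFbF x
  have hb2x : ∀ x, offShell D (offShell D x) = 0 := fun x => DFunLike.congr_fun (offShell_sq hD) x
  have hFtx : ∀ x, F (tauT S.tauH x) = tauT tauA (F x) := fun x => DFunLike.congr_fun hF.even x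
  have hFbtx : ∀ x, Fb (tauT tauA x) = tauT S.tauH (Fb x) := fun x => DFunLike.congr_fun hFb.even x
  have hbtx : ∀ x, offShell D (tauT tauA x) = -tauT tauA (offShell D x) :=
    fun x => DFunLike.congr_fun (isOddCoderivation_offShell hD).odd x
  refine ⟨⟨hF, ⟨⟨?_, ?_⟩, ?_, ?_⟩, ?_, ?_, ?_, ?_⟩,
    ⟨hFb, hUodd, ?_, hFbF, hP, hUc, hU1, ?_, ?_, ?_, ?_⟩⟩
  · refine LinearMap.ext fun x => ?_
    simp only [LinearMap.comp_apply, LinearMap.neg_apply, hFtx, hbtx, map_neg, hFbtx]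
  · have hcl := (isOddCoderivation_offShell hD).coLeibniz
    rw [tensorOdd, LinearMap.id_comp] at hcl ⊢
    have hm : TensorProduct.map Fb Fb ∘ₗ (TensorProduct.map (offShell D) LinearMap.id
          + TensorProduct.map (tauT tauA) (offShell D)) ∘ₗ TensorProduct.map F F
        = TensorProduct.map (Fb ∘ₗ offShell D ∘ₗ F) LinearMap.id
          + TensorProduct.map (tauT S.tauH) (Fb ∘ₗ offShell D ∘ₗ F) := by
      refine TensorProduct.ext' fun x y => ?_
      simp [hFbFx, hFbtx]
    refine LinearMap.ext fun x => ?_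
    have e1 : ∀ y, deconcat (Fb y) = TensorProduct.map Fb Fb (deconcat y) :=
      fun y => DFunLike.congr_fun hFb.comul y
    have e2 : ∀ y, deconcat (F y) = TensorProduct.map F F (deconcat y) :=
      fun y => DFunLike.congr_fun hF.comul y
    have e3 := DFunLike.congr_fun hcl (F x)
    rw [LinearMap.comp_apply, LinearMap.comp_apply] at e3
    rw [← hm, LinearMap.comp_apply, LinearMap.comp_apply, LinearMap.comp_apply, e1, e3, e2]
    rfl
  · refine LinearMap.ext fun x => ?_
    simp only [LinearMap.comp_apply, hbPx, hb2x, map_zero, LinearMap.zero_apply]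
  · rw [LinearMap.comp_apply, LinearMap.comp_apply, hF.strong, hb0, map_zero]
  · intro a
    rw [LinearMap.comp_apply, LinearMap.comp_apply, hFι, offShell_eq, LinearMap.add_apply,
      quadPart_ι, add_zero, ← mul_one (TensorAlgebra.ι ℂ _), linPart_ι_mul, linPart_one,
      S.d_of_mem_H a.2]
    simp
  · refine LinearMap.ext fun x => ?_
    simp only [LinearMap.comp_apply, hbPx, hFbFx]
  · intro a
    rw [hFι, pr₁_ι]
  · intro m hm v
    rw [hpF, pr₁_tprod hm]
    simp
  · refine LinearMap.ext fun x => ?_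
    simp only [LinearMap.comp_apply, ← hbPx, hFbFx]
  · intro a
    rw [hUι, map_neg, pr₁_ι]
  · intro m hm v
    rw [hpU, pr₁_tprod hm]
    simp
  · intro a
    rw [hpFb, hUι, map_neg, r₂_ι, pr₁_ι]
    simp
  · intro m hm v
    rw [hpFb, pr₁_tprod hm]
    simp

set_option maxHeartbeats 1000000 in
-- The perturbation lemma with base `∂₁` and perturbation `∂₂`. The fixed-point equations `U = u + u
-- ∂₂ U` and `F = i + u ∂₂ F`, and `F̄ = π + π ∂₂ U`, become the required recursions after `pr₁`,
-- because `u` acts there as `-G`.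
theorem exists_retraction (hD : IsMatrixFactorisation W D) {α : ℂ} (hα : α = 0 ∨ α = 1) :
    ∃ F dt Fb U, IsMinimalModel S F dt ∧ IsRetraction S α F dt Fb U := by
  obtain ⟨u, hu⟩ := exists_isLinearHomotopy S hD hα
  obtain ⟨v, hv⟩ := hu.isUnit
  obtain ⟨Nn, hN, hN'⟩ : ∃ Nn : Module.End ℂ (TensorAlgebra ℂ (Supermatrix N n)),
      Nn * (1 - quadPart * u) = 1 ∧ (1 - quadPart * u) * Nn = 1 :=
    ⟨↑v⁻¹, by rw [← hv, Units.inv_mul], by rw [← hv, Units.mul_inv]⟩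
  clear hv v
  have huu := (hu.standard hD).1
  have hFu := (hu.standard hD).2
  have hup := hu.mul_linProj
  have hpt := linProj_tauT S hD
  have hp := hu.homotopy hD
  have hee := (isOddCoderivation_iff _).mp (isOddCoderivation_quadPart (N := N) (n := n))
  have hbb := (isOddCoderivation_iff _).mp (isOddCoderivation_offShell hD)
  have hb2 := offShell_sq hD
  obtain ⟨r1, r2, r3, r4, r5, r6, r7, r8, r9⟩ := perturbed_relations hN huu hup
    (hu.linProj_mul hD) (linProj_sq S)
  have hMu := perturbed_inverse_mul hN
  have hP := perturbed_homotopy hN hN' hp (linPart_quadPart hD)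
  rw [← offShell_eq] at hP
  obtain ⟨hN1, hN2⟩ := perturbed_inverse_eq hN hN'
  have hNt := perturbed_inverse_comm hN hN' hee.1 hu.odd
  have hUodd : u * Nn * tauT tauA = -(tauT tauA * (u * Nn)) := by
    rw [mul_assoc, hNt, ← mul_assoc, hu.odd, ← mul_assoc]
    exact LinearMap.neg_comp _ _
  have hUx : ∀ x, (u * Nn) x = u x + u (quadPart ((u * Nn) x)) := fun x => by
    conv_lhs => rw [Module.End.mul_apply, hN2]
    simp [map_add]
  set M := 1 + u * Nn * quadPart with hM
  set U := u * Nn with hU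
  set P := M * linProj S * Nn with hPdef
  have hMt : M * tauT tauA = tauT tauA * M := by
    have := odd_mul_odd hUodd hee.1
    rw [hM, add_mul, mul_add, this, one_mul, mul_one]
  have hPt : P * tauT tauA = tauT tauA * P := by
    rw [hPdef, mul_assoc, hNt, ← mul_assoc, mul_assoc M, hpt, ← mul_assoc M, hMt]
    simp only [mul_assoc]
  have hbP : offShell D * P = P * offShell D := comm_of_homotopy hb2 hP
  have hU1 : U 1 = 0 := by rw [← hMu, Module.End.mul_apply, hu.one, map_zero]
  have hM1 : ∀ x, quadPart x = 0 → M x = x := fun x hx => by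
    rw [hM, LinearMap.add_apply, Module.End.mul_apply, hx, map_zero, add_zero]
    rfl
  have hUι : ∀ a, U (TensorAlgebra.ι ℂ a) = -TensorAlgebra.ι ℂ (S.G a) := fun a => by
    rw [← hMu, Module.End.mul_apply, hu.ι, map_neg, hM1 _ (quadPart_ι _)]
  have hΔ : deconcat ∘ₗ (1 - quadPart * u) = (1 - (actL quadPart
      + actL (tauT tauA) * actR quadPart) * homotopyAct tauA α (linProj S) u) ∘ₗ deconcat := by
    rw [LinearMap.comp_sub, LinearMap.sub_comp, Module.End.mul_eq_comp, ← LinearMap.comp_assoc,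
      hee.2, LinearMap.comp_assoc, hu.comul]
    rfl
  -- Compared after right multiplication by the invertible `1 - ∂₂ u`, both sides reduce to `Δ u`.
  have hUc : deconcat ∘ₗ U = homotopyAct tauA α P U ∘ₗ deconcat := by
    have hUN : U ∘ₗ (1 - quadPart * u) = u := by
      change u * Nn * (1 - quadPart * u) = u
      rw [mul_assoc, hN, mul_one]
    have h1 : (deconcat ∘ₗ U) ∘ₗ (1 - quadPart * u)
        = (homotopyAct tauA α P U ∘ₗ deconcat) ∘ₗ (1 - quadPart * u) := by
      rw [LinearMap.comp_assoc, hUN, LinearMap.comp_assoc, hΔ, ← LinearMap.comp_assoc,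
        ← Module.End.mul_eq_comp, homotopyAct_comul_perturbed hα hu.odd hee.1 hpt r3 r4 r5 r6 r7
          r8 r9, hu.comul]
    have h2 := congrArg (fun z => z ∘ₗ Nn) h1
    simp only [LinearMap.comp_assoc, ← Module.End.mul_eq_comp, mul_assoc, hN', mul_one] at h2
    exact h2
  have hPc := comul_of_homotopy (isOddCoderivation_offShell hD) hUodd hUc hbP hPt hP
  set F := M ∘ₗ tmap S.H.subtype with hF
  set Fb := tmap S.piH ∘ₗ Nn with hFb
  have hFFb : F ∘ₗ Fb = P := by
    rw [hPdef, linProj_eq]; rfl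
  have huF : ∀ x, u (tmap S.H.subtype x) = 0 := fun x => by
    have h1 : linProj S (tmap S.H.subtype x) = tmap S.H.subtype x := by
      have := DFunLike.congr_fun (tmap_piH_tmap_subtype S) x
      rw [linProj_eq, LinearMap.comp_apply]
      exact congrArg _ this
    rw [← h1]
    exact DFunLike.congr_fun hup _
  -- `N = 1 + N ∂₂ u` is the identity on the kernel of `u`, which contains the image of `i`, the
  -- image of `u` and the unit.
  have hNx : ∀ x, u x = 0 → Nn x = x := fun x hx => by
    conv_lhs => rw [hN1]
    simp [hx]
  have hFbF : Fb ∘ₗ F = LinearMap.id := by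
    refine LinearMap.ext fun x => ?_
    have h1 : F x = tmap S.H.subtype x + u (Nn (quadPart (tmap S.H.subtype x))) := rfl
    rw [LinearMap.comp_apply, h1, map_add, hFb, LinearMap.comp_apply, LinearMap.comp_apply,
      hNx _ (huF x), hNx _ (DFunLike.congr_fun huu _)]
    have h2 := DFunLike.congr_fun hFu (Nn (quadPart (tmap S.H.subtype x)))
    rw [LinearMap.comp_apply] at h2
    rw [h2]
    have h3 := DFunLike.congr_fun (tmap_piH_tmap_subtype S) x
    simpa using h3
  have hFb1 : Fb 1 = 1 := by
    rw [hFb, LinearMap.comp_apply, hNx _ hu.one, tmap_one]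
  have hF1 : F 1 = 1 := by
    rw [hF, LinearMap.comp_apply, tmap_one, hM1 _ quadPart_one]
  have hFbc : deconcat ∘ₗ Fb = TensorProduct.map Fb Fb ∘ₗ deconcat := by
    have hk1 : linProj S * Nn = linProj S + linProj S * Nn * quadPart * u := by
      conv_lhs => rw [hN1]
      rw [mul_add, mul_one]
      simp only [mul_assoc]
    have hk2 : linProj S * Nn * tauT tauA = tauT tauA * (linProj S * Nn) := by
      rw [mul_assoc, hNt, ← mul_assoc, hpt, mul_assoc]
    have hk := perturbed_projector_comul
      (R := Module.End ℂ (TensorAlgebra ℂ (Supermatrix N n)))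
      (S := Module.End ℂ
        (TensorAlgebra ℂ (Supermatrix N n) ⊗[ℂ] TensorAlgebra ℂ (Supermatrix N n)))
      (l := actL) (r := actR) act_comm (tauT_sq tauA_tauA) α hk1 hpt hk2
      (by rw [mul_assoc, r1, hu.linProj_mul hD]) (by rw [mul_assoc, r2, linProj_sq])
    -- `F̄ = π N` is rewritten through the endomorphism `k = p N` of `T_A`, to which the identity on
    -- the tensor square applies.
    have hFbk : Fb = tmap S.piH ∘ₗ (linProj S * Nn) := by
      rw [Module.End.mul_eq_comp, ← LinearMap.comp_assoc, tmap_piH_linProj]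
    have h1 : (TensorProduct.map Fb Fb ∘ₗ deconcat) ∘ₗ (1 - quadPart * u)
        = (deconcat ∘ₗ Fb) ∘ₗ (1 - quadPart * u) := by
      have h2 : Fb ∘ₗ (1 - quadPart * u) = tmap S.piH := by
        rw [hFb, LinearMap.comp_assoc, ← Module.End.mul_eq_comp, hN]
        rfl
      rw [LinearMap.comp_assoc, hΔ, LinearMap.comp_assoc, h2, hFbk, TensorProduct.map_comp,
        map_eq_act, LinearMap.comp_assoc, ← LinearMap.comp_assoc deconcat,
        ← Module.End.mul_eq_comp, homotopyAct, hk, ← map_eq_act, ← LinearMap.comp_assoc,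
        ← TensorProduct.map_comp, tmap_piH_linProj, deconcat_tmap]
    have h2 := congrArg (fun z => z ∘ₗ Nn) h1
    simp only [LinearMap.comp_assoc, ← Module.End.mul_eq_comp, hN'] at h2
    exact h2.symm
  have hPF : P ∘ₗ F = F := by rw [← hFFb, LinearMap.comp_assoc, hFbF, LinearMap.comp_id]
  have hFbP : Fb ∘ₗ P = Fb := by rw [← hFFb, ← LinearMap.comp_assoc, hFbF, LinearMap.id_comp]
  -- `P = F F̄` and `F̄` are compatible with the coproduct; composing with `F` on the right and
  -- using `F̄ F = id` transfers this to `F`.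
  have hFc : deconcat ∘ₗ F = TensorProduct.map F F ∘ₗ deconcat := by
    clear_value F Fb P
    have hPc' : deconcat ∘ₗ P = TensorProduct.map F F ∘ₗ deconcat ∘ₗ Fb := by
      rw [hPc, ← map_eq_act, ← hFFb, TensorProduct.map_comp, LinearMap.comp_assoc, ← hFbc]
    conv_lhs => rw [← hPF, ← LinearMap.comp_assoc, hPc']
    rw [LinearMap.comp_assoc, LinearMap.comp_assoc, hFbF, LinearMap.comp_id]
  have hFt : F ∘ₗ tauT S.tauH = tauT tauA ∘ₗ F := by
    rw [hF, LinearMap.comp_assoc, ← tauT_tmap_subtype, ← LinearMap.comp_assoc,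
      ← LinearMap.comp_assoc]
    exact congrArg (fun z => z ∘ₗ tmap S.H.subtype) hMt
  have hFbt : Fb ∘ₗ tauT tauA = tauT S.tauH ∘ₗ Fb := by
    rw [hFb, ← LinearMap.comp_assoc, ← tmap_piH_tauT S hD, LinearMap.comp_assoc,
      LinearMap.comp_assoc]
    exact congrArg (fun z => tmap S.piH ∘ₗ z) hNt
  have hNxx : ∀ x, Nn x = x + quadPart (U x) := fun x => by
    conv_lhs => rw [hN2]
    simp [hU]
  have hFx : ∀ x, F x = tmap S.H.subtype x + u (quadPart (F x)) := fun x => by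
    have h1 : F x = tmap S.H.subtype x + u (Nn (quadPart (tmap S.H.subtype x))) := rfl
    have h2 : quadPart (F x) = Nn (quadPart (tmap S.H.subtype x)) := by
      rw [hNxx, h1, map_add]
      rfl
    rw [h2, h1]
  have hFbx : ∀ x, Fb x = tmap S.piH x + tmap S.piH (quadPart (U x)) := fun x => by
    rw [hFb, LinearMap.comp_apply, hNxx, map_add]
  have hFι : ∀ a, F (TensorAlgebra.ι ℂ a) = TensorAlgebra.ι ℂ (a : Supermatrix N n) := fun a => by
    rw [hF, LinearMap.comp_apply, tmap_ι, hM1 _ (quadPart_ι _)]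
    rfl
  have hcF : ∀ x, counit (tmap S.H.subtype x) = counit x :=
    fun x => DFunLike.congr_fun (counit_tmap _) x
  have hcFb : ∀ x, counit (tmap S.piH x) = counit x :=
    fun x => DFunLike.congr_fun (counit_tmap _) x
  have hpF : ∀ x, pr₁ (F x) = (pr₁ x : S.H) - S.G (r₂ (F x)) := fun x => by
    have h := DFunLike.congr_fun (pr₁_tmap S.H.subtype) x
    rw [LinearMap.comp_apply] at h
    conv_lhs => rw [hFx, map_add, hu.pr₁, pr₁_quadPart, h]
    rw [sub_eq_add_neg]
    rfl
  have hpU : ∀ x, pr₁ (U x) = -S.G (pr₁ x) - S.G (r₂ (U x)) := fun x => by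
    conv_lhs => rw [hUx, map_add, hu.pr₁, hu.pr₁, pr₁_quadPart]
    rw [sub_eq_add_neg]
  have hpFb : ∀ x, pr₁ (Fb x) = S.piH (pr₁ x) + S.piH (r₂ (U x)) := fun x => by
    have h : ∀ y, pr₁ (tmap S.piH y) = S.piH (pr₁ y) :=
      fun y => DFunLike.congr_fun (pr₁_tmap S.piH) y
    rw [hFbx, map_add, h, h, pr₁_quadPart]
  refine ⟨F, Fb ∘ₗ offShell D ∘ₗ F, Fb, U, isMinimalModel_and_isRetraction hD
    ⟨hFt, hFc, LinearMap.ext fun x => ?_, hF1⟩ ⟨hFbt, hFbc, LinearMap.ext fun x => ?_, hFb1⟩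
    hUodd hFbF ?_ ?_ hU1 hFι hUι hpF hpU hpFb⟩
  · rw [LinearMap.comp_apply, hFx, map_add, hu.counit, hcF, add_zero]
  · rw [LinearMap.comp_apply, hFbx, map_add, hcFb, hcFb, counit_quadPart, add_zero]
  · rw [hFFb, sub_eq_iff_eq_add']
    exact hP
  · rw [hUc, homotopyAct_eq, hFFb]

end Existence

/-! ### Uniqueness and the side conditions for arbitrary `α`. -/

section Uniqueness

variable {N n : ℕ} {W : MvPolynomial (Fin N) ℂ} {D : Supermatrix N n}
  {S : Splitting tauA (brst D)} {α : ℂ}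
  {F : TensorAlgebra ℂ S.H →ₗ[ℂ] TensorAlgebra ℂ (Supermatrix N n)}
  {dt : Module.End ℂ (TensorAlgebra ℂ S.H)}
  {Fb Fb' : TensorAlgebra ℂ (Supermatrix N n) →ₗ[ℂ] TensorAlgebra ℂ S.H}
  {U U' : Module.End ℂ (TensorAlgebra ℂ (Supermatrix N n))}

/-- The map `r₂` on `A[1] ⊗ A[1]`. -/
noncomputable def mulTau : Supermatrix N n ⊗[ℂ] Supermatrix N n →ₗ[ℂ] Supermatrix N n :=
  LinearMap.mul' ℂ _ ∘ₗ TensorProduct.map tauA LinearMap.id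

theorem r₂_eq_mulTau (x : TensorAlgebra ℂ (Supermatrix N n)) : r₂ x = mulTau (pr₂ x) := rfl

theorem eq_on_word {V M : Type*} [AddCommGroup V] [Module ℂ V] [AddCommGroup M] [Module ℂ M]
    {f g : TensorAlgebra ℂ V →ₗ[ℂ] M} (h0 : f 1 = g 1)
    (h1 : ∀ a, f (TensorAlgebra.ι ℂ a) = g (TensorAlgebra.ι ℂ a))
    (h2 : ∀ m : ℕ, 2 ≤ m → ∀ v : Fin m → V,
      f (TensorAlgebra.tprod ℂ V m v) = g (TensorAlgebra.tprod ℂ V m v)) : f = g := by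
  refine ext_word fun l => ?_
  rcases l with _ | ⟨a, _ | ⟨b, l⟩⟩
  · exact h0
  · simpa [word_cons] using h1 a
  · have := h2 (a :: b :: l).length (by simp) (a :: b :: l).get
    rwa [tprod_eq_word, List.ofFn_get] at this

/-- The conditions for `m = 1` and `m ≥ 2` merge into one formula: `pr₁` vanishes on longer words,
and `r₂ F` vanishes on single letters since `F` maps them to primitive elements. -/
theorem IsMinimalModel.pr₁_apply (h : IsMinimalModel S F dt) (x : TensorAlgebra ℂ S.H) :
    pr₁ (F x) = (pr₁ x : S.H) - S.G (r₂ (F x)) := by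
  have : pr₁ ∘ₗ F = S.H.subtype ∘ₗ pr₁ - S.G ∘ₗ r₂ ∘ₗ F := by
    refine eq_on_word ?_ (fun a => ?_) fun m hm v => ?_
    · simp [h.coalgHom.strong, r₂_one]
    · have hp : IsPrimitive (F (TensorAlgebra.ι ℂ a)) := by
        have := DFunLike.congr_fun h.coalgHom.comul (TensorAlgebra.ι ℂ a)
        rw [LinearMap.comp_apply, LinearMap.comp_apply, deconcat_ι, map_add,
          TensorProduct.map_tmul, TensorProduct.map_tmul, h.coalgHom.strong] at this
        rw [IsPrimitive, this, add_comm]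
      simp [h.F_one, r₂_eq_zero_of_pr₂ hp.pr₂_eq_zero]
    · simp [-TensorAlgebra.tprod_apply, h.F_two_le m hm v, pr₁_tprod hm]
  exact DFunLike.congr_fun this x

theorem IsRetraction.isPrimitive_ι (h : IsRetraction S α F dt Fb U)
    (hF : F 1 = 1) (a : Supermatrix N n) : IsPrimitive (U (TensorAlgebra.ι ℂ a)) := by
  have := DFunLike.congr_fun h.comul (TensorAlgebra.ι ℂ a)
  rw [LinearMap.comp_apply, LinearMap.comp_apply, deconcat_ι, map_add, LinearMap.add_apply,
    LinearMap.add_apply, tensorOdd, TensorProduct.map_tmul, TensorProduct.map_tmul,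
    TensorProduct.map_tmul, TensorProduct.map_tmul, h.U_zero] at this
  rw [IsPrimitive, this]
  have ht1 : tauT tauA (1 : TensorAlgebra ℂ (Supermatrix N n)) = 1 := tauT_one
  simp [h.coalgHom.strong, hF, ht1, ← add_smul, add_comm]

theorem IsRetraction.pr₁_U (h : IsRetraction S α F dt Fb U) (hF : F 1 = 1)
    (x : TensorAlgebra ℂ (Supermatrix N n)) :
    pr₁ (U x) = -S.G (pr₁ x) - S.G (r₂ (U x)) := by
  have : pr₁ ∘ₗ U = -(S.G ∘ₗ pr₁) - S.G ∘ₗ r₂ ∘ₗ U := by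
    refine eq_on_word ?_ (fun a => ?_) fun m hm v => ?_
    · simp [h.U_zero]
    · simp [h.U_one, r₂_eq_zero_of_pr₂ (h.isPrimitive_ι hF a).pr₂_eq_zero]
    · simp [-TensorAlgebra.tprod_apply, h.U_two_le m hm v, pr₁_tprod hm]
  exact DFunLike.congr_fun this x

theorem IsRetraction.pr₁_Fb (h : IsRetraction S α F dt Fb U) (hF : F 1 = 1)
    (x : TensorAlgebra ℂ (Supermatrix N n)) :
    pr₁ (Fb x) = S.piH (pr₁ x) + S.piH (r₂ (U x)) := by
  have : pr₁ ∘ₗ Fb = S.piH ∘ₗ pr₁ + S.piH ∘ₗ r₂ ∘ₗ U := by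
    refine eq_on_word ?_ (fun a => ?_) fun m hm v => ?_
    · simp [h.coalgHom.strong, h.U_zero]
    · simp [h.Fb_one, r₂_eq_zero_of_pr₂ (h.isPrimitive_ι hF a).pr₂_eq_zero]
    · simp [-TensorAlgebra.tprod_apply, h.Fb_two_le m hm v, pr₁_tprod hm]
  exact DFunLike.congr_fun this x

/-- In the difference of the two recursions the inclusion of `H` cancels, leaving a function of
`pr₂`. -/
theorem IsMinimalModel.unique_F {F' : TensorAlgebra ℂ S.H →ₗ[ℂ] TensorAlgebra ℂ (Supermatrix N n)}
    {dt' : Module.End ℂ (TensorAlgebra ℂ S.H)} (h : IsMinimalModel S F dt)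
    (h' : IsMinimalModel S F' dt') : F = F' := by
  refine eq_of_comul h.coalgHom.comul h.coalgHom.strong h'.coalgHom.comul h'.coalgHom.strong
    (-(S.G ∘ₗ mulTau)) fun l => ?_
  simp only [LinearMap.sub_apply, map_sub, h.pr₁_apply, h'.pr₁_apply, LinearMap.neg_apply,
    LinearMap.comp_apply, r₂_eq_mulTau]
  abel

theorem IsMinimalModel.existsUnique (hD : IsMatrixFactorisation W D) :
    ∃! q : (TensorAlgebra ℂ S.H →ₗ[ℂ] TensorAlgebra ℂ (Supermatrix N n)) ×
        Module.End ℂ (TensorAlgebra ℂ S.H), IsMinimalModel S q.1 q.2 := by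
  obtain ⟨F, dt, Fb, U, hm, hr⟩ := exists_retraction (S := S) hD (Or.inl (rfl : (0 : ℂ) = 0))
  refine ⟨(F, dt), hm, fun q hq => ?_⟩
  have h1 : q.1 = F := hq.unique_F hm
  refine Prod.ext h1 ?_
  -- `F` has a left inverse `F̄`, so `F ∂̃ = ∂ F` determines `∂̃`.
  have h2 : F ∘ₗ q.2 = F ∘ₗ dt := by
    rw [← hm.comm, ← h1, hq.comm]
  have h3 := congrArg (fun z => Fb ∘ₗ z) h2
  simpa only [← LinearMap.comp_assoc, hr.leftInv, LinearMap.id_comp] using h3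

/-- The coproduct of `U` involves `F̄`, and `F̄` on a word involves `U` on the same word. The
induction on length treats both, `U` before `F̄`. -/
theorem IsRetraction.unique (hF : F 1 = 1) (h : IsRetraction S α F dt Fb U)
    (h' : IsRetraction S α F dt Fb' U') : Fb = Fb' ∧ U = U' := by
  have ht1 : tauT tauA (1 : TensorAlgebra ℂ (Supermatrix N n)) = 1 := tauT_one
  have key : ∀ l : List (Supermatrix N n),
      (Fb - Fb') (word l) = 0 ∧ (U - U') (word l) = 0 := by
    refine word_induction fun l ih => ?_
    have hK := fun l' hl' => (ih l' hl').1
    have hE := fun l' hl' => (ih l' hl').2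
    have hP : IsPrimitive ((U - U') (word l)) := by
      -- Every summand contains one difference. Those with `Fb - Fb'` need it only on shorter words,
      -- because the remaining cut is multiplied by `U' 1 = 0`.
      have e : TensorProduct.map U (α • LinearMap.id + (1 - α) • (F ∘ₗ Fb))
            + tensorOdd tauA ((1 - α) • LinearMap.id + α • (F ∘ₗ Fb)) U
            - (TensorProduct.map U' (α • LinearMap.id + (1 - α) • (F ∘ₗ Fb'))
            + tensorOdd tauA ((1 - α) • LinearMap.id + α • (F ∘ₗ Fb')) U')
          = TensorProduct.map (U - U') (α • LinearMap.id + (1 - α) • (F ∘ₗ Fb))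
            + TensorProduct.map U' ((1 - α) • (F ∘ₗ (Fb - Fb')))
            + TensorProduct.map (((1 - α) • LinearMap.id + α • (F ∘ₗ Fb)) ∘ₗ tauT tauA) (U - U')
            + TensorProduct.map (α • (F ∘ₗ (Fb - Fb') ∘ₗ tauT tauA)) U' := by
        refine TensorProduct.ext' fun x y => ?_
        simp only [tensorOdd, LinearMap.add_apply, LinearMap.sub_apply, LinearMap.smul_apply,
          TensorProduct.map_tmul, LinearMap.comp_apply, LinearMap.id_apply, map_sub,
          TensorProduct.sub_tmul, TensorProduct.tmul_sub, smul_sub, TensorProduct.add_tmul,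
          TensorProduct.tmul_add]
        abel
      have e1 := DFunLike.congr_fun h.comul (word l)
      have e2 := DFunLike.congr_fun h'.comul (word l)
      rw [LinearMap.comp_apply, LinearMap.comp_apply] at e1 e2
      rw [IsPrimitive, LinearMap.sub_apply, map_sub, e1, e2, ← LinearMap.sub_apply, e]
      simp only [LinearMap.add_apply]
      rw [map_deconcat_left _ _ l hE, map_deconcat_right _ _ l hE,
        map_deconcat_right U' _ l fun l' hl' => by
          rw [LinearMap.smul_apply, LinearMap.comp_apply, hK l' hl', map_zero, smul_zero],
        map_deconcat_left _ U' l fun l' hl' => by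
          rw [LinearMap.smul_apply, LinearMap.comp_apply, LinearMap.comp_apply, tauT_eq_tmap,
            tmap_word, hK _ (by simpa using hl'), map_zero, smul_zero]]
      simp [h'.U_zero, h.coalgHom.strong, hF, ht1, ← add_smul]
    have hE0 : (U - U') (word l) = 0 := by
      have : pr₁ ((U - U') (word l)) = 0 := by
        have h0 : r₂ (U (word l)) - r₂ (U' (word l)) = 0 := by
          rw [← map_sub, ← LinearMap.sub_apply]
          exact r₂_eq_zero_of_pr₂ hP.pr₂_eq_zero
        rw [LinearMap.sub_apply, map_sub, h.pr₁_U hF, h'.pr₁_U hF, sub_eq_zero.mp h0, sub_self]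
      rw [hP.eq_ι, this, map_zero]
    refine ⟨?_, hE0⟩
    have hP' : IsPrimitive ((Fb - Fb') (word l)) := by
      have e1 := DFunLike.congr_fun h.coalgHom.comul (word l)
      have e2 := DFunLike.congr_fun h'.coalgHom.comul (word l)
      rw [LinearMap.comp_apply, LinearMap.comp_apply] at e1 e2
      have e : TensorProduct.map Fb Fb - TensorProduct.map Fb' Fb'
          = TensorProduct.map (Fb - Fb') Fb + TensorProduct.map Fb' (Fb - Fb') := by
        rw [map_sub_left, map_sub_right]; abel
      rw [IsPrimitive, LinearMap.sub_apply, map_sub, e1, e2, ← LinearMap.sub_apply, e,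
        LinearMap.add_apply, map_deconcat_left _ _ l hK, map_deconcat_right _ _ l hK,
        h.coalgHom.strong, h'.coalgHom.strong, LinearMap.sub_apply]
    have : pr₁ ((Fb - Fb') (word l)) = 0 := by
      rw [LinearMap.sub_apply, sub_eq_zero] at hE0
      rw [LinearMap.sub_apply, map_sub, h.pr₁_Fb hF, h'.pr₁_Fb hF, hE0, sub_self]
    rw [hP'.eq_ι, this, map_zero]
  exact ⟨sub_eq_zero.mp (ext_word fun l => (key l).1),
    sub_eq_zero.mp (ext_word fun l => (key l).2)⟩

theorem IsRetraction.existsUnique (hD : IsMatrixFactorisation W D) (h : IsMinimalModel S F dt)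
    (hα : α = 0 ∨ α = 1) :
    ∃! q : (TensorAlgebra ℂ (Supermatrix N n) →ₗ[ℂ] TensorAlgebra ℂ S.H) ×
      Module.End ℂ (TensorAlgebra ℂ (Supermatrix N n)), IsRetraction S α F dt q.1 q.2 := by
  obtain ⟨F', dt', Fb, U, hm, hr⟩ := exists_retraction (S := S) hD hα
  -- The constructed retraction belongs to some minimal model, which uniqueness identifies with the
  -- given one.
  obtain ⟨rfl, rfl⟩ := Prod.ext_iff.mp
    ((IsMinimalModel.existsUnique (S := S) hD).unique (y₁ := (F, dt)) (y₂ := (F', dt')) h hm)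
  refine ⟨(Fb, U), hr, fun q hq => ?_⟩
  have := IsRetraction.unique h.coalgHom.strong hq hr
  exact Prod.ext this.1 this.2

/-- The degree-one part of `F` lies in the sum of `H` and the image of `G`, both killed by `G`; so
`pr₁ U F` depends only on `pr₂ U F`. -/
theorem IsRetraction.comp_F (hm : IsMinimalModel S F dt) (h : IsRetraction S α F dt Fb U) :
    U ∘ₗ F = 0 := by
  have ht1 : tauT tauA (1 : TensorAlgebra ℂ (Supermatrix N n)) = 1 := tauT_one
  refine eq_zero_of_comul (g := (α • LinearMap.id + (1 - α) • (F ∘ₗ Fb)) ∘ₗ F)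
    (f := (((1 - α) • LinearMap.id + α • (F ∘ₗ Fb)) ∘ₗ tauT tauA) ∘ₗ F) ?_ ?_ ?_
    (-(S.G ∘ₗ mulTau)) fun l => ?_
  · rw [← LinearMap.comp_assoc, h.comul, LinearMap.comp_assoc, hm.coalgHom.comul,
      ← LinearMap.comp_assoc, LinearMap.add_comp, tensorOdd, ← TensorProduct.map_comp,
      ← TensorProduct.map_comp]
  · simp [hm.coalgHom.strong, h.coalgHom.strong, ht1, ← add_smul]
  · simp [hm.coalgHom.strong, h.coalgHom.strong, ← add_smul]
  · rw [LinearMap.comp_apply, h.pr₁_U hm.coalgHom.strong, hm.pr₁_apply, map_sub, S.G_coe, S.G_G]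
    simp [r₂_eq_mulTau]

/-- `G G = 0` and `π_H G = 0` leave only the `r₂` terms in degree one, so that `standard_form`
applies. -/
theorem IsRetraction.standard (hm : IsMinimalModel S F dt) (h : IsRetraction S α F dt Fb U) :
    U ∘ₗ U = 0 ∧ U ∘ₗ F = 0 ∧ Fb ∘ₗ U = 0 := by
  have hUF := h.comp_F hm
  have hFbF : ∀ x, Fb (F x) = x := fun x => DFunLike.congr_fun h.leftInv x
  have hFt : ∀ x, F (tauT S.tauH x) = tauT tauA (F x) :=
    fun x => DFunLike.congr_fun hm.coalgHom.even x
  have hFbt : ∀ x, Fb (tauT tauA x) = tauT S.tauH (Fb x) :=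
    fun x => DFunLike.congr_fun h.coalgHom.even x
  have hs := standard_form (U := U) (p := F ∘ₗ Fb) (α := α) tauA_tauA rfl
    (LinearMap.ext fun x => by simp [hFbF])
    (by simp [h.coalgHom.strong, hm.coalgHom.strong])
    (LinearMap.ext fun x => by simp [hFt, hFbt]) h.coalgHom.comul h.coalgHom.strong h.odd
    (by rw [homotopyAct_eq, h.comul]) h.U_zero
    (by rw [Module.End.mul_eq_comp, ← LinearMap.comp_assoc, hUF, LinearMap.zero_comp])
    (-(S.G ∘ₗ mulTau)) (S.piH ∘ₗ mulTau) (fun l => ?_) (fun l => ?_)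
  · exact ⟨hs.1, hUF, hs.2⟩
  · rw [h.pr₁_U hm.coalgHom.strong, h.pr₁_U hm.coalgHom.strong (word l), map_sub, map_neg, S.G_G,
      S.G_G]
    simp [r₂_eq_mulTau]
  · rw [h.pr₁_Fb hm.coalgHom.strong, h.pr₁_U hm.coalgHom.strong (word l), map_sub, map_neg,
      S.piH_G, S.piH_G]
    simp [r₂_eq_mulTau]

end Uniqueness

/-! ### Formal power series of operators. -/

section Formal

variable {κ R : Type*}

/-- `X ^ k` has order at least `k`, so only the terms with `k` up to the degree of a monomial
contribute to its coefficient. -/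
theorem HasFormalSum.of_geometric [Ring R] {X Z N : MvPowerSeries κ R}
    (hX : MvPowerSeries.constantCoeff X = 0) (hN : (1 - X) * N = 1) :
    HasFormalSum (fun k => X ^ k * Z) (N * Z) := by
  classical
  obtain ⟨A, hNZ⟩ : ∃ A, N * Z = A := ⟨_, rfl⟩
  have hA : A = Z + X * A := by
    rw [← hNZ]
    linear_combination (norm := noncomm_ring) hN * Z
  rw [hNZ]
  have hvan : ∀ (k : ℕ) (Y : MvPowerSeries κ R) (m : κ →₀ ℕ), m.degree < k →
      MvPowerSeries.coeff m (X ^ k * Y) = 0 := by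
    intro k
    induction k with
    | zero => intro Y m hm; omega
    | succ k ih =>
      intro Y m hm
      rw [pow_succ', mul_assoc, MvPowerSeries.coeff_mul]
      refine Finset.sum_eq_zero fun p hp => ?_
      rw [Finset.HasAntidiagonal.mem_antidiagonal] at hp
      by_cases h : p.1 = 0
      · rw [h, MvPowerSeries.coeff_zero_eq_constantCoeff_apply, hX, zero_mul]
      · have h1 : 0 < p.1.degree := by
          rw [Nat.pos_iff_ne_zero, Ne, Finsupp.degree_eq_zero_iff]
          exact h
        have h2 : p.1.degree + p.2.degree = m.degree := by rw [← hp, map_add]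
        rw [ih Y p.2 (by omega), mul_zero]
  -- Iteration of `A = Z + X A`; the remainder `X ^ K A` does not reach degrees below `K`.
  have hsum : ∀ K : ℕ, A = ∑ k ∈ Finset.range K, X ^ k * Z + X ^ K * A := by
    intro K
    induction K with
    | zero => simp
    | succ K ih =>
      rw [Finset.sum_range_succ, pow_succ, mul_assoc, add_assoc, ← mul_add, ← hA]
      exact ih
  intro m
  have hs : Function.support (fun k => MvPowerSeries.coeff m (X ^ k * Z)) ⊆
      (Finset.range (m.degree + 1) : Set ℕ) := by
    intro k hk
    rw [Finset.coe_range, Set.mem_Iio]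
    by_contra h
    exact hk (hvan k Z m (by omega))
  refine ⟨(Finset.finite_toSet _).subset hs, ?_⟩
  rw [finsum_eq_sum_of_support_subset _ hs]
  conv_lhs => rw [hsum (m.degree + 1), map_add, hvan _ A m (by omega), add_zero, map_sum]

variable {C₁ C₂ : Type*} [AddCommGroup C₁] [Module ℂ C₁] [AddCommGroup C₂] [Module ℂ C₂]

theorem coeff_compress (p : C₁ →ₗ[ℂ] C₂) (i : C₂ →ₗ[ℂ] C₁)
    (X : MvPowerSeries κ (Module.End ℂ C₁)) (m : κ →₀ ℕ) :
    MvPowerSeries.coeff m (compress p i X) = p ∘ₗ MvPowerSeries.coeff m X ∘ₗ i := rfl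

theorem HasFormalSum.compress {f : ℕ → MvPowerSeries κ (Module.End ℂ C₁)}
    {s : MvPowerSeries κ (Module.End ℂ C₁)} (h : HasFormalSum f s) (p : C₁ →ₗ[ℂ] C₂)
    (i : C₂ →ₗ[ℂ] C₁) : HasFormalSum (fun k => compress p i (f k)) (compress p i s) := by
  intro m
  obtain ⟨h1, h2⟩ := h m
  have hs : Function.support (fun k => p ∘ₗ MvPowerSeries.coeff m (f k) ∘ₗ i) ⊆
      (h1.toFinset : Set ℕ) := by
    intro k hk
    rw [Set.Finite.coe_toFinset]
    intro h0
    exact hk (by simp only [h0, LinearMap.zero_comp, LinearMap.comp_zero])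
  simp only [coeff_compress]
  refine ⟨(Finset.finite_toSet _).subset hs, ?_⟩
  rw [finsum_eq_sum_of_support_subset _ hs, h2,
    finsum_eq_sum_of_support_subset (s := h1.toFinset) _ (by rw [Set.Finite.coe_toFinset]; rfl)]
  ext x
  simp [LinearMap.sum_apply]

theorem compress_add (p : C₁ →ₗ[ℂ] C₂) (i : C₂ →ₗ[ℂ] C₁)
    (X Y : MvPowerSeries κ (Module.End ℂ C₁)) :
    compress p i (X + Y) = compress p i X + compress p i Y := by
  ext1 m
  simp only [coeff_compress, map_add, LinearMap.add_comp, LinearMap.comp_add]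

theorem compress_zero (p : C₁ →ₗ[ℂ] C₂) (i : C₂ →ₗ[ℂ] C₁) :
    compress p i (0 : MvPowerSeries κ (Module.End ℂ C₁)) = 0 := by
  ext1 m
  simp only [coeff_compress, map_zero, LinearMap.zero_comp, LinearMap.comp_zero]

theorem compress_C_mul {p : C₁ →ₗ[ℂ] C₂} {i : C₂ →ₗ[ℂ] C₁} {d : Module.End ℂ C₁}
    {d' : Module.End ℂ C₂} (h : p ∘ₗ d = d' ∘ₗ p) (X : MvPowerSeries κ (Module.End ℂ C₁)) :
    compress p i (MvPowerSeries.C d * X) = MvPowerSeries.C d' * compress p i X := by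
  ext1 m
  simp only [coeff_compress, MvPowerSeries.coeff_C_mul, Module.End.mul_eq_comp]
  rw [LinearMap.comp_assoc, ← LinearMap.comp_assoc, h]
  rfl

theorem compress_mul_C {p : C₁ →ₗ[ℂ] C₂} {i : C₂ →ₗ[ℂ] C₁} {d : Module.End ℂ C₁}
    {d' : Module.End ℂ C₂} (h : d ∘ₗ i = i ∘ₗ d') (X : MvPowerSeries κ (Module.End ℂ C₁)) :
    compress p i (X * MvPowerSeries.C d) = compress p i X * MvPowerSeries.C d' := by
  ext1 m
  simp only [coeff_compress, MvPowerSeries.coeff_mul_C, Module.End.mul_eq_comp]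
  rw [LinearMap.comp_assoc, h]
  rfl

theorem compress_mul_compress (p : C₁ →ₗ[ℂ] C₂) (i : C₂ →ₗ[ℂ] C₁)
    (X Y : MvPowerSeries κ (Module.End ℂ C₁)) :
    compress p i X * compress p i Y
      = compress p i (X * MvPowerSeries.C (i ∘ₗ p) * Y) := by
  classical
  ext1 m
  rw [coeff_compress, MvPowerSeries.coeff_mul, MvPowerSeries.coeff_mul]
  ext x
  simp [LinearMap.sum_apply, coeff_compress, MvPowerSeries.coeff_mul_C]

theorem comp_finsetSum {ι M : Type*} [AddCommGroup M] [Module ℂ M] (f : C₁ →ₗ[ℂ] C₂)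
    (s : Finset ι) (g : ι → M →ₗ[ℂ] C₁) : f ∘ₗ ∑ j ∈ s, g j = ∑ j ∈ s, f ∘ₗ g j := by
  ext x
  simp [LinearMap.sum_apply]

theorem finsetSum_comp {ι M : Type*} [AddCommGroup M] [Module ℂ M] (f : C₁ →ₗ[ℂ] C₂)
    (s : Finset ι) (g : ι → C₂ →ₗ[ℂ] M) : (∑ j ∈ s, g j) ∘ₗ f = ∑ j ∈ s, g j ∘ₗ f := by
  ext x
  simp [LinearMap.sum_apply]

theorem koszulSign_zero {n : ℕ} (σ : Equiv.Perm (Fin n)) : koszulSign σ (fun _ => 0) = 1 := by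
  simp [koszulSign]

theorem prod_intersperse_replicate [Ring R] (x y : R) (k : ℕ) :
    ((List.replicate (k + 1) x).intersperse y).prod = (x * y) ^ k * x := by
  induction k with
  | zero => simp
  | succ k ih =>
    rw [List.replicate_succ, List.replicate_succ, List.intersperse_cons_cons, ← List.replicate_succ,
      List.prod_cons, List.prod_cons, ih, pow_succ']
    simp only [mul_assoc]

/-- In suspended degree zero all Koszul signs are `1`, and equal arguments make the `(k + 1)!`
summands equal. The shift `m = k + 1` matches the `k` insertions of the homotopy. -/
theorem smul_transfer_const (p : C₁ →ₗ[ℂ] C₂) (h : Module.End ℂ C₁) (i : C₂ →ₗ[ℂ] C₁) (k : ℕ)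
    (a : MvPowerSeries κ (Module.End ℂ C₁)) :
    (1 / ((k + 1).factorial : ℂ)) • transfer p h i (n := k + 1) (fun _ => 0) (fun _ => a)
      = compress p i ((a * MvPowerSeries.C h) ^ k * a) := by
  have hk : ((k + 1).factorial : ℂ) ≠ 0 := by exact_mod_cast Nat.factorial_ne_zero _
  simp only [transfer, koszulSign_zero, one_smul, List.ofFn_const, prod_intersperse_replicate,
    Finset.sum_const, Finset.card_univ, Fintype.card_perm, Fintype.card_fin]
  rw [← Nat.cast_smul_eq_nsmul ℂ, smul_smul, one_div, inv_mul_cancel₀ hk, one_smul]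

/-- `f ∘ X = Y ∘ f`, coefficient by coefficient. -/
def Intertwines (f : C₁ →ₗ[ℂ] C₂) (X : MvPowerSeries κ (Module.End ℂ C₁))
    (Y : MvPowerSeries κ (Module.End ℂ C₂)) : Prop :=
  ∀ m, f ∘ₗ MvPowerSeries.coeff m X = MvPowerSeries.coeff m Y ∘ₗ f

namespace Intertwines

variable {f : C₁ →ₗ[ℂ] C₂} {X X' : MvPowerSeries κ (Module.End ℂ C₁)}
  {Y Y' : MvPowerSeries κ (Module.End ℂ C₂)}

theorem C {x : Module.End ℂ C₁} {y : Module.End ℂ C₂} (h : f ∘ₗ x = y ∘ₗ f) :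
    Intertwines (κ := κ) f (MvPowerSeries.C x) (MvPowerSeries.C y) := by
  classical
  intro m
  rw [MvPowerSeries.coeff_C, MvPowerSeries.coeff_C]
  split_ifs
  · exact h
  · rw [LinearMap.comp_zero, LinearMap.zero_comp]

theorem sub (h : Intertwines f X Y) (h' : Intertwines f X' Y') :
    Intertwines f (X - X') (Y - Y') := fun m => by
  rw [map_sub, map_sub, LinearMap.comp_sub, LinearMap.sub_comp, h m, h' m]

theorem mul (h : Intertwines f X Y) (h' : Intertwines f X' Y') :
    Intertwines f (X * X') (Y * Y') := fun m => by
  classical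
  rw [MvPowerSeries.coeff_mul, MvPowerSeries.coeff_mul, finsetSum_comp, comp_finsetSum]
  refine Finset.sum_congr rfl fun p _ => ?_
  rw [Module.End.mul_eq_comp, Module.End.mul_eq_comp, ← LinearMap.comp_assoc, h, LinearMap.comp_assoc,
    h', LinearMap.comp_assoc]

theorem one : Intertwines (κ := κ) f 1 1 := by
  have := C (κ := κ) (f := f) (x := 1) (y := 1) (LinearMap.ext fun _ => rfl)
  rwa [map_one, map_one] at this

/-- Left cancellation by induction on the exponent: the only new term in the coefficient at `m` is
the one multiplied by the constant coefficient of `Y`. -/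
theorem of_mul (h : Intertwines f X Y) (h' : Intertwines f (X * X') (Y * Y'))
    (hY : MvPowerSeries.constantCoeff Y = 1) : Intertwines f X' Y' := by
  classical
  intro m
  induction m using WellFoundedLT.induction with
  | ind m ih =>
  have e := h' m
  rw [MvPowerSeries.coeff_mul, MvPowerSeries.coeff_mul, finsetSum_comp, comp_finsetSum,
    ← sub_eq_zero, ← Finset.sum_sub_distrib, Finset.sum_eq_single (0, m)] at e
  · rw [Module.End.mul_eq_comp, Module.End.mul_eq_comp, ← LinearMap.comp_assoc, h,
      MvPowerSeries.coeff_zero_eq_constantCoeff_apply, hY] at e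
    exact sub_eq_zero.mp e
  · intro p hp hp0
    rw [Finset.HasAntidiagonal.mem_antidiagonal] at hp
    have hlt : p.2 < m := by
      refine lt_of_le_of_ne (hp ▸ le_add_self) fun h0 => hp0 (Prod.ext ?_ h0)
      rw [h0] at hp
      exact add_eq_right.mp hp
    rw [Module.End.mul_eq_comp, Module.End.mul_eq_comp, ← LinearMap.comp_assoc, h,
      LinearMap.comp_assoc, ih _ hlt, LinearMap.comp_assoc, sub_self]
  · intro h0
    simp at h0

end Intertwines

section Series

variable {S : Type*} [Ring R] [Ring S] [Algebra ℂ R] [Algebra ℂ S] {l r : R →ₐ[ℂ] S}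

theorem C_smul (a : ℂ) (x : R) :
    (MvPowerSeries.C (a • x) : MvPowerSeries κ R) = a • MvPowerSeries.C x := by
  classical
  ext1 m
  change _ = a • MvPowerSeries.coeff m (MvPowerSeries.C x)
  rw [MvPowerSeries.coeff_C, MvPowerSeries.coeff_C]
  split_ifs <;> simp

theorem mapAlgHom_C (l : R →ₐ[ℂ] S) (x : R) :
    MvPowerSeries.mapAlgHom (σ := κ) l (MvPowerSeries.C x) = MvPowerSeries.C (l x) :=
  MvPowerSeries.map_C _ _

theorem coeff_mapAlgHom (l : R →ₐ[ℂ] S) (X : MvPowerSeries κ R) (m : κ →₀ ℕ) :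
    MvPowerSeries.coeff m (MvPowerSeries.mapAlgHom l X) = l (MvPowerSeries.coeff m X) := rfl

theorem mapAlgHom_comm (h : ∀ x y, l x * r y = r y * l x) (X Y : MvPowerSeries κ R) :
    MvPowerSeries.mapAlgHom l X * MvPowerSeries.mapAlgHom r Y
      = MvPowerSeries.mapAlgHom r Y * MvPowerSeries.mapAlgHom l X := by
  classical
  ext1 m
  rw [MvPowerSeries.coeff_mul, MvPowerSeries.coeff_mul, Finsupp.sum_antidiagonal_swap m fun a b => MvPowerSeries.coeff a
    (MvPowerSeries.mapAlgHom r Y) * MvPowerSeries.coeff b (MvPowerSeries.mapAlgHom l X)]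
  refine Finset.sum_congr rfl fun p _ => ?_
  simp only [MvPowerSeries.mapAlgHom_apply, MvPowerSeries.coeff_map]
  exact h _ _


variable {p t u : R} {δ v N : MvPowerSeries κ R}

theorem perturbed_image_comul_series (hc : ∀ x y, l x * r y = r y * l x) (ht : t * t = 1)
    (hut : u * t = -(t * u)) (α : ℂ) (hv : v = MvPowerSeries.C p + MvPowerSeries.C u * δ * v)
    (huv : MvPowerSeries.C u * v = 0) (hpv : MvPowerSeries.C p * v = MvPowerSeries.C p) :
    (1 - MvPowerSeries.C (l u * r (α • 1 + (1 - α) • p)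
          + l (((1 - α) • 1 + α • p) * t) * r u)
        * (MvPowerSeries.mapAlgHom l δ + MvPowerSeries.C (l t) * MvPowerSeries.mapAlgHom r δ))
      * (MvPowerSeries.mapAlgHom l v * MvPowerSeries.mapAlgHom r v)
      = MvPowerSeries.C (l p * r p) := by
  have e := perturbed_image_comul (mapAlgHom_comm (κ := κ) hc)
    (t := MvPowerSeries.C t) (by rw [← map_mul, ht, map_one])
    (U := MvPowerSeries.C u) (by rw [← map_mul, ← map_mul, ← map_neg, hut]) α hv huv hpv
  have h1 : ∀ a b : ℂ, (a • 1 + b • MvPowerSeries.C p : MvPowerSeries κ R)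
      = MvPowerSeries.C (a • 1 + b • p) := fun a b => by
    rw [map_add, C_smul, C_smul, map_one]
  rw [h1, h1, ← map_mul MvPowerSeries.C] at e
  simpa only [mapAlgHom_C, ← map_mul MvPowerSeries.C, ← map_add MvPowerSeries.C] using e

/-- By `p v = p`, the projection `p ⊗ p` reduces `v` to `p` on the leg that `δ` does not hit. -/
theorem coeff_coderivation_mul (hc : ∀ x y, l x * r y = r y * l x) (hpt : p * t = t * p)
    (hpv : MvPowerSeries.C p * v = MvPowerSeries.C p) (m : κ →₀ ℕ) :
    l p * r p * MvPowerSeries.coeff m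
        ((MvPowerSeries.mapAlgHom l δ + MvPowerSeries.C (l t) * MvPowerSeries.mapAlgHom r δ)
          * (MvPowerSeries.mapAlgHom l v * MvPowerSeries.mapAlgHom r v))
      = l (p * MvPowerSeries.coeff m (δ * v)) * r p
        + l (t * p) * r (p * MvPowerSeries.coeff m (δ * v)) := by
  have hc' := mapAlgHom_comm (κ := κ) hc
  have e1 := tens_mul hc' δ 1 v v
  have e2 := tens_mul hc' (MvPowerSeries.C t) δ v v
  have e3 := tens_mul hc' (MvPowerSeries.C p) (MvPowerSeries.C p) (δ * v) (1 * v)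
  have e4 := tens_mul hc' (MvPowerSeries.C p) (MvPowerSeries.C p) (MvPowerSeries.C t * v) (δ * v)
  have hpt' : MvPowerSeries.C p * (MvPowerSeries.C t * v) = MvPowerSeries.C (t * p) := by
    rw [← mul_assoc, ← map_mul, hpt, map_mul, mul_assoc, hpv]
  rw [map_one, mul_one] at e1
  rw [one_mul, hpv] at e3
  rw [hpt'] at e4
  rw [one_mul] at e1
  have e : MvPowerSeries.C (l p * r p)
        * ((MvPowerSeries.mapAlgHom l δ + MvPowerSeries.C (l t) * MvPowerSeries.mapAlgHom r δ)
          * (MvPowerSeries.mapAlgHom l v * MvPowerSeries.mapAlgHom r v))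
      = MvPowerSeries.mapAlgHom l (MvPowerSeries.C p * (δ * v)) * MvPowerSeries.C (r p)
        + MvPowerSeries.C (l (t * p)) * MvPowerSeries.mapAlgHom r (MvPowerSeries.C p * (δ * v)) := by
    rw [map_mul MvPowerSeries.C]
    simp only [← mapAlgHom_C]
    rw [add_mul, e1, e2, mul_add, e3, e4]
  rw [← MvPowerSeries.coeff_C_mul, e, map_add, MvPowerSeries.coeff_mul_C,
    MvPowerSeries.coeff_C_mul, coeff_mapAlgHom, coeff_mapAlgHom, MvPowerSeries.coeff_C_mul]

end Series

section Series

variable [Ring R] {p t u : R} {δ N : MvPowerSeries κ R}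

/-- The witness `v = (1 + u N δ) p` is the perturbed inclusion composed with the projection, and `δ
v = N δ p` expresses the transferred operator through it. -/
theorem exists_perturbed_image (huu : u * u = 0) (hup : u * p = 0) (hpu : p * u = 0)
    (hpp : p * p = p)
    (hN' : (1 - δ * MvPowerSeries.C u) * N = 1) :
    ∃ v, v = MvPowerSeries.C p + MvPowerSeries.C u * δ * v ∧ MvPowerSeries.C u * v = 0 ∧
      MvPowerSeries.C p * v = MvPowerSeries.C p ∧
      ∀ m, MvPowerSeries.coeff m (δ * v) = MvPowerSeries.coeff m (N * δ) * p := by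
  have huu' : (MvPowerSeries.C u * MvPowerSeries.C u : MvPowerSeries κ R) = 0 := by
    rw [← map_mul, huu, map_zero]
  have hup' : (MvPowerSeries.C u * MvPowerSeries.C p : MvPowerSeries κ R) = 0 := by
    rw [← map_mul, hup, map_zero]
  have hpu' : (MvPowerSeries.C p * MvPowerSeries.C u : MvPowerSeries κ R) = 0 := by
    rw [← map_mul, hpu, map_zero]
  have hpp' : (MvPowerSeries.C p * MvPowerSeries.C p : MvPowerSeries κ R)
      = MvPowerSeries.C p := by
    rw [← map_mul, hpp]
  have hA : N * δ = δ + δ * MvPowerSeries.C u * (N * δ) := by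
    linear_combination (norm := noncomm_ring) hN' * δ
  have hδv : δ * ((1 + MvPowerSeries.C u * (N * δ)) * MvPowerSeries.C p)
      = N * δ * MvPowerSeries.C p := by
    linear_combination (norm := noncomm_ring) -(hA * MvPowerSeries.C p)
  refine ⟨(1 + MvPowerSeries.C u * (N * δ)) * MvPowerSeries.C p, ?_, ?_, ?_, fun m => ?_⟩
  · rw [mul_assoc _ δ, hδv]
    noncomm_ring
  · linear_combination (norm := noncomm_ring) hup' + huu' * (N * δ) * MvPowerSeries.C p
  · linear_combination (norm := noncomm_ring) hpp' + hpu' * (N * δ) * MvPowerSeries.C p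
  · rw [hδv, MvPowerSeries.coeff_mul_C]

theorem coeff_perturbed_odd (hut : u * t = -(t * u))
    (hδt : ∀ m, MvPowerSeries.coeff m δ * t = -(t * MvPowerSeries.coeff m δ))
    (hN : N * (1 - δ * MvPowerSeries.C u) = 1)
    (hN' : (1 - δ * MvPowerSeries.C u) * N = 1) (m : κ →₀ ℕ) :
    MvPowerSeries.coeff m (N * δ) * t = -(t * MvPowerSeries.coeff m (N * δ)) := by
  have h : δ * MvPowerSeries.C t = -(MvPowerSeries.C t * δ) := by
    ext1 m
    rw [map_neg, MvPowerSeries.coeff_C_mul, MvPowerSeries.coeff_mul_C, hδt]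
  have hNt := perturbed_inverse_comm hN hN' h
    (by rw [← map_mul, ← map_mul, ← map_neg, hut])
  rw [← MvPowerSeries.coeff_mul_C, ← MvPowerSeries.coeff_C_mul, ← map_neg, mul_assoc, h, mul_neg,
    ← mul_assoc, hNt, mul_assoc]

theorem series_perturbation_sq {d : R} (hN : N * (1 - δ * MvPowerSeries.C u) = 1)
    (hN' : (1 - δ * MvPowerSeries.C u) * N = 1) (hp : p = 1 + (d * u + u * d))
    (hδ : MvPowerSeries.C d * δ + δ * MvPowerSeries.C d + δ * δ = 0) :
    MvPowerSeries.C d * (N * δ) + N * δ * MvPowerSeries.C d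
      + N * δ * MvPowerSeries.C p * (N * δ) = 0 :=
  perturbation_sq hN hN' rfl (by rw [hp]; simp only [map_add, map_one, map_mul, add_assoc]) hδ

end Series

end Formal

/-! ### The off-shell deformation as a Maurer-Cartan element. -/

section Bulk

variable {κ : Type*} {N n : ℕ} {W : MvPolynomial (Fin N) ℂ} {D : Supermatrix N n}

theorem IsOddCoderivation.sum {V ι : Type*} [AddCommGroup V] [Module ℂ V] {τ : V →ₗ[ℂ] V}
    {s : Finset ι} {X : ι → Module.End ℂ (TensorAlgebra ℂ V)}
    (h : ∀ i ∈ s, IsOddCoderivation τ (X i)) : IsOddCoderivation τ (∑ i ∈ s, X i) :=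
  Finset.sum_induction _ _ (fun _ _ => IsOddCoderivation.add) IsOddCoderivation.zero h

theorem isOddCoderivation_coeff_C {V : Type*} [AddCommGroup V] [Module ℂ V] {τ : V →ₗ[ℂ] V}
    {X : Module.End ℂ (TensorAlgebra ℂ V)} (h : IsOddCoderivation τ X) (m : κ →₀ ℕ) :
    IsOddCoderivation τ (MvPowerSeries.coeff m (MvPowerSeries.C X)) := by
  classical
  rw [MvPowerSeries.coeff_C]
  split_ifs
  exacts [h, IsOddCoderivation.zero]

variable [Fintype κ] (φ : κ → MvPolynomial (Fin N) ℂ)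

theorem isOddCoderivation_coeff_offShellDeformation (m : κ →₀ ℕ) :
    IsOddCoderivation (tauA (N := N) (n := n))
      (MvPowerSeries.coeff m (offShellDeformation φ)) := by
  classical
  rw [offShellDeformation, map_sum]
  refine IsOddCoderivation.sum fun i _ => ?_
  rw [MvPowerSeries.coeff_monomial]
  split_ifs
  exacts [isOddCoderivation_insertion _, IsOddCoderivation.zero]

theorem constantCoeff_offShellDeformation : MvPowerSeries.constantCoeff
    (offShellDeformation (n := n) φ) = 0 := by
  classical
  rw [offShellDeformation, map_sum]
  refine Finset.sum_eq_zero fun i _ => ?_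
  rw [← MvPowerSeries.coeff_zero_eq_constantCoeff_apply, MvPowerSeries.coeff_monomial, if_neg]
  intro h
  simpa using DFunLike.congr_fun h i

theorem C_offShell_offShellDeformation (hD : IsMatrixFactorisation W D) :
    MvPowerSeries.C (offShell D) * offShellDeformation φ
      + offShellDeformation φ * MvPowerSeries.C (offShell D) = 0 := by
  rw [offShellDeformation, Finset.mul_sum, Finset.sum_mul, ← Finset.sum_add_distrib]
  refine Finset.sum_eq_zero fun i _ => ?_
  rw [← MvPowerSeries.monomial_zero_eq_C_apply, MvPowerSeries.monomial_mul_monomial,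
    MvPowerSeries.monomial_mul_monomial, add_zero, zero_add, ← map_add, offShell_insertion _ hD,
    map_zero]

theorem offShellDeformation_sq :
    (offShellDeformation φ * offShellDeformation φ :
      MvPowerSeries κ (Module.End ℂ (TensorAlgebra ℂ (Supermatrix N n)))) = 0 := by
  set δ : MvPowerSeries κ (Module.End ℂ (TensorAlgebra ℂ (Supermatrix N n))) :=
    offShellDeformation φ with hδ
  have h : δ * δ + δ * δ = 0 := by
    rw [hδ, offShellDeformation, Finset.sum_mul_sum]
    -- Swapping the summation in one copy of `δ δ` pairs `(i, j)` with `(j, i)`, so that each pair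
    -- is an anticommutator of insertions.
    conv_lhs => arg 2; rw [Finset.sum_comm]
    rw [← Finset.sum_add_distrib]
    refine Finset.sum_eq_zero fun i _ => ?_
    rw [← Finset.sum_add_distrib]
    refine Finset.sum_eq_zero fun j _ => ?_
    rw [MvPowerSeries.monomial_mul_monomial, MvPowerSeries.monomial_mul_monomial,
      add_comm (Finsupp.single j 1), ← map_add, insertion_insertion, map_zero]
  rw [← two_smul ℂ] at h
  exact (smul_eq_zero.mp h).resolve_left two_ne_zero

theorem offShellDeformation_maurerCartan (hD : IsMatrixFactorisation W D) :
    MvPowerSeries.C (offShell D) * offShellDeformation φ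
      + offShellDeformation φ * MvPowerSeries.C (offShell D)
      + offShellDeformation φ * offShellDeformation φ = 0 := by
  rw [C_offShell_offShellDeformation φ hD, offShellDeformation_sq, add_zero]

theorem isCurvedAInfinity_offShell (hD : IsMatrixFactorisation W D) :
    IsCurvedAInfinity tauA (MvPowerSeries.C (offShell D) + offShellDeformation φ) where
  coder m := by
    rw [map_add]
    exact (isOddCoderivation_coeff_C (isOddCoderivation_offShell hD) m).add
      (isOddCoderivation_coeff_offShellDeformation φ m)
  sq := by
    have h : (MvPowerSeries.C (offShell D) * MvPowerSeries.C (offShell D) :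
        MvPowerSeries κ (Module.End ℂ (TensorAlgebra ℂ (Supermatrix N n)))) = 0 := by
      rw [← map_mul, offShell_sq hD, map_zero]
    linear_combination (norm := noncomm_ring) h + offShellDeformation_maurerCartan φ hD

end Bulk

/-! ### Transfer of the deformation to `T_H`. -/

section Transfer

variable {κ : Type*} {n₀ n : ℕ} {W : MvPolynomial (Fin n₀) ℂ} {D : Supermatrix n₀ n}
  {S : Splitting tauA (brst D)} {α : ℂ}
  {F : TensorAlgebra ℂ S.H →ₗ[ℂ] TensorAlgebra ℂ (Supermatrix n₀ n)}
  {dt : Module.End ℂ (TensorAlgebra ℂ S.H)}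
  {Fb : TensorAlgebra ℂ (Supermatrix n₀ n) →ₗ[ℂ] TensorAlgebra ℂ S.H}
  {U : Module.End ℂ (TensorAlgebra ℂ (Supermatrix n₀ n))}
  {δ N : MvPowerSeries κ (Module.End ℂ (TensorAlgebra ℂ (Supermatrix n₀ n)))}

theorem Intertwines.coderivation_comul
    (hδ : ∀ m, IsOddCoderivation tauA (MvPowerSeries.coeff m δ)) :
    Intertwines deconcat δ (MvPowerSeries.mapAlgHom actL δ
      + MvPowerSeries.C (actL (tauT tauA)) * MvPowerSeries.mapAlgHom actR δ) := fun m => by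
  rw [((isOddCoderivation_iff _).mp (hδ m)).2, map_add, MvPowerSeries.coeff_C_mul]
  rfl

/-- `(1 - U δ) v = F F̄` is compatible with the coproduct, and so is `1 - U δ`, whose constant
coefficient is `1`; hence it can be cancelled. -/
theorem IsRetraction.intertwines_perturbed_image (hm : IsMinimalModel S F dt)
    (h : IsRetraction S α F dt Fb U)
    (hδ : ∀ m, IsOddCoderivation tauA (MvPowerSeries.coeff m δ))
    (hδ0 : MvPowerSeries.constantCoeff δ = 0)
    {v : MvPowerSeries κ (Module.End ℂ (TensorAlgebra ℂ (Supermatrix n₀ n)))}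
    (hv : v = MvPowerSeries.C (F ∘ₗ Fb) + MvPowerSeries.C U * δ * v)
    (hUv : MvPowerSeries.C U * v = 0)
    (hPv : MvPowerSeries.C (F ∘ₗ Fb) * v = MvPowerSeries.C (F ∘ₗ Fb)) :
    Intertwines deconcat v
      (MvPowerSeries.mapAlgHom actL v * MvPowerSeries.mapAlgHom actR v) := by
  have hU : deconcat ∘ₗ U = homotopyAct tauA α (F ∘ₗ Fb) U ∘ₗ deconcat := by
    rw [homotopyAct_eq, h.comul]
  refine Intertwines.of_mul (Intertwines.one.sub
    ((Intertwines.C hU).mul (Intertwines.coderivation_comul hδ))) ?_ ?_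
  · have e := perturbed_image_comul_series
      (R := Module.End ℂ (TensorAlgebra ℂ (Supermatrix n₀ n)))
      (S := Module.End ℂ (TensorAlgebra ℂ (Supermatrix n₀ n)
        ⊗[ℂ] TensorAlgebra ℂ (Supermatrix n₀ n)))
      (l := actL) (r := actR) act_comm (tauT_sq tauA_tauA) h.odd α hv hUv hPv
    have hl : (1 - MvPowerSeries.C U * δ) * v = MvPowerSeries.C (F ∘ₗ Fb) := by
      rw [sub_mul, one_mul, sub_eq_iff_eq_add]
      exact hv
    rw [hl]
    refine (congrArg (Intertwines _ _) e).mpr (Intertwines.C ?_)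
    rw [← map_eq_act, ← LinearMap.comp_assoc, hm.coalgHom.comul, LinearMap.comp_assoc,
      h.coalgHom.comul, TensorProduct.map_comp, LinearMap.comp_assoc]
  · have hz : ∀ l : Module.End ℂ (TensorAlgebra ℂ (Supermatrix n₀ n)) →ₐ[ℂ]
        Module.End ℂ (TensorAlgebra ℂ (Supermatrix n₀ n)
          ⊗[ℂ] TensorAlgebra ℂ (Supermatrix n₀ n)),
        MvPowerSeries.constantCoeff (MvPowerSeries.mapAlgHom l δ) = 0 := fun l => by
      rw [← MvPowerSeries.coeff_zero_eq_constantCoeff_apply] at hδ0 ⊢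
      exact (congrArg l hδ0).trans (map_zero l)
    rw [map_sub, map_mul, map_add, map_mul, map_one, hz, hz, mul_zero, add_zero, mul_zero]
    exact sub_zero (1 : Module.End ℂ (TensorAlgebra ℂ (Supermatrix n₀ n)
      ⊗[ℂ] TensorAlgebra ℂ (Supermatrix n₀ n)))

/-- `F̄ N δ F = F̄ δ v F`, where `δ` is a coderivation and `Δ v = (v ⊗ v) Δ`. Since `F̄ v = F̄`, the
leg without `δ` becomes `F̄ F = id`. -/
theorem IsRetraction.isOddCoderivation_compress (hm : IsMinimalModel S F dt)
    (h : IsRetraction S α F dt Fb U)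
    (hδ : ∀ m, IsOddCoderivation tauA (MvPowerSeries.coeff m δ))
    (hδ0 : MvPowerSeries.constantCoeff δ = 0)
    (hN : N * (1 - δ * MvPowerSeries.C U) = 1) (hN' : (1 - δ * MvPowerSeries.C U) * N = 1)
    (m : κ →₀ ℕ) :
    IsOddCoderivation S.tauH (MvPowerSeries.coeff m (compress Fb F (N * δ))) := by
  obtain ⟨hUU, hUF, hFbU⟩ := h.standard hm
  have hFbF : ∀ x, Fb (F x) = x := fun x => DFunLike.congr_fun h.leftInv x
  have hFt : ∀ x, F (tauT S.tauH x) = tauT tauA (F x) :=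
    fun x => DFunLike.congr_fun hm.coalgHom.even x
  have hFbt : ∀ x, Fb (tauT tauA x) = tauT S.tauH (Fb x) :=
    fun x => DFunLike.congr_fun h.coalgHom.even x
  have hAt := coeff_perturbed_odd h.odd (fun m => (hδ m).odd) hN hN' m
  have hPt : (F ∘ₗ Fb) * tauT tauA = tauT tauA * (F ∘ₗ Fb) :=
    LinearMap.ext fun x => by simp [hFt, hFbt]
  obtain ⟨v, hv, hUv, hPv, hδv⟩ := exists_perturbed_image (u := U) (p := F ∘ₗ Fb) hUU
    (by rw [Module.End.mul_eq_comp, ← LinearMap.comp_assoc, hUF, LinearMap.zero_comp])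
    (by rw [Module.End.mul_eq_comp, LinearMap.comp_assoc, hFbU, LinearMap.comp_zero])
    (LinearMap.ext fun x => by simp [hFbF]) hN'
  have hcomul := (Intertwines.coderivation_comul hδ).mul
    (h.intertwines_perturbed_image hm hδ hδ0 hv hUv hPv) m
  have hcoeff := coeff_coderivation_mul
    (R := Module.End ℂ (TensorAlgebra ℂ (Supermatrix n₀ n)))
    (S := Module.End ℂ (TensorAlgebra ℂ (Supermatrix n₀ n)
      ⊗[ℂ] TensorAlgebra ℂ (Supermatrix n₀ n)))
    (l := actL) (r := actR) (δ := δ) act_comm hPt hPv m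
  rw [hδv m] at hcoeff hcomul
  rw [coeff_compress]
  generalize MvPowerSeries.coeff m (N * δ) = a at *
  generalize MvPowerSeries.coeff m ((MvPowerSeries.mapAlgHom actL δ
        + MvPowerSeries.C (actL (tauT tauA)) * MvPowerSeries.mapAlgHom actR δ)
        * (MvPowerSeries.mapAlgHom actL v * MvPowerSeries.mapAlgHom actR v)) = Z
    at hcoeff hcomul
  constructor
  · refine LinearMap.ext fun x => ?_
    have := DFunLike.congr_fun hAt (F x)
    simp only [Module.End.mul_apply, LinearMap.neg_apply] at this
    simp [hFt, this, hFbt]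
  · have hX : Fb ∘ₗ a ∘ₗ F = Fb ∘ₗ (a * (F ∘ₗ Fb)) ∘ₗ F :=
      LinearMap.ext fun x => by simp [hFbF]
    have hPP : TensorProduct.map Fb Fb ∘ₗ (actL (F ∘ₗ Fb) * actR (F ∘ₗ Fb))
        = TensorProduct.map Fb Fb := by
      rw [← map_eq_act, ← TensorProduct.map_comp, ← LinearMap.comp_assoc, h.leftInv,
        LinearMap.id_comp]
    have e1 : deconcat ∘ₗ Fb ∘ₗ (a * (F ∘ₗ Fb)) ∘ₗ F = TensorProduct.map Fb Fb
        ∘ₗ ((actL (F ∘ₗ Fb) * actR (F ∘ₗ Fb)) * Z) ∘ₗ TensorProduct.map F F ∘ₗ deconcat := by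
      rw [← hm.coalgHom.comul, Module.End.mul_eq_comp (actL (F ∘ₗ Fb) * actR (F ∘ₗ Fb)),
        LinearMap.comp_assoc, ← LinearMap.comp_assoc _ _ (TensorProduct.map Fb Fb), hPP,
        ← LinearMap.comp_assoc _ Fb deconcat,
        h.coalgHom.comul, ← LinearMap.comp_assoc _ deconcat Z, ← hcomul]
      simp only [LinearMap.comp_assoc]
    rw [hX, e1, hcoeff]
    simp only [← LinearMap.comp_assoc]
    congr 1
    refine TensorProduct.ext' fun x y => ?_
    rw [← map_eq_act, ← map_eq_act]
    simp [tensorOdd, hFbF, hFbt]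

/-- With `A = N δ`, moving `∂̃` through `F̄` and `F` turns the square into `F̄ (∂ A + A ∂ + A F F̄
A) F`, which vanishes by the perturbation lemma. -/
theorem IsRetraction.compress_sq (hm : IsMinimalModel S F dt) (h : IsRetraction S α F dt Fb U)
    (hδ : MvPowerSeries.C (offShell D) * δ + δ * MvPowerSeries.C (offShell D) + δ * δ = 0)
    (hN : N * (1 - δ * MvPowerSeries.C U) = 1) (hN' : (1 - δ * MvPowerSeries.C U) * N = 1) :
    (MvPowerSeries.C dt + compress Fb F (N * δ)) * (MvPowerSeries.C dt + compress Fb F (N * δ))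
      = 0 := by
  have e := series_perturbation_sq (p := F ∘ₗ Fb) hN hN' (sub_eq_iff_eq_add'.mp h.homotopy) hδ
  have hdt : (MvPowerSeries.C dt * MvPowerSeries.C dt : MvPowerSeries κ _) = 0 := by
    rw [← map_mul, Module.End.mul_eq_comp, hm.aInfinity.sq, map_zero]
  rw [add_mul, mul_add, mul_add, hdt, zero_add, ← compress_C_mul h.comm, ← compress_mul_C hm.comm,
    compress_mul_compress, ← compress_add, ← compress_add, ← add_assoc, e, compress_zero]

theorem IsRetraction.isCurvedAInfinity_compress (hm : IsMinimalModel S F dt)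
    (h : IsRetraction S α F dt Fb U)
    (hδ : ∀ m, IsOddCoderivation tauA (MvPowerSeries.coeff m δ))
    (hδ0 : MvPowerSeries.constantCoeff δ = 0)
    (hMC : MvPowerSeries.C (offShell D) * δ + δ * MvPowerSeries.C (offShell D) + δ * δ = 0)
    (hN : N * (1 - δ * MvPowerSeries.C U) = 1) (hN' : (1 - δ * MvPowerSeries.C U) * N = 1) :
    IsCurvedAInfinity S.tauH (MvPowerSeries.C dt + compress Fb F (N * δ)) where
  coder m := by
    rw [map_add]
    exact (isOddCoderivation_coeff_C hm.aInfinity.coder m).add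
      (h.isOddCoderivation_compress hm hδ hδ0 hN hN' m)
  sq := h.compress_sq hm hMC hN hN'

end Transfer

end LGBulk

/-! ### The main theorem. -/

theorem theorem3p8 {N n : ℕ} (W : MvPolynomial (Fin N) ℂ)
    (D : LGBulk.Supermatrix N n) (hD : LGBulk.IsMatrixFactorisation W D)
    {κ : Type*} [Fintype κ] (b : Module.Basis κ ℂ (LGBulk.Jac W))
    (φ : κ → MvPolynomial (Fin N) ℂ)
    (hφ : ∀ i, Ideal.Quotient.mk (LGBulk.jacobianIdeal W) (φ i) = b i)
    (S : LGBulk.Splitting LGBulk.tauA (LGBulk.brst D)) :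
    -- the off-shell deformation
    LGBulk.IsCurvedAInfinity LGBulk.tauA
      (MvPowerSeries.C (LGBulk.offShell D) + LGBulk.offShellDeformation φ) ∧
    -- the minimal model exists and is unique
    (∃! q : (TensorAlgebra ℂ S.H →ₗ[ℂ] TensorAlgebra ℂ (LGBulk.Supermatrix N n)) ×
        Module.End ℂ (TensorAlgebra ℂ S.H), LGBulk.IsMinimalModel S q.1 q.2) ∧
    ∀ F dt, LGBulk.IsMinimalModel S F dt →
      -- retraction data of type 0 and of type 1 exist and are unique
      (∀ α : ℂ, α = 0 ∨ α = 1 →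
        ∃! q : (TensorAlgebra ℂ (LGBulk.Supermatrix N n) →ₗ[ℂ] TensorAlgebra ℂ S.H) ×
          Module.End ℂ (TensorAlgebra ℂ (LGBulk.Supermatrix N n)),
          LGBulk.IsRetraction S α F dt q.1 q.2) ∧
      ∀ (α : ℂ) Fb U, LGBulk.IsRetraction S α F dt Fb U →
        -- the homotopy is in standard form
        (U ∘ₗ U = 0 ∧ U ∘ₗ F = 0 ∧ Fb ∘ₗ U = 0) ∧
        -- the bulk-induced deformation and its closed forms
        ∃ δt : MvPowerSeries κ (Module.End ℂ (TensorAlgebra ℂ S.H)),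
          LGBulk.HasFormalSum
            (fun k => (1 / ((k + 1).factorial : ℂ)) •
              LGBulk.transfer Fb U F (n := k + 1) (fun _ => 0)
                (fun _ => LGBulk.offShellDeformation φ)) δt ∧
          LGBulk.HasFormalSum
            (fun k => LGBulk.compress Fb F
              ((LGBulk.offShellDeformation φ * MvPowerSeries.C U) ^ k *
                LGBulk.offShellDeformation φ)) δt ∧
          IsUnit (1 - LGBulk.offShellDeformation φ * MvPowerSeries.C U) ∧
          δt = LGBulk.compress Fb F
            (Ring.inverse (1 - LGBulk.offShellDeformation φ * MvPowerSeries.C U) *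
              LGBulk.offShellDeformation φ) ∧
          LGBulk.IsCurvedAInfinity S.tauH (MvPowerSeries.C dt + δt) := by
  refine ⟨LGBulk.isCurvedAInfinity_offShell φ hD, LGBulk.IsMinimalModel.existsUnique hD,
    fun F dt hm => ⟨fun α hα => LGBulk.IsRetraction.existsUnique hD hm hα,
      fun α Fb U h => ⟨h.standard hm, ?_⟩⟩⟩
  have hδ0 := LGBulk.constantCoeff_offShellDeformation (n := n) φ
  have hX0 : MvPowerSeries.constantCoeff
      (LGBulk.offShellDeformation (n := n) φ * MvPowerSeries.C U) = 0 := by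
    rw [map_mul, hδ0, zero_mul]
  -- A power series is invertible as soon as its constant coefficient is, and here that coefficient
  -- is `1` since `δ` is linear in the parameters. No nilpotency of `δ U` on `T_A` is needed.
  have hu : IsUnit (1 - LGBulk.offShellDeformation φ * MvPowerSeries.C U) := by
    rw [MvPowerSeries.isUnit_iff_constantCoeff, map_sub, hX0, map_one, sub_zero]
    exact isUnit_one
  have hN := Ring.inverse_mul_cancel _ hu
  have hN' := Ring.mul_inverse_cancel _ hu
  set N' := Ring.inverse (1 - LGBulk.offShellDeformation φ * MvPowerSeries.C U)
  have hsum : LGBulk.HasFormalSum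
      (fun k => LGBulk.compress Fb F
        ((LGBulk.offShellDeformation φ * MvPowerSeries.C U) ^ k * LGBulk.offShellDeformation φ))
      (LGBulk.compress Fb F (N' * LGBulk.offShellDeformation φ)) :=
    (LGBulk.HasFormalSum.of_geometric hX0 hN').compress Fb F
  refine ⟨LGBulk.compress Fb F (N' * LGBulk.offShellDeformation φ), ?_, hsum, hu, rfl,
    h.isCurvedAInfinity_compress hm (LGBulk.isOddCoderivation_coeff_offShellDeformation φ) hδ0
      (LGBulk.offShellDeformation_maurerCartan φ hD) hN hN'⟩
  -- The defining series and the geometric series agree term by term.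
  simpa only [LGBulk.smul_transfer_const] using hsum
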